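/- Let $F$ be a non-archimedean local field of characteristic different from $2$, with residue field of cardinality $q$, normalised absolute value $|\cdot|_F$ and ring of integers $O_F$; let $E/F$ be a quadratic field extension and let $\eta_{E/F}$ be the character of $F^*$ with values in $\{\pm1\}$ whose kernel is the group of norms of $E^*$. Let $D$ be a division algebra with centre $F$ and of dimension $d^2$ over $F$, with $d$ odd, so that $D_E=D\otimes_F E$ is again a division algebra; let $O_{D_E}$ be its ring of integers. Put $G=GL(2,D_E)$, $H=GL(2,D)\subset G$, $K=GL(2,O_{D_E})$, let $P$ be the group of upper triangular matrices in $G$, and let $\delta_P$ be its modulus character, $\delta_P\begin{pmatrix} a & x\\ 0 & b\end{pmatrix}=|\det_F(y\mapsto ayb^{-1}\mid D_E)|_F$. For $s\in\mathbb{C}$ let $\phi_{2,s}:G\to\mathbb{C}$ be the normalised spherical section of the (unnormalised) induced representation $\mathrm{ind}_P^G(\delta_P^s)$, that is, the function well defined by $\phi_{2,s}(pk)=\delta_P(p)^s$ for $p\in P$, $k\in K$. Choose $\lambda\in E\setminus F$ with $\lambda^2\in F$, and put $u_0=\begin{pmatrix}1&-\lambda\\1&\lambda\end{pmatrix}\in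 G$ and $T=u_0^{-1}Pu_0\cap H$. Then $h\mapsto\phi_{2,s}(u_0h)$ is left $T$-invariant, there is a nonzero right $H$-invariant Radon measure $dh$ on $T\backslash H$, and for every such measure the following holds. The integral $$I_2(\phi_{2,s})=\int_{T\backslash H}\phi_{2,s}(u_0h)\,dh$$ converges absolutely for $\mathrm{Re}(s)$ large enough and has a meromorphic continuation to $s\in\mathbb{C}$, still denoted by $I_2(\phi_{2,s})$, and there is a unit $\epsilon$ of the ring $\mathbb{C}[q^{\pm s}]$ such that $$I_2(\phi_{2,s})=\epsilon(s)\,\frac{L(\mathbf{1}_{F^*},d(2s-1))}{L(\eta_{E/F},2ds)},$$ where $L(\chi,s)$ is the Tate $L$-factor of a character $\chi$ of $F^*$: it equals $(1-\chi(\varpi)q^{-s})^{-1}$ if $\chi$ is trivial on $O_F^*$, with $\varpi$ a uniformiser of $F$, and $1$ otherwise. In particular, the continuation is regular at $s=0$ and its value $I_2(\phi_{2,0})$ there is nonzero. -/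

import Mathlib

open scoped TensorProduct
open MeasureTheory ValuativeRel

noncomputable section

namespace IntertwiningPeriod

/-! ### Local field data -/

section LocalField

variable (F : Type*) [Field F] [ValuativeRel F] [TopologicalSpace F]
  [IsNonarchimedeanLocalField F]

/-- The cardinality `q` of the residue field of `F`. -/
def residueCard : ℕ := Nat.card 𝓀[F]

theorem residueCard_ne_zero : (residueCard F : NNReal) ≠ 0 := by
  have : residueCard F ≠ 0 := Nat.card_pos.ne'
  exact_mod_cast this

/-- The normalised absolute value of `F`: a uniformiser has absolute value `q⁻¹`. -/
def absF (x : F) : ℝ :=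
  (WithZeroMulInt.toNNReal (residueCard_ne_zero F)
    (IsNonarchimedeanLocalField.valueGroupWithZeroIsoInt F (valuation F x)) : NNReal)

/-- A uniformiser of `F`, as an element of the ring of integers. -/
def uniformiser : 𝒪[F] := (IsDiscreteValuationRing.exists_irreducible 𝒪[F]).choose

theorem uniformiser_irreducible : Irreducible (uniformiser F) :=
  (IsDiscreteValuationRing.exists_irreducible 𝒪[F]).choose_spec

/-- A uniformiser of `F`, as an element of `Fˣ`. -/
def uniformiserUnit : Fˣ :=
  Units.mk0 (uniformiser F : F) fun h =>
    (uniformiser_irreducible F).ne_zero (Subtype.ext h)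

open scoped Classical in
/-- The Tate `L`-factor `L(χ, s)` of a character `χ` of `Fˣ`: it is `(1 - χ(ϖ) q⁻ˢ)⁻¹` if `χ` is
trivial on the units of the ring of integers, and `1` otherwise. -/
def tateL (χ : Fˣ → ℂ) (s : ℂ) : ℂ :=
  if ∀ u : Fˣ, absF F (u : F) = 1 → χ u = 1 then
    (1 - χ (uniformiserUnit F) * (residueCard F : ℂ) ^ (-s))⁻¹
  else 1

/-- The ring `ℂ[q^{±s}]`, as a ring of functions of `s`. -/
def laurentRing : Subalgebra ℂ (ℂ → ℂ) :=
  Algebra.adjoin ℂ {fun s : ℂ => (residueCard F : ℂ) ^ s, fun s : ℂ => (residueCard F : ℂ) ^ (-s)}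

end LocalField

open scoped Classical in
/-- The quadratic character `η_{E/F}` of `Fˣ` whose kernel is the group of norms of `Eˣ`. -/
def etaChar (F E : Type*) [Field F] [Field E] [Algebra F E] (x : Fˣ) : ℂ :=
  if ∃ y : E, Algebra.norm F y = (x : F) then 1 else -1

/-! ### The group `GL(2, A)` over an `F`-algebra `A` -/

/-- `GL(2, A)` for a ring `A` that need not be commutative. -/
abbrev GL2 (A : Type*) [Ring A] : Type _ := (Matrix (Fin 2) (Fin 2) A)ˣ

/-- The group of upper triangular matrices in `GL(2, A)`. (Asking the inverse to be upper triangular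
is automatic when `A` is a division ring.) -/
def borelSubgroup (A : Type*) [Ring A] : Subgroup (GL2 A) where
  carrier := {g | g.val 1 0 = 0 ∧ g⁻¹.val 1 0 = 0}
  one_mem' := by simp
  mul_mem' := by
    rintro a b ⟨ha, ha'⟩ ⟨hb, hb'⟩
    refine ⟨?_, ?_⟩
    · simp [Matrix.mul_apply, Fin.sum_univ_two, ha, hb]
    · rw [mul_inv_rev]
      simp only [Units.val_mul, Matrix.mul_apply, Fin.sum_univ_two, ha', hb']
      simp
  inv_mem' := by
    rintro a ⟨ha, ha'⟩
    exact ⟨ha', by simpa using ha⟩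

section Section

variable (F : Type*) [Field F] [ValuativeRel F] [TopologicalSpace F]
  [IsNonarchimedeanLocalField F] (A : Type*) [Ring A] [Algebra F A]

/-- `K = GL(2, O_A)`, where `O_A` is the set of elements of `A` that are integral over the ring of
integers of `F`; when `A` is a finite-dimensional division algebra over `F`, this set is the ring of
integers (the unique maximal order) of `A`. -/
def maxCompact : Set (GL2 A) :=
  {g | ∀ i j, IsIntegral 𝒪[F] (g.val i j) ∧ IsIntegral 𝒪[F] (g⁻¹.val i j)}

variable {A}

/-- The modulus character `δ_P(p) = |det (Ad p | Lie N)|_F` of the group `P` of upper triangular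
matrices. Here `Lie N` is identified with `A`, and for `p` with diagonal entries `a, b`
the map `Ad p` is `x ↦ a x b⁻¹`. -/
def modulus (p : GL2 A) : ℝ :=
  absF F (LinearMap.det
    (LinearMap.mulLeft F (p.val 0 0) ∘ₗ LinearMap.mulRight F (p⁻¹.val 1 1)))

open scoped Classical in
/-- The normalised spherical section `φ_s` of the unnormalised induced representation
`ind_P^G(δ_P ^ s)`: it is given by `φ_s(p k) = δ_P(p) ^ s` for `p ∈ P` and `k ∈ K`. -/
def sphericalSection (s : ℂ) (g : GL2 A) : ℂ :=
  if h : ∃ p ∈ borelSubgroup A, p⁻¹ * g ∈ maxCompact F A then ((modulus F h.choose : ℝ) : ℂ) ^ s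
  else 0

end Section

/-! ### Integration over `T \ H` -/

section Quotient

variable {H : Type*} [Group H]

/-- The space `T \ H` of right cosets `T h`. -/
def RightCosets (T : Subgroup H) : Type _ := Quotient (QuotientGroup.rightRel T)

/-- A representative of a coset. -/
def RightCosets.rep {T : Subgroup H} (x : RightCosets T) : H := Quotient.out x

/-- Right translation by `g` on `T \ H`. -/
def RightCosets.translate {T : Subgroup H} (g : H) : RightCosets T → RightCosets T :=
  Quotient.map (fun h => h * g) fun a b hab => by
    have h1 : b * a⁻¹ ∈ T := QuotientGroup.rightRel_apply.mp hab
    exact QuotientGroup.rightRel_apply.mpr (by simpa [mul_assoc] using h1)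

variable [TopologicalSpace H]

instance (T : Subgroup H) : TopologicalSpace (RightCosets T) :=
  inferInstanceAs (TopologicalSpace (Quotient (QuotientGroup.rightRel T)))

instance (T : Subgroup H) : MeasurableSpace (RightCosets T) := borel _

instance (T : Subgroup H) : BorelSpace (RightCosets T) := ⟨rfl⟩

/-- A nonzero Borel measure on `T \ H`, finite on compact sets, invariant under right translation
by `H`. -/
structure IsInvariantQuotientMeasure {T : Subgroup H} (μ : Measure (RightCosets T)) : Prop where
  ne_zero : μ ≠ 0
  finite_on_compact : ∀ C : Set (RightCosets T), IsCompact C → μ C < ⊤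
  invariant : ∀ g : H, μ.map (RightCosets.translate g) = μ

end Quotient

/-! ### The intertwining period -/

section Period

variable {F E : Type*} [Field F] [Field E] [Algebra F E]

theorem det_ne_zero_of_sqrt (h2 : (2 : F) ≠ 0) {l : E} (hl : l ∉ Set.range (algebraMap F E)) :
    (!![1, -l; 1, l] : Matrix (Fin 2) (Fin 2) E).det ≠ 0 := by
  have hl0 : l ≠ 0 := by
    rintro rfl
    exact hl ⟨0, map_zero _⟩
  have h2E : (2 : E) ≠ 0 := by
    rw [← map_ofNat (algebraMap F E) 2]
    exact (map_ne_zero (algebraMap F E)).mpr h2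
  rw [Matrix.det_fin_two_of]
  have : (1 : E) * l - -l * 1 = 2 * l := by ring
  rw [this]
  exact mul_ne_zero h2E hl0

variable (D : Type*) [DivisionRing D] [Algebra F D]

/-- The matrix `u₀` with rows `(1, -l)` and `(1, l)`, in `GL(2, D ⊗ E)`. -/
def uZero (h2 : (2 : F) ≠ 0) {l : E} (hl : l ∉ Set.range (algebraMap F E)) : GL2 (D ⊗[F] E) :=
  Units.map
    (RingHom.mapMatrix (m := Fin 2)
      (Algebra.TensorProduct.includeRight : E →ₐ[F] D ⊗[F] E).toRingHom).toMonoidHom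
    (Matrix.GeneralLinearGroup.mkOfDetNeZero !![1, -l; 1, l] (det_ne_zero_of_sqrt h2 hl))

variable (F E)

/-- The embedding of `H = GL(2, D)` in `G = GL(2, D ⊗ E)`. -/
def embH : GL2 D →* GL2 (D ⊗[F] E) :=
  Units.map
    (RingHom.mapMatrix (m := Fin 2)
      (Algebra.TensorProduct.includeLeft : D →ₐ[F] D ⊗[F] E).toRingHom).toMonoidHom

variable {F E}

/-- The subgroup `u⁻¹ P u ∩ H` of `H`. -/
def stabilizerH (u : GL2 (D ⊗[F] E)) : Subgroup (GL2 D) :=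
  (borelSubgroup (D ⊗[F] E)).comap ((MulAut.conj u).toMonoidHom.comp (embH F E D))

variable [ValuativeRel F] [TopologicalSpace F] [IsNonarchimedeanLocalField F]

/-- The integrand `h ↦ φ_s(u h)` on `H`. -/
def periodIntegrand (u : GL2 (D ⊗[F] E)) (s : ℂ) (h : GL2 D) : ℂ :=
  sphericalSection F s (u * embH F E D h)

end Period

end IntertwiningPeriod

end

open scoped TensorProduct
open MeasureTheory ValuativeRel

noncomputable section

namespace IntertwiningPeriod

/-! ### The normalised absolute value of a local field -/

section AbsoluteValue

variable (F : Type*) [Field F] [ValuativeRel F] [TopologicalSpace F]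
  [IsNonarchimedeanLocalField F]

/-! The period is computed explicitly as a double geometric series. Write Q = q ^ d, and for a
finite-dimensional algebra let |x| be `algAbs F x`, the absolute value of the norm of x down to F.

Geometry. Conjugation of E over F swaps the two rows of u₀, so T consists of the matrices with rows
(x, a y) and (y, x), where a = l²; it is a copy of the unit group of D_E, and δ_P is trivial on u₀ T
u₀⁻¹. The matrices with rows (1, x) and (0, y) represent the cosets (`cosetEquiv`), and the Iwasawa
decomposition gives the integrand there: (|2 y l| / max(1, |x + y l|)²) ^ s
(`periodIntegrand_upperUnit`). As T is compact modulo the scalars of F, an invariant measure comes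
from Haar measure on H modulo these scalars.

Arithmetic. The absolute value of D_E has to be made explicit on D + D l. The key is
`exists_orthogonal_generator`: E has a generator θ with |u + v θ| = max(|u|², Q⁻ᵐ |v|²) for u, v in
D. If F and E have the same absolute values, θ is a unit not congruent to any scalar; its reduced
minimal polynomial has no root in the residue field of D, whose degree d is odd, and m = 0.
Otherwise θ is a uniformiser of E and m = d; the two summands have absolute values Q^(2i) and Q^(2j
- d), never equal for d odd. In the first case all units of F are norms and a uniformiser is not; in
the second some unit is not a norm (`exists_unit_not_norm`). So the parity of m decides the factor
L(η, ·). The facts needed about D, namely that its value group is generated by Q and that its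
residue field has Q elements (`exists_uniformiser_of_central`), follow from e ≤ d, f ≤ d and d² ≤ e
f.

Summation. In the coordinates u, v, with x + y l = u + v θ, invariance under upper triangular
translations forces the set where |u| ≤ Q^j and |v| = Q^k to have volume c Q^(j - k)
(`exists_measure_labelSet`). Put Y = Q^(-2s). Summing the integrand over these sets
(`integral_of_volumes`) gives a monomial times (1 + Y) / (1 - Q Y) for m even and (1 + Q⁻¹) / (1 - Q
Y) for m odd. Here (1 - Q Y)⁻¹ is L(1, d(2s - 1)), while 1 + Y, respectively 1, is the inverse of
L(η, 2ds). At s = 0 one has Y = 1, so the value is finite and nonzero. -/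

theorem one_lt_residueCard : 1 < residueCard F := Finite.one_lt_card

theorem one_lt_residueCard_nnreal : (1 : NNReal) < residueCard F := by
  exact_mod_cast one_lt_residueCard F

theorem one_lt_residueCard_real : (1 : ℝ) < residueCard F := by
  exact_mod_cast one_lt_residueCard F

/-- The absolute value as a homomorphism of monoids with zero. -/
def absHom : F →*₀ ℝ where
  toFun := absF F
  map_zero' := by simp [absF]
  map_one' := by simp [absF]
  map_mul' x y := by simp [absF]

variable {F}

@[simp] theorem absF_zero : absF F 0 = 0 := map_zero (absHom F)
@[simp] theorem absF_one : absF F 1 = 1 := map_one (absHom F)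
theorem absF_mul (x y : F) : absF F (x * y) = absF F x * absF F y := map_mul (absHom F) x y
theorem absF_pow (x : F) (n : ℕ) : absF F (x ^ n) = absF F x ^ n := map_pow (absHom F) x n
theorem absF_inv (x : F) : absF F x⁻¹ = (absF F x)⁻¹ := map_inv₀ (absHom F) x
theorem absF_zpow (x : F) (n : ℤ) : absF F (x ^ n) = absF F x ^ n := map_zpow₀ (absHom F) x n
theorem absF_nonneg (x : F) : 0 ≤ absF F x := NNReal.coe_nonneg _
@[simp] theorem absF_eq_zero {x : F} : absF F x = 0 ↔ x = 0 := map_eq_zero (absHom F)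
theorem absF_pos {x : F} (hx : x ≠ 0) : 0 < absF F x :=
  lt_of_le_of_ne (absF_nonneg x) (Ne.symm (by simpa using hx))

theorem absF_le_absF_iff {x y : F} : absF F x ≤ absF F y ↔ valuation F x ≤ valuation F y := by
  unfold absF
  rw [NNReal.coe_le_coe,
    (WithZeroMulInt.toNNReal_strictMono (one_lt_residueCard_nnreal F)).le_iff_le]
  exact map_le_map_iff (IsNonarchimedeanLocalField.valueGroupWithZeroIsoInt F)

theorem absF_lt_absF_iff {x y : F} : absF F x < absF F y ↔ valuation F x < valuation F y := by
  rw [← not_le, absF_le_absF_iff, not_le]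

theorem absF_le_one_iff {x : F} : absF F x ≤ 1 ↔ x ∈ 𝒪[F] := by
  rw [← absF_one (F := F), absF_le_absF_iff, map_one, Valuation.mem_integer_iff]

theorem absF_coe_le_one (x : 𝒪[F]) : absF F x ≤ 1 := absF_le_one_iff.2 x.2

theorem absF_add_le (x y : F) : absF F (x + y) ≤ max (absF F x) (absF F y) := by
  have := Valuation.map_add (valuation F) x y
  rcases le_max_iff.1 this with h | h
  · exact le_max_of_le_left (absF_le_absF_iff.2 h)
  · exact le_max_of_le_right (absF_le_absF_iff.2 h)

@[simp] theorem absF_neg (x : F) : absF F (-x) = absF F x := by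
  have h : absF F (-1) = 1 := by
    have h1 : absF F (-1) ^ 2 = 1 := by rw [← absF_pow]; simp
    exact (pow_eq_one_iff_of_nonneg (absF_nonneg _) two_ne_zero).1 h1
  rw [← neg_one_mul, absF_mul, h, one_mul]

theorem exists_absF_eq_zpow {x : F} (hx : x ≠ 0) : ∃ n : ℤ, absF F x = (residueCard F : ℝ) ^ n := by
  have h0 : IsNonarchimedeanLocalField.valueGroupWithZeroIsoInt F (valuation F x) ≠ 0 := by
    simpa using hx
  refine ⟨(WithZero.unzero h0).toAdd, ?_⟩
  unfold absF
  rw [WithZeroMulInt.toNNReal_neg_apply _ h0]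
  simp

-- The value group is all of q^ℤ, so some integral y has absolute value q⁻¹. The uniformiser divides
-- y, hence is at least as large, and as a non-unit it is smaller than 1.
variable (F) in
theorem absF_uniformiser : absF F (uniformiser F : F) = (residueCard F : ℝ)⁻¹ := by
  have hirr := uniformiser_irreducible F
  have h0 : (uniformiser F : F) ≠ 0 := fun h => hirr.ne_zero (Subtype.ext h)
  have hq := one_lt_residueCard_real F
  obtain ⟨n, hn⟩ := exists_absF_eq_zpow h0
  -- an element of absolute value `q⁻¹`
  obtain ⟨y, hy⟩ := ValuativeRel.valuation_surjective
    ((IsNonarchimedeanLocalField.valueGroupWithZeroIsoInt F).symm (WithZero.exp (-1)))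
  have hy1 : absF F y = (residueCard F : ℝ) ^ (-1 : ℤ) := by
    unfold absF
    rw [hy, OrderMonoidIso.apply_symm_apply, WithZeroMulInt.toNNReal_neg_apply _ WithZero.exp_ne_zero]
    simp only [WithZero.exp, WithZero.unzero_coe, toAdd_ofAdd]
    simp
  have hyO : y ∈ 𝒪[F] := absF_le_one_iff.1 (by
    rw [hy1]; exact zpow_le_one_of_nonpos₀ hq.le (by norm_num))
  have hunit : ∀ u : 𝒪[F], IsUnit u → absF F (u : F) = 1 := by
    rintro u ⟨v, rfl⟩
    have h1 := absF_coe_le_one (v : 𝒪[F])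
    have h2 := absF_coe_le_one ((v⁻¹ : 𝒪[F]ˣ) : 𝒪[F])
    have h3 : absF F ((v : 𝒪[F]) : F) * absF F (((v⁻¹ : 𝒪[F]ˣ) : 𝒪[F]) : F) = 1 := by
      rw [← absF_mul, ← Subring.coe_mul]
      simp
    nlinarith [absF_nonneg ((v : 𝒪[F]) : F), absF_nonneg (((v⁻¹ : 𝒪[F]ˣ) : 𝒪[F]) : F)]
  have hynu : ¬ IsUnit (⟨y, hyO⟩ : 𝒪[F]) := by
    intro h
    have := hunit _ h
    simp only [hy1] at this
    rw [zpow_neg_one, inv_eq_one] at this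
    exact hq.ne' this
  have hpy : (uniformiser F) ∣ (⟨y, hyO⟩ : 𝒪[F]) := by
    have hm : (⟨y, hyO⟩ : 𝒪[F]) ∈ IsLocalRing.maximalIdeal 𝒪[F] := hynu
    rwa [hirr.maximalIdeal_eq, Ideal.mem_span_singleton] at hm
  obtain ⟨c, hc⟩ := hpy
  have hc' : y = (uniformiser F : F) * c := congrArg Subtype.val hc
  have hle : (residueCard F : ℝ) ^ (-1 : ℤ) ≤ (residueCard F : ℝ) ^ n := by
    rw [← hy1, ← hn, hc', absF_mul]
    exact mul_le_of_le_one_right (absF_nonneg _) (absF_coe_le_one c)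
  have hlt : (residueCard F : ℝ) ^ n < (residueCard F : ℝ) ^ (0 : ℤ) := by
    rw [← hn, zpow_zero]
    refine lt_of_le_of_ne (absF_coe_le_one _) fun h => hirr.not_isUnit ?_
    refine IsUnit.of_mul_eq_one
      (⟨(uniformiser F : F)⁻¹, absF_le_one_iff.1 (by rw [absF_inv, h, inv_one])⟩ : 𝒪[F]) ?_
    exact Subtype.ext (mul_inv_cancel₀ h0)
  have h1 := (zpow_le_zpow_iff_right₀ hq).1 hle
  have h2 := (zpow_lt_zpow_iff_right₀ hq).1 hlt
  have : n = -1 := by omega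
  rw [hn, this, zpow_neg_one]

theorem continuous_absF : Continuous (absF F) := by
  rw [continuous_iff_continuousAt]
  intro x
  have hq := one_lt_residueCard_real F
  rw [ContinuousAt, Metric.tendsto_nhds]
  intro ε hε
  -- the neighbourhood `|y - x| < |c|`
  have key : ∀ c : F, c ≠ 0 → ∀ᶠ y in nhds x, absF F (y - x) < absF F c := by
    intro c hc
    have h1 : ∀ᶠ z in nhds (0 : F), absF F z < absF F c := by
      refine ((IsValuativeTopology.hasBasis_nhds_zero' F).mem_iff).2
        ⟨valuation F c, by simpa using hc, fun z hz => ?_⟩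
      exact absF_lt_absF_iff.2 hz
    have h2 : Filter.Tendsto (fun y => y - x) (nhds x) (nhds 0) := by
      have : Continuous fun y : F => y - x := by fun_prop
      simpa using this.tendsto x
    exact h2.eventually h1
  by_cases hx : x = 0
  · obtain ⟨k, hk⟩ := exists_pow_lt_of_lt_one hε (inv_lt_one_of_one_lt₀ hq)
    have hc : (uniformiser F : F) ^ k ≠ 0 :=
      pow_ne_zero _ fun h => (uniformiser_irreducible F).ne_zero (Subtype.ext h)
    filter_upwards [key _ hc] with y hy
    rw [absF_pow, absF_uniformiser] at hy
    subst hx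
    rw [sub_zero] at hy
    simp only [absF_zero, dist_zero_right, Real.norm_eq_abs, abs_of_nonneg (absF_nonneg y)]
    exact hy.trans hk
  -- Away from 0 the absolute value is locally constant: |y - x| < |x| forces |y| = |x|.
  · filter_upwards [key x hx] with y hy
    have : absF F y = absF F x := by
      apply le_antisymm
      · have := absF_add_le (y - x) x
        rw [sub_add_cancel, max_eq_right hy.le] at this
        exact this
      · have := absF_add_le (-(y - x)) y
        rw [absF_neg, neg_sub, sub_add_cancel] at this
        rcases le_max_iff.1 this with h | h
        · exact absurd (h.trans_eq (by rw [← neg_sub, absF_neg])) (not_le.2 hy)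
        · exact h
    simpa [this] using hε

theorem isCompact_absF_le_one : IsCompact {x : F | absF F x ≤ 1} := by
  have := IsNonarchimedeanLocalField.isCompact_closedBall F 1
  convert this using 1
  ext x
  simp only [Set.mem_ofPred_eq]
  rw [absF_le_one_iff, Valuation.mem_integer_iff]

theorem exists_lt_absF (r : ℝ) : ∃ c : F, c ≠ 0 ∧ r < absF F c := by
  have h0 : (uniformiser F : F) ≠ 0 := fun h => (uniformiser_irreducible F).ne_zero (Subtype.ext h)
  obtain ⟨k, hk⟩ := pow_unbounded_of_one_lt r (one_lt_residueCard_real F)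
  refine ⟨((uniformiser F : F)⁻¹) ^ k, pow_ne_zero _ (inv_ne_zero h0), ?_⟩
  rwa [absF_pow, absF_inv, absF_uniformiser, inv_inv]

end AbsoluteValue


/-! ### The absolute value of a finite-dimensional division algebra -/

/-- Injective endomorphisms of a finite-dimensional space are surjective. The lemma serves D ⊗ E,
which is only known to be a domain and carries no division ring structure. -/
theorem isUnit_of_ne_zero (F : Type*) [Field F] {A : Type*} [Ring A] [Algebra F A] [IsDomain A]
    [FiniteDimensional F A] {x : A} (hx : x ≠ 0) : IsUnit x := by
  have hinj : Function.Injective (LinearMap.mulLeft F x) := fun a b h =>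
    mul_left_cancel₀ hx h
  have hinj' : Function.Injective (LinearMap.mulRight F x) := fun a b h =>
    mul_right_cancel₀ hx h
  obtain ⟨y, hy⟩ := LinearMap.surjective_of_injective hinj 1
  obtain ⟨z, hz⟩ := LinearMap.surjective_of_injective hinj' 1
  exact isUnit_iff_exists_and_exists.2 ⟨⟨y, hy⟩, ⟨z, hz⟩⟩

section DivisionAlgebra

variable (F : Type*) [Field F] [ValuativeRel F] [TopologicalSpace F]
  [IsNonarchimedeanLocalField F] {A : Type*} [Ring A] [Algebra F A]

/-- The absolute value of the norm of an element of an `F`-algebra. -/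
def algAbs (x : A) : ℝ := absF F (Algebra.norm F x)

@[simp] theorem algAbs_one : algAbs F (1 : A) = 1 := by simp [algAbs]
theorem algAbs_mul (x y : A) : algAbs F (x * y) = algAbs F x * algAbs F y := by
  simp [algAbs, absF_mul]
theorem algAbs_pow (x : A) (n : ℕ) : algAbs F (x ^ n) = algAbs F x ^ n := by
  simp [algAbs, absF_pow]
theorem algAbs_nonneg (x : A) : 0 ≤ algAbs F x := absF_nonneg _

theorem algAbs_units_inv (x : Aˣ) : algAbs F ((x⁻¹ : Aˣ) : A) = (algAbs F (x : A))⁻¹ := by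
  refine eq_inv_of_mul_eq_one_left ?_
  rw [← algAbs_mul, Units.inv_mul, algAbs_one]

@[simp] theorem algAbs_neg (x : A) : algAbs F (-x) = algAbs F x := by
  have h : algAbs F (-1 : A) = 1 := by
    have h1 : algAbs F (-1 : A) ^ 2 = 1 := by rw [← algAbs_pow]; simp
    exact (pow_eq_one_iff_of_nonneg (algAbs_nonneg F _) two_ne_zero).1 h1
  rw [← neg_one_mul, algAbs_mul, h, one_mul]

/-- An automorphism preserves the absolute value. -/
theorem algAbs_algEquiv (τ : A ≃ₐ[F] A) (x : A) : algAbs F (τ x) = algAbs F x := by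
  rw [algAbs, algAbs, Algebra.norm_eq_of_algEquiv]

variable [IsDomain A] [FiniteDimensional F A]

@[simp] theorem algAbs_eq_zero {x : A} : algAbs F x = 0 ↔ x = 0 := by
  rw [algAbs, absF_eq_zero, Algebra.norm_eq_zero_iff]

@[simp] theorem algAbs_zero : algAbs F (0 : A) = 0 := (algAbs_eq_zero F).2 rfl

theorem algAbs_pos {x : A} (hx : x ≠ 0) : 0 < algAbs F x :=
  lt_of_le_of_ne (algAbs_nonneg F x) (Ne.symm (by simpa using hx))

theorem algAbs_algebraMap (a : F) :
    algAbs F (algebraMap F A a) = absF F a ^ Module.finrank F A := by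
  rw [algAbs, Algebra.norm_algebraMap, absF_pow]

theorem algAbs_smul (a : F) (x : A) :
    algAbs F (a • x) = absF F a ^ Module.finrank F A * algAbs F x := by
  rw [Algebra.smul_def, algAbs_mul, algAbs_algebraMap]

/-- The coordinates of an element with respect to a fixed basis have absolute value at most `r`. -/
def CoordBounded (r : ℝ) (x : A) : Prop :=
  ∀ i, absF F ((Module.finBasis F A).repr x i) ≤ r

/-- The norm is a determinant whose entries are linear in the coordinates. Working in coordinates
avoids any topology on A. -/
theorem continuous_algAbs_coord :
    Continuous fun v : Fin (Module.finrank F A) → F =>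
      algAbs F ((Module.finBasis F A).equivFun.symm v) := by
  have h : (fun v : Fin (Module.finrank F A) → F =>
      algAbs F ((Module.finBasis F A).equivFun.symm v)) = fun v =>
      absF F (∑ i, v i • Algebra.leftMulMatrix (Module.finBasis F A) (Module.finBasis F A i)).det := by
    funext v
    rw [algAbs, Algebra.norm_eq_matrix_det (Module.finBasis F A), Module.Basis.equivFun_symm_apply,
      map_sum]
    simp only [map_smul]
  rw [h]
  refine continuous_absF.comp (Continuous.matrix_det ?_)
  fun_prop

theorem exists_algAbs_le_of_coordBounded :
    ∃ C : ℝ, ∀ x : A, CoordBounded F 1 x → algAbs F x ≤ C := by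
  have hK : IsCompact (Set.univ.pi fun _ : Fin (Module.finrank F A) => {x : F | absF F x ≤ 1}) :=
    isCompact_univ_pi fun _ => isCompact_absF_le_one
  obtain ⟨C, hC⟩ := (hK.image (continuous_algAbs_coord F (A := A))).bddAbove
  refine ⟨C, fun x hx => hC ⟨(Module.finBasis F A).equivFun x, fun i _ => ?_, ?_⟩⟩
  · simpa using hx i
  · simp

/-- The norm form is anisotropic, so its absolute value has a positive minimum on the compact set of
integral coordinate vectors with some coordinate equal to 1. -/
theorem exists_le_algAbs_of_coord :
    ∃ m : ℝ, 0 < m ∧ ∀ x : A, CoordBounded F 1 x →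
      (∃ i, (Module.finBasis F A).repr x i = 1) → m ≤ algAbs F x := by
  classical
  have hclosed : ∀ i : Fin (Module.finrank F A), IsClosed {v : Fin (Module.finrank F A) → F | v i = 1} := by
    intro i
    let := IsTopologicalAddGroup.rightUniformSpace F
    have := isUniformAddGroup_of_addCommGroup (G := F)
    have : T2Space F := inferInstance
    exact isClosed_eq (continuous_apply i) continuous_const
  have hK : IsCompact ((Set.univ.pi fun _ : Fin (Module.finrank F A) => {x : F | absF F x ≤ 1}) ∩
      ⋃ i, {v | v i = 1}) :=
    (isCompact_univ_pi fun _ => isCompact_absF_le_one).inter_right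
      (isClosed_iUnion_of_finite hclosed)
  have hne : Module.finrank F A ≠ 0 := Module.finrank_pos.ne'
  obtain ⟨v, hv, hmin⟩ := hK.exists_isMinOn
    ⟨fun _ => 1, fun _ _ => by simp, Set.mem_iUnion.2 ⟨⟨0, Nat.pos_of_ne_zero hne⟩, rfl⟩⟩
    (continuous_algAbs_coord F (A := A)).continuousOn
  refine ⟨algAbs F ((Module.finBasis F A).equivFun.symm v), algAbs_pos F ?_, fun x hx hi => ?_⟩
  · obtain ⟨i, hi⟩ := Set.mem_iUnion.1 hv.2
    intro h
    rw [LinearEquiv.map_eq_zero_iff] at h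
    have hi' : v i = 1 := hi
    rw [h] at hi'
    exact zero_ne_one hi'
  · obtain ⟨i, hi⟩ := hi
    have := hmin (a := (Module.finBasis F A).equivFun x)
      ⟨fun i _ => by simpa using hx i, Set.mem_iUnion.2 ⟨i, by simpa using hi⟩⟩
    simpa using this

/-- Dividing x by its largest coordinate a gives m |a|^n ≤ |x| ≤ 1, where m is the minimum of the
previous lemma and n the dimension. This is impossible once |a| exceeds both 1 and m⁻¹, which
dictates the choice of c. -/
theorem exists_coordBounded_of_algAbs_le :
    ∃ c : F, c ≠ 0 ∧ ∀ x : A, algAbs F x ≤ 1 → CoordBounded F (absF F c) x := by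
  obtain ⟨m, hm, H⟩ := exists_le_algAbs_of_coord F (A := A)
  obtain ⟨c, hc0, hc⟩ := exists_lt_absF (F := F) (max 1 m⁻¹)
  refine ⟨c, hc0, fun x hx => ?_⟩
  have hne : Module.finrank F A ≠ 0 := Module.finrank_pos.ne'
  have : Nonempty (Fin (Module.finrank F A)) := ⟨⟨0, Nat.pos_of_ne_zero hne⟩⟩
  obtain ⟨i, hi⟩ := Finite.exists_max fun i => absF F ((Module.finBasis F A).repr x i)
  intro j
  refine (hi j).trans ?_
  set a := (Module.finBasis F A).repr x i with ha
  by_cases ha0 : a = 0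
  · rw [ha0, absF_zero]; exact absF_nonneg c
  have h1 : m ≤ algAbs F (a⁻¹ • x) := by
    refine H _ (fun k => ?_) ⟨i, ?_⟩
    · rw [map_smul, Finsupp.smul_apply, smul_eq_mul, absF_mul, absF_inv, inv_mul_le_iff₀ (absF_pos ha0),
        mul_one]
      exact hi k
    · rw [map_smul, Finsupp.smul_apply, smul_eq_mul, ← ha, inv_mul_cancel₀ ha0]
  rw [algAbs_smul, absF_inv] at h1
  have hpos := absF_pos ha0
  have h2 : m * absF F a ^ Module.finrank F A ≤ 1 := by
    rw [inv_pow] at h1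
    have hp : 0 < absF F a ^ Module.finrank F A := pow_pos hpos _
    rw [inv_mul_eq_div, le_div_iff₀ hp] at h1
    exact h1.trans hx
  by_contra! hlt
  have h3 : 1 < absF F a := (le_max_left _ _).trans_lt (hc.trans hlt)
  have h4 : m⁻¹ < absF F a := (le_max_right _ _).trans_lt (hc.trans hlt)
  have h5 : absF F a ≤ absF F a ^ Module.finrank F A := le_self_pow₀ h3.le hne
  have h6 : 1 < m * absF F a := by rwa [inv_lt_iff_one_lt_mul₀' hm] at h4
  nlinarith

/-- The lattice of elements whose coordinates have absolute value at most `|c|`. -/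
def coordLattice (A : Type*) [Ring A] [Algebra F A] [IsDomain A] [FiniteDimensional F A] (c : F) :
    Submodule 𝒪[F] A where
  carrier := {x | CoordBounded F (absF F c) x}
  zero_mem' i := by simp [absF_nonneg]
  add_mem' {x y} hx hy i := by
    rw [map_add, Finsupp.add_apply]
    exact (absF_add_le _ _).trans (max_le (hx i) (hy i))
  smul_mem' a x hx i := by
    have : a • x = (a : F) • x := rfl
    rw [this, map_smul, Finsupp.smul_apply, smul_eq_mul, absF_mul]
    exact (mul_le_of_le_one_left (absF_nonneg _) (absF_coe_le_one a)).trans (hx i)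

theorem coordLattice_fg {c : F} (hc : c ≠ 0) : (coordLattice F A c).FG := by
  classical
  refine ⟨Finset.univ.image fun i => c • Module.finBasis F A i, le_antisymm ?_ ?_⟩
  · rw [Submodule.span_le]
    intro x hx
    simp only [Finset.coe_image, Finset.coe_univ, Set.image_univ, Set.mem_range] at hx
    obtain ⟨i, rfl⟩ := hx
    intro j
    rw [map_smul, Module.Basis.repr_self, Finsupp.smul_apply, smul_eq_mul, absF_mul,
      Finsupp.single_apply]
    split_ifs <;> simp [absF_nonneg]
  · intro x hx
    rw [← (Module.finBasis F A).sum_repr x]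
    refine Submodule.sum_mem _ fun i _ => ?_
    have hmem : c⁻¹ * (Module.finBasis F A).repr x i ∈ 𝒪[F] := by
      rw [← absF_le_one_iff, absF_mul, absF_inv, inv_mul_le_iff₀ (absF_pos hc), mul_one]
      exact hx i
    have : (Module.finBasis F A).repr x i • Module.finBasis F A i =
        (⟨_, hmem⟩ : 𝒪[F]) • (c • Module.finBasis F A i) := by
      change _ = (c⁻¹ * (Module.finBasis F A).repr x i) • (c • Module.finBasis F A i)
      rw [smul_smul, mul_right_comm, inv_mul_cancel₀ hc, one_mul]
    rw [this]
    exact Submodule.smul_mem _ _ (Submodule.subset_span (by simp))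

theorem exists_algAbs_le_of_mem_coordLattice (c : F) (hc : c ≠ 0) :
    ∃ C : ℝ, ∀ x ∈ coordLattice F A c, algAbs F x ≤ C := by
  obtain ⟨C, hC⟩ := exists_algAbs_le_of_coordBounded F (A := A)
  refine ⟨absF F c ^ Module.finrank F A * C, fun x hx => ?_⟩
  have h1 := hC (c⁻¹ • x) fun i => by
    rw [map_smul, Finsupp.smul_apply, smul_eq_mul, absF_mul, absF_inv,
      inv_mul_le_iff₀ (absF_pos hc), mul_one]
    exact hx i
  have h2 : x = c • c⁻¹ • x := by rw [smul_smul, mul_inv_cancel₀ hc, one_smul]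
  rw [h2, algAbs_smul]
  exact mul_le_mul_of_nonneg_left h1 (pow_nonneg (absF_nonneg _) _)

/-- The absolute value is bounded on a lattice, whereas the powers of an element with |x| > 1 have
unbounded absolute values. -/
theorem algAbs_le_one_of_pow_mem {c : F} (hc : c ≠ 0) {x : A}
    (hx : ∀ k : ℕ, x ^ k ∈ coordLattice F A c) : algAbs F x ≤ 1 := by
  obtain ⟨C, hC⟩ := exists_algAbs_le_of_mem_coordLattice F (A := A) c hc
  by_contra! hlt
  obtain ⟨k, hk⟩ := pow_unbounded_of_one_lt C hlt
  have := hC _ (hx k)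
  rw [algAbs_pow] at this
  exact absurd this (not_le.2 hk)

/-- The maximal order: the algebra spanned by the elements of absolute value at most `1`. -/
def maxOrder (A : Type*) [Ring A] [Algebra F A] [IsDomain A] [FiniteDimensional F A] :
    Subalgebra 𝒪[F] A where
  carrier := Submodule.span 𝒪[F] {x : A | algAbs F x ≤ 1}
  add_mem' := Submodule.add_mem _
  mul_mem' {x y} hx hy := by
    have := Submodule.mul_mem_mul hx hy
    rw [Submodule.span_mul_span] at this
    refine Submodule.span_mono ?_ this
    rintro _ ⟨a, ha, b, hb, rfl⟩
    change algAbs F (a * b) ≤ 1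
    rw [algAbs_mul]
    exact mul_le_one₀ ha (algAbs_nonneg F b) hb
  algebraMap_mem' a := by
    rw [Algebra.algebraMap_eq_smul_one]
    exact Submodule.smul_mem _ _ (Submodule.subset_span (by simp))

theorem exists_maxOrder_le :
    ∃ c : F, c ≠ 0 ∧ Subalgebra.toSubmodule (maxOrder F A) ≤ coordLattice F A c := by
  obtain ⟨c, hc0, hc⟩ := exists_coordBounded_of_algAbs_le F (A := A)
  refine ⟨c, hc0, ?_⟩
  change Submodule.span 𝒪[F] {x : A | algAbs F x ≤ 1} ≤ _
  rw [Submodule.span_le]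
  exact fun x hx => hc x hx

/-- This is the source of the ultrametric inequality. The span of the unit ball is a ring, because
the ball is multiplicatively closed, and it lies in a lattice, because the ball is bounded. So all
powers of an element of the span stay in one lattice, and the span is no larger than the ball. -/
theorem mem_maxOrder {x : A} : x ∈ maxOrder F A ↔ algAbs F x ≤ 1 := by
  refine ⟨fun hx => ?_, fun hx => Submodule.subset_span hx⟩
  obtain ⟨c, hc0, hc⟩ := exists_maxOrder_le F (A := A)
  exact algAbs_le_one_of_pow_mem F hc0 fun k => hc (Subalgebra.pow_mem _ hx k)

theorem maxOrder_fg : (Subalgebra.toSubmodule (maxOrder F A)).FG := by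
  obtain ⟨c, hc0, hc⟩ := exists_maxOrder_le F (A := A)
  exact (coordLattice_fg F hc0).of_le hc

theorem algAbs_add_le_one {x y : A} (hx : algAbs F x ≤ 1) (hy : algAbs F y ≤ 1) :
    algAbs F (x + y) ≤ 1 := by
  rw [← mem_maxOrder] at *
  exact add_mem hx hy

theorem algAbs_add_le (x y : A) : algAbs F (x + y) ≤ max (algAbs F x) (algAbs F y) := by
  wlog h : algAbs F x ≤ algAbs F y generalizing x y
  · rw [add_comm, max_comm]
    exact this y x (not_le.1 h).le
  by_cases hy : y = 0
  · simp [hy]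
  obtain ⟨u, rfl⟩ := isUnit_of_ne_zero F hy
  have hp := algAbs_pos F hy
  have h1 : algAbs F (x * ((u⁻¹ : Aˣ) : A)) ≤ 1 := by
    rw [algAbs_mul, algAbs_units_inv, mul_inv_le_iff₀ hp, one_mul]
    exact h
  have h2 := algAbs_add_le_one F h1 (y := (1 : A)) (by simp)
  have h3 : x + u = (x * ((u⁻¹ : Aˣ) : A) + 1) * u := by
    rw [add_mul, mul_assoc, Units.inv_mul, mul_one, one_mul]
  rw [h3, algAbs_mul, max_eq_right h]
  exact mul_le_of_le_one_left hp.le h2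

theorem algAbs_sub_le (x y : A) : algAbs F (x - y) ≤ max (algAbs F x) (algAbs F y) := by
  rw [sub_eq_add_neg]
  simpa using algAbs_add_le F x (-y)

theorem algAbs_add_eq_right {x y : A} (h : algAbs F x < algAbs F y) :
    algAbs F (x + y) = algAbs F y := by
  apply le_antisymm
  · simpa [h.le] using algAbs_add_le F x y
  · have := algAbs_sub_le F (x + y) x
    rw [add_sub_cancel_left] at this
    rcases le_max_iff.1 this with h' | h'
    · exact h'
    · exact absurd h' (not_le.2 h)

theorem algAbs_add_eq_max {x y : A} (h : algAbs F x ≠ algAbs F y) :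
    algAbs F (x + y) = max (algAbs F x) (algAbs F y) := by
  rcases lt_or_gt_of_ne h with h | h
  · rw [algAbs_add_eq_right F h, max_eq_right h.le]
  · rw [add_comm, algAbs_add_eq_right F h, max_eq_left h.le]

/-- If |x| > 1, the leading term of a monic integral equation strictly dominates the others.
Conversely, `maxOrder` is a finitely generated module and consists of integral elements. This
identifies the entries allowed in K. -/
theorem isIntegral_iff_algAbs_le_one {x : A} : IsIntegral 𝒪[F] x ↔ algAbs F x ≤ 1 := by
  refine ⟨fun hx => ?_, fun hx => ?_⟩
  · obtain ⟨p, hp, hpx⟩ := hx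
    by_contra! hlt
    rw [← Polynomial.aeval_def, Polynomial.aeval_eq_sum_range, Finset.sum_range_succ,
      hp.coeff_natDegree, one_smul] at hpx
    have hd : p.natDegree ≠ 0 := by
      intro h0
      simp [h0] at hpx
    have key : algAbs F (∑ i ∈ Finset.range p.natDegree, p.coeff i • x ^ i) <
        algAbs F (x ^ p.natDegree) := by
      have : ∀ n : ℕ, n ≠ 0 → algAbs F (∑ i ∈ Finset.range n, p.coeff i • x ^ i) <
          algAbs F x ^ n := by
        intro n
        induction n with
        | zero => simp
        | succ n ih =>
          intro _
          rw [Finset.sum_range_succ]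
          refine (algAbs_add_le F _ _).trans_lt (max_lt ?_ ?_)
          · rcases eq_or_ne n 0 with rfl | hn
            · simpa using zero_lt_one.trans hlt
            · exact (ih hn).trans (pow_lt_pow_right₀ hlt n.lt_succ_self)
          · have : p.coeff n • x ^ n = (p.coeff n : F) • x ^ n := rfl
            rw [this, algAbs_smul, algAbs_pow]
            refine (mul_le_of_le_one_left (pow_nonneg (algAbs_nonneg F _) _)
              (pow_le_one₀ (absF_nonneg _) (absF_coe_le_one _))).trans_lt ?_
            exact pow_lt_pow_right₀ hlt n.lt_succ_self
      rw [algAbs_pow]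
      exact this _ hd
    have h1 := algAbs_add_eq_right F key
    rw [hpx, algAbs_zero, algAbs_pow] at h1
    have : 0 < algAbs F x ^ p.natDegree := pow_pos (zero_lt_one.trans hlt) _
    exact this.ne h1
  · exact IsIntegral.of_mem_of_fg (maxOrder F A) (maxOrder_fg F) x
      ((mem_maxOrder F).2 hx)

/-- A multiplicative function that is bounded by `1` on integral elements and agrees with a power
of the absolute value on scalars is determined by these properties. -/
theorem eq_algAbs_pow_of_scalar (χ : A →* ℝ) (hχ : ∀ x, 0 ≤ χ x) (c : ℕ)
    (hint : ∀ x : A, algAbs F x ≤ 1 → χ x ≤ 1)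
    (hsc : ∀ a : F, χ (algebraMap F A a) = (absF F a ^ Module.finrank F A) ^ c) {x : A} (hx : x ≠ 0) :
    χ x = algAbs F x ^ c := by
  have hn : Module.finrank F A ≠ 0 := Module.finrank_pos.ne'
  have ha : Algebra.norm F x ≠ 0 := by rwa [Algebra.norm_ne_zero_iff]
  -- Both χ u and χ u⁻¹ are at most 1 and their product is 1.
  have h1 : ∀ u : Aˣ, algAbs F (u : A) = 1 → χ u = 1 := by
    intro u hu
    have h1 := hint u hu.le
    have h2 := hint ((u⁻¹ : Aˣ) : A) (by rw [algAbs_units_inv, hu, inv_one])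
    have h3 : χ u * χ ((u⁻¹ : Aˣ) : A) = 1 := by rw [← map_mul, Units.mul_inv, map_one]
    nlinarith [hχ u, hχ ((u⁻¹ : Aˣ) : A)]
  -- With n the dimension, x^n = N(x) u defines u, and |u| = 1 because |N(x)| as a scalar has
  -- absolute value |x|^n. So χ(x)^n is determined by the value of χ on the scalar N(x).
  have hu0 : algebraMap F A (Algebra.norm F x)⁻¹ * x ^ Module.finrank F A ≠ 0 :=
    mul_ne_zero (by simpa using ha) (pow_ne_zero _ hx)
  obtain ⟨u, hu⟩ := isUnit_of_ne_zero F hu0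
  have hxu : x ^ Module.finrank F A = algebraMap F A (Algebra.norm F x) * u := by
    rw [hu, ← mul_assoc, ← map_mul, mul_inv_cancel₀ ha, map_one, one_mul]
  have hu1 : algAbs F (u : A) = 1 := by
    have := congrArg (algAbs F) hxu
    rw [algAbs_pow, algAbs_mul, algAbs_algebraMap] at this
    have hne : absF F (Algebra.norm F x) ^ Module.finrank F A ≠ 0 :=
      pow_ne_zero _ (by simpa using ha)
    exact mul_left_cancel₀ hne (by rw [mul_one]; exact this.symm)
  have h2 := congrArg χ hxu
  rw [map_pow, map_mul, hsc, h1 u hu1, mul_one, ← pow_mul, mul_comm, pow_mul] at h2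
  exact (pow_left_inj₀ (hχ x) (pow_nonneg (algAbs_nonneg F x) c) hn).1 h2

theorem exists_algAbs_eq_zpow {x : A} (hx : x ≠ 0) :
    ∃ n : ℤ, algAbs F x = (residueCard F : ℝ) ^ n :=
  exists_absF_eq_zpow (by rwa [Algebra.norm_ne_zero_iff])

/-- `Algebra.norm` uses left multiplication, while `modulus` also involves right multiplication. The
determinant of the latter is the norm in the opposite algebra, where integrality means the same
thing, so the uniqueness in `eq_algAbs_pow_of_scalar` with exponent 1 applies. -/
theorem absF_det_mulRight (x : A) : absF F (LinearMap.det (LinearMap.mulRight F x)) = algAbs F x := by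
  by_cases hx : x = 0
  · subst hx
    rw [LinearMap.mulRight_zero_eq_zero, LinearMap.det_zero, algAbs_zero, absF_pow, absF_zero,
      zero_pow Module.finrank_pos.ne']
  let χ : A →* ℝ :=
    { toFun := fun x => absF F (LinearMap.det (LinearMap.mulRight F x))
      map_one' := by simp
      map_mul' := fun x y => by
        rw [LinearMap.mulRight_mul, LinearMap.det_comp, absF_mul, mul_comm] }
  have hint : ∀ x : A, algAbs F x ≤ 1 → χ x ≤ 1 := by
    intro x hx
    let e : A ≃ₗ[F] Aᵐᵒᵖ := MulOpposite.opLinearEquiv F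
    have hdet : ∀ y : A, χ y = algAbs F (MulOpposite.op y) := by
      intro y
      change absF F _ = absF F _
      rw [Algebra.norm_apply, ← LinearMap.det_conj (LinearMap.mulRight F y) e]
      congr 2
    rw [hdet, ← isIntegral_iff_algAbs_le_one]
    rw [← isIntegral_iff_algAbs_le_one] at hx
    obtain ⟨p, hp, hpx⟩ := hx
    refine ⟨p, hp, ?_⟩
    rw [← Polynomial.aeval_def] at hpx ⊢
    rw [Polynomial.aeval_eq_sum_range] at hpx ⊢
    have := congrArg MulOpposite.op hpx
    simpa using this
  have := eq_algAbs_pow_of_scalar F χ (fun x => absF_nonneg _) 1 hint (fun a => by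
    change absF F (LinearMap.det (LinearMap.mulRight F (algebraMap F A a))) = _
    have : LinearMap.mulRight F (algebraMap F A a) = a • LinearMap.id := by
      ext y; simp [Algebra.smul_def, Algebra.commutes]
    rw [this, LinearMap.det_smul, LinearMap.det_id, mul_one, absF_pow, pow_one]) hx
  rwa [pow_one] at this

end DivisionAlgebra


/-! ### Residue algebras -/

section Residue

variable (F : Type*) [Field F] [ValuativeRel F] [TopologicalSpace F]
  [IsNonarchimedeanLocalField F] (A : Type*) [Ring A] [Algebra F A]
  [IsDomain A] [FiniteDimensional F A]

/-- The maximal ideal of the maximal order. -/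
def maxOrderIdeal : Ideal (maxOrder F A) where
  carrier := {x | algAbs F (x : A) < 1}
  zero_mem' := by simp
  add_mem' {x y} hx hy := (algAbs_add_le F (x : A) y).trans_lt (max_lt hx hy)
  smul_mem' c x hx := by
    change algAbs F ((c : A) * x) < 1
    rw [algAbs_mul]
    exact mul_lt_one_of_nonneg_of_lt_one_right ((mem_maxOrder F).1 c.2) (algAbs_nonneg F _) hx

instance : (maxOrderIdeal F A).IsTwoSided where
  mul_mem_of_left {x} y hx := by
    change algAbs F ((x : A) * y) < 1
    rw [algAbs_mul]
    exact mul_lt_one_of_nonneg_of_lt_one_left (algAbs_nonneg F _) hx ((mem_maxOrder F).1 y.2)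

/-- The residue algebra of the maximal order. -/
def ResidueAlgebra : Type _ := maxOrder F A ⧸ maxOrderIdeal F A

instance : Ring (ResidueAlgebra F A) := inferInstanceAs (Ring (maxOrder F A ⧸ maxOrderIdeal F A))

instance : Algebra 𝒪[F] (ResidueAlgebra F A) :=
  inferInstanceAs (Algebra 𝒪[F] (maxOrder F A ⧸ maxOrderIdeal F A))

/-- The reduction map. -/
def residueMap : maxOrder F A →ₐ[𝒪[F]] ResidueAlgebra F A :=
  Ideal.Quotient.mkₐ 𝒪[F] (maxOrderIdeal F A)

variable {F A}

theorem residueMap_surjective : Function.Surjective (residueMap F A) :=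
  Ideal.Quotient.mk_surjective

theorem residueMap_eq_zero {x : maxOrder F A} : residueMap F A x = 0 ↔ algAbs F (x : A) < 1 :=
  Ideal.Quotient.eq_zero_iff_mem

instance : IsDomain (ResidueAlgebra F A) :=
  haveI : Nontrivial (ResidueAlgebra F A) := by
    refine ⟨1, 0, fun h => ?_⟩
    rw [← map_one (residueMap F A), residueMap_eq_zero] at h
    simp at h
  haveI : NoZeroDivisors (ResidueAlgebra F A) := ⟨by
    intro a b hab
    obtain ⟨x, rfl⟩ := residueMap_surjective a
    obtain ⟨y, rfl⟩ := residueMap_surjective b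
    rw [← map_mul, residueMap_eq_zero, Subalgebra.coe_mul, algAbs_mul] at hab
    rw [residueMap_eq_zero, residueMap_eq_zero]
    by_contra! hc
    nlinarith⟩
  NoZeroDivisors.to_isDomain _

theorem absF_lt_one_of_mem {a : 𝒪[F]} (ha : a ∈ 𝓂[F]) : absF F (a : F) < 1 := by
  rw [(uniformiser_irreducible F).maximalIdeal_eq, Ideal.mem_span_singleton] at ha
  obtain ⟨c, rfl⟩ := ha
  rw [Subring.coe_mul, absF_mul, absF_uniformiser]
  exact mul_lt_one_of_nonneg_of_lt_one_left (inv_nonneg.2 (Nat.cast_nonneg _))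
    (inv_lt_one_of_one_lt₀ (one_lt_residueCard_real F)) (absF_coe_le_one c)

theorem algebraMap_eq_zero_of_mem {a : 𝒪[F]} (ha : a ∈ 𝓂[F]) :
    algebraMap 𝒪[F] (ResidueAlgebra F A) a = 0 := by
  rw [← (residueMap F A).commutes, residueMap_eq_zero]
  change algAbs F (algebraMap F A a) < 1
  rw [algAbs_algebraMap]
  exact pow_lt_one₀ (absF_nonneg _) (absF_lt_one_of_mem ha) Module.finrank_pos.ne'

instance : Algebra 𝓀[F] (ResidueAlgebra F A) :=
  (Ideal.Quotient.lift 𝓂[F] (algebraMap 𝒪[F] (ResidueAlgebra F A)) fun _ ha =>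
    algebraMap_eq_zero_of_mem ha).toAlgebra' fun c x => by
      obtain ⟨c, rfl⟩ := Ideal.Quotient.mk_surjective c
      simp only [Ideal.Quotient.lift_mk]
      exact Algebra.commutes c x

instance : IsScalarTower 𝒪[F] 𝓀[F] (ResidueAlgebra F A) :=
  IsScalarTower.of_algebraMap_eq fun _ => rfl

theorem algebraMap_residue (a : 𝒪[F]) :
    algebraMap 𝓀[F] (ResidueAlgebra F A) (IsLocalRing.residue 𝒪[F] a) =
      algebraMap 𝒪[F] (ResidueAlgebra F A) a := rfl

instance : Module.Finite 𝒪[F] (ResidueAlgebra F A) := by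
  have : Module.Finite 𝒪[F] (maxOrder F A) := Module.Finite.of_fg (maxOrder_fg F)
  exact Module.Finite.of_surjective (residueMap F A).toLinearMap residueMap_surjective

instance : Module.Finite 𝓀[F] (ResidueAlgebra F A) :=
  Module.Finite.of_restrictScalars_finite 𝒪[F] 𝓀[F] (ResidueAlgebra F A)

instance : Finite (ResidueAlgebra F A) := Module.finite_of_finite 𝓀[F]

/-- Wedderburn's little theorem: a finite domain is a field. -/
instance : Field (ResidueAlgebra F A) := (Finite.isDomain_to_isField (ResidueAlgebra F A)).toField

theorem card_residueAlgebra :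
    Nat.card (ResidueAlgebra F A) =
      residueCard F ^ Module.finrank 𝓀[F] (ResidueAlgebra F A) :=
  Module.natCard_eq_pow_finrank

/-- The reduction of the quadratic polynomial `X ^ 2 + t X + n`. -/
def residueQuadratic (t n : 𝒪[F]) : Polynomial 𝓀[F] :=
  .X ^ 2 + .C (IsLocalRing.residue _ t) * .X + .C (IsLocalRing.residue _ n)

theorem natDegree_residueQuadratic (t n : 𝒪[F]) : (residueQuadratic t n).natDegree = 2 := by
  have := Polynomial.natDegree_quadratic (R := 𝓀[F]) (a := 1) (b := IsLocalRing.residue _ t)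
    (c := IsLocalRing.residue _ n) one_ne_zero
  simpa [residueQuadratic] using this

theorem monic_residueQuadratic (t n : 𝒪[F]) : (residueQuadratic t n).Monic := by
  have := Polynomial.leadingCoeff_quadratic (R := 𝓀[F]) (a := 1) (b := IsLocalRing.residue _ t)
    (c := IsLocalRing.residue _ n) one_ne_zero
  simpa [residueQuadratic, Polynomial.Monic] using this

theorem eval_residueQuadratic_ne_zero {t n : 𝒪[F]}
    (H : ∀ c : 𝒪[F], absF F ((c : F) ^ 2 + t * c + n) = 1) (c : 𝓀[F]) :
    (residueQuadratic t n).eval c ≠ 0 := by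
  intro hc
  obtain ⟨c, rfl⟩ := IsLocalRing.residue_surjective c
  simp only [residueQuadratic, Polynomial.eval_add, Polynomial.eval_pow, Polynomial.eval_X,
    Polynomial.eval_mul, Polynomial.eval_C, ← map_pow, ← map_mul, ← map_add] at hc
  rw [IsLocalRing.residue_eq_zero_iff] at hc
  exact (absF_lt_one_of_mem hc).ne (H c)

theorem irreducible_residueQuadratic {t n : 𝒪[F]}
    (H : ∀ c : 𝒪[F], absF F ((c : F) ^ 2 + t * c + n) = 1) :
    Irreducible (residueQuadratic t n) := by
  have hdeg := natDegree_residueQuadratic t n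
  rw [Polynomial.irreducible_iff_roots_eq_zero_of_degree_le_three (by omega) (by omega),
    Multiset.eq_zero_iff_forall_notMem]
  exact fun c hc => eval_residueQuadratic_ne_zero H c (Polynomial.mem_roots'.1 hc).2

/-- If a monic quadratic polynomial takes unit values at integral scalars and the residue
algebra has odd degree, then it takes unit values at all integral elements. -/
theorem algAbs_quadratic_eq_one (hodd : Odd (Module.finrank 𝓀[F] (ResidueAlgebra F A)))
    (t n : 𝒪[F]) (H : ∀ c : 𝒪[F], absF F ((c : F) ^ 2 + t * c + n) = 1) {w : A}
    (hw : algAbs F w ≤ 1) :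
    algAbs F (w ^ 2 + (t : F) • w + algebraMap F A n) = 1 := by
  set w' : maxOrder F A := ⟨w, (mem_maxOrder F).2 hw⟩
  have hmem : w ^ 2 + (t : F) • w + algebraMap F A n =
      ((w' ^ 2 + t • w' + algebraMap 𝒪[F] _ n : maxOrder F A) : A) := rfl
  have hle : algAbs F (w ^ 2 + (t : F) • w + algebraMap F A n) ≤ 1 := by
    rw [hmem]; exact (mem_maxOrder F).1 (Subtype.prop _)
  by_contra hne
  have hlt := lt_of_le_of_ne hle hne
  rw [hmem] at hlt
  have hzero : residueMap F A (w' ^ 2 + t • w' + algebraMap 𝒪[F] _ n) = 0 :=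
    residueMap_eq_zero.2 hlt
  set α : ResidueAlgebra F A := residueMap F A w'
  have hroot : Polynomial.aeval α (residueQuadratic t n) = 0 := by
    simp only [residueQuadratic, map_add, map_mul, map_pow, Polynomial.aeval_X, Polynomial.aeval_C]
    rw [algebraMap_residue, algebraMap_residue]
    rw [← hzero, map_add, map_add, map_pow, map_smul, Algebra.smul_def, AlgHom.commutes]
  -- If the value were not a unit, the reduction of w would be a root of an irreducible quadratic,
  -- so 2 would divide the odd residue degree.
  have hmin : minpoly 𝓀[F] α = residueQuadratic t n :=
    (minpoly.eq_of_irreducible_of_monic (irreducible_residueQuadratic H) hroot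
      (monic_residueQuadratic t n)).symm
  have hdvd := minpoly.degree_dvd (K := 𝓀[F]) (x := α) (Algebra.IsIntegral.isIntegral α)
  rw [hmin, natDegree_residueQuadratic] at hdvd
  exact (Nat.not_even_iff_odd.2 hodd) (even_iff_two_dvd.2 hdvd)

end Residue


/-! ### Uniformisers, ramification and residue degree -/

section Uniformiser

variable (F : Type*) [Field F] [ValuativeRel F] [TopologicalSpace F]
  [IsNonarchimedeanLocalField F] (A : Type*) [Ring A] [Algebra F A]
  [IsDomain A] [FiniteDimensional F A]

theorem uniformiser_ne_zero : (uniformiser F : F) ≠ 0 := fun h =>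
  (uniformiser_irreducible F).ne_zero (Subtype.ext h)

theorem algAbs_uniformiser :
    algAbs F (algebraMap F A (uniformiser F : F)) =
      ((residueCard F : ℝ) ^ Module.finrank F A)⁻¹ := by
  rw [algAbs_algebraMap, absF_uniformiser, inv_pow]

/-- All absolute values are powers of q; ϖ is taken with |ϖ| = q^(-k) for the least possible k > 0,
and division with remainder shows that k divides every exponent. -/
theorem exists_algUniformiser :
    ∃ ϖ : Aˣ, algAbs F (ϖ : A) < 1 ∧ ∀ x : A, x ≠ 0 → ∃ n : ℤ, algAbs F x = algAbs F (ϖ : A) ^ n := by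
  classical
  have hq := one_lt_residueCard_real F
  have hq0 : (0 : ℝ) < residueCard F := zero_lt_one.trans hq
  have hex : ∃ k : ℕ, 0 < k ∧ ∃ x : Aˣ, algAbs F (x : A) = (residueCard F : ℝ) ^ (-(k : ℤ)) := by
    refine ⟨Module.finrank F A, Module.finrank_pos, ?_⟩
    obtain ⟨u, hu⟩ := isUnit_of_ne_zero F
      (show algebraMap F A (uniformiser F : F) ≠ 0 by simpa using uniformiser_ne_zero F)
    refine ⟨u, ?_⟩
    rw [hu, algAbs_uniformiser, zpow_neg, zpow_natCast]
  obtain ⟨hk, ϖ, hϖ⟩ := Nat.find_spec hex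
  set k := Nat.find hex
  have hkz : (0 : ℤ) < k := by exact_mod_cast hk
  refine ⟨ϖ, ?_, fun x hx => ?_⟩
  · rw [hϖ]
    exact zpow_lt_one_of_neg₀ hq (by omega)
  obtain ⟨u, rfl⟩ := isUnit_of_ne_zero F hx
  obtain ⟨m, hm⟩ := exists_algAbs_eq_zpow F hx
  refine ⟨-(m / k), ?_⟩
  have hr : m % k = 0 := by
    by_contra hne
    have h0 := Int.emod_nonneg m hkz.ne'
    have h1 := Int.emod_lt_of_pos m hkz
    have hlt : (m % k).toNat < k := by omega
    -- With |u| = q^m, the element (u ϖ^(m/k))⁻¹ has absolute value q^(-(m mod k)), which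
    -- contradicts the minimality of k.
    refine Nat.find_min hex hlt ⟨by omega, (u * ϖ ^ (m / k))⁻¹, ?_⟩
    have hzp : ∀ j : ℤ, algAbs F ((ϖ ^ j : Aˣ) : A) = algAbs F (ϖ : A) ^ j := by
      intro j
      cases j with
      | ofNat j => simp [algAbs_pow]
      | negSucc j => simp [algAbs_units_inv, algAbs_pow, zpow_negSucc]
    rw [algAbs_units_inv, Units.val_mul, algAbs_mul, hm, hzp, hϖ, ← zpow_mul,
      ← zpow_add₀ hq0.ne', ← zpow_neg]
    congr 1
    rw [Int.toNat_of_nonneg h0]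
    have := Int.mul_ediv_add_emod m k
    linarith
  rw [hm, hϖ, ← zpow_mul]
  congr 1
  have := Int.mul_ediv_add_emod m k
  linarith

variable {F A} in
/-- Elements whose sum vanishes and whose nonzero members have distinct absolute values are zero. -/
theorem eq_zero_of_sum_eq_zero {ι : Type*} (s : Finset ι) (x : ι → A)
    (hdist : ∀ i ∈ s, ∀ j ∈ s, i ≠ j → x i ≠ 0 → algAbs F (x i) ≠ algAbs F (x j))
    (hsum : ∑ i ∈ s, x i = 0) : ∀ i ∈ s, x i = 0 := by
  classical
  by_contra! hne
  obtain ⟨i₀, hi₀, hx₀⟩ := hne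
  obtain ⟨i, hi, hmax⟩ := s.exists_max_image (fun i => algAbs F (x i)) ⟨i₀, hi₀⟩
  have hpos : 0 < algAbs F (x i) := (algAbs_pos F hx₀).trans_le (hmax i₀ hi₀)
  have hxi : x i ≠ 0 := fun h => by simp [h] at hpos
  have hlt : algAbs F (∑ j ∈ s.erase i, x j) < algAbs F (x i) := by
    refine Finset.sum_induction x (fun y => algAbs F y < algAbs F (x i))
      (fun a b ha hb => (algAbs_add_le F a b).trans_lt (max_lt ha hb)) (by simpa using hpos) ?_
    intro j hj
    rw [Finset.mem_erase] at hj
    exact lt_of_le_of_ne (hmax j hj.2) (hdist i hi j hj.2 hj.1.symm hxi).symm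
  rw [← Finset.add_sum_erase s x hi, ← eq_neg_iff_add_eq_zero] at hsum
  rw [hsum, algAbs_neg] at hlt
  exact lt_irrefl _ hlt

-- The nonzero terms g_i ϖ^i have absolute values |ϖ|^r with r congruent to i modulo e, hence
-- pairwise distinct, and cannot cancel. Together with `le_of_linearIndependent_pow` this bounds the
-- ramification index.
variable {F A} in
theorem linearIndependent_pow_uniformiser {ϖ : A} {e : ℕ} (h0 : ϖ ≠ 0) (h1 : algAbs F ϖ < 1)
    (he : algAbs F ϖ ^ e = algAbs F (algebraMap F A (uniformiser F : F))) :
    LinearIndependent F fun i : Fin e => ϖ ^ (i : ℕ) := by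
  rw [Fintype.linearIndependent_iff]
  intro g hg
  have hp := algAbs_pos F h0
  have hval : ∀ i : Fin e, g i ≠ 0 →
      ∃ n : ℤ, algAbs F (g i • ϖ ^ (i : ℕ)) = algAbs F ϖ ^ ((e : ℤ) * n + i) := by
    intro i hi
    obtain ⟨n, hn⟩ := exists_absF_eq_zpow hi
    refine ⟨-n, ?_⟩
    have hswap : ((residueCard F : ℝ) ^ n) ^ Module.finrank F A =
        ((residueCard F : ℝ) ^ Module.finrank F A) ^ n := by
      rw [← zpow_natCast, ← zpow_mul, mul_comm, zpow_mul, zpow_natCast]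
    rw [algAbs_smul, algAbs_pow, zpow_add₀ hp.ne', zpow_natCast, zpow_mul, zpow_natCast, he,
      algAbs_uniformiser, hn, inv_zpow', neg_neg, hswap]
  have hz := eq_zero_of_sum_eq_zero Finset.univ (fun i : Fin e => g i • ϖ ^ (i : ℕ)) (F := F) ?_ hg
  · intro i
    have := hz i (Finset.mem_univ _)
    exact (smul_eq_zero.1 this).resolve_right (pow_ne_zero _ h0)
  · intro i _ j _ hij hi heq
    have hgi : g i ≠ 0 := fun h => hi (by simp [h])
    have hgj : g j ≠ 0 := fun h => by
      simp only [h, zero_smul, algAbs_zero, algAbs_eq_zero] at heq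
      exact hi heq
    obtain ⟨n, hn⟩ := hval i hgi
    obtain ⟨m, hm⟩ := hval j hgj
    rw [hn, hm] at heq
    have := zpow_right_injective₀ hp h1.ne heq
    apply hij
    have h3 : ((i : ℕ) : ℤ) % e = ((j : ℕ) : ℤ) % e := by
      have := congrArg (· % (e : ℤ)) this
      simpa [Int.add_emod] using this
    rw [Int.emod_eq_of_lt (by positivity) (by exact_mod_cast i.2),
      Int.emod_eq_of_lt (by positivity) (by exact_mod_cast j.2)] at h3
    exact Fin.ext (by exact_mod_cast h3)

/-- The element ζ lifts a primitive element of the residue field. A linear relation, divided by its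
largest coefficient, would reduce to a nontrivial relation below the degree of the minimal
polynomial. This bounds the residue degree in the same way. -/
theorem exists_linearIndependent_pow_residue :
    ∃ ζ : A, LinearIndependent F
      fun i : Fin (Module.finrank 𝓀[F] (ResidueAlgebra F A)) => ζ ^ (i : ℕ) := by
  obtain ⟨α, hα⟩ := Field.exists_primitive_element_of_finite_bot 𝓀[F] (ResidueAlgebra F A)
  have hint : IsIntegral 𝓀[F] α := Algebra.IsIntegral.isIntegral α
  have hdeg : (minpoly 𝓀[F] α).natDegree = Module.finrank 𝓀[F] (ResidueAlgebra F A) := by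
    rw [← IntermediateField.adjoin.finrank hint, hα, IntermediateField.finrank_top']
  have hli : LinearIndependent 𝓀[F]
      fun i : Fin (Module.finrank 𝓀[F] (ResidueAlgebra F A)) => α ^ (i : ℕ) := by
    rw [← hdeg]; exact linearIndependent_pow α
  obtain ⟨z, hz⟩ := residueMap_surjective α
  refine ⟨z, ?_⟩
  rw [Fintype.linearIndependent_iff]
  intro g hg
  by_contra! hne
  obtain ⟨i₀, hi₀⟩ := hne
  obtain ⟨j, -, hmax⟩ := Finset.univ.exists_max_image (fun i => absF F (g i)) ⟨i₀, Finset.mem_univ _⟩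
  have hj : g j ≠ 0 := by
    have := (absF_pos hi₀).trans_le (hmax i₀ (Finset.mem_univ _))
    intro h
    simp [h] at this
  let a : Fin (Module.finrank 𝓀[F] (ResidueAlgebra F A)) → 𝒪[F] := fun i =>
    ⟨(g j)⁻¹ * g i, absF_le_one_iff.1 (by
      rw [absF_mul, absF_inv, inv_mul_le_iff₀ (absF_pos hj), mul_one]
      exact hmax i (Finset.mem_univ _))⟩
  have hsum : ∑ i, a i • z ^ (i : ℕ) = 0 := by
    apply Subtype.ext
    have h2 : ((∑ i, a i • z ^ (i : ℕ) : maxOrder F A) : A) = (g j)⁻¹ • ∑ i, g i • (z : A) ^ (i : ℕ) := by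
      rw [Finset.smul_sum, AddSubmonoidClass.coe_finsetSum]
      refine Finset.sum_congr rfl fun i _ => ?_
      rw [smul_smul]
      rfl
    rw [h2, hg, smul_zero]
    rfl
  have h3 := congrArg (residueMap F A) hsum
  rw [map_zero, map_sum] at h3
  have h4 : ∑ i, (IsLocalRing.residue 𝒪[F] (a i)) • α ^ (i : ℕ) = 0 := by
    rw [← h3]
    refine Finset.sum_congr rfl fun i _ => ?_
    rw [map_smul, map_pow, hz, Algebra.smul_def, Algebra.smul_def, algebraMap_residue]
  have h5 := Fintype.linearIndependent_iff.1 hli _ h4 j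
  rw [IsLocalRing.residue_eq_zero_iff] at h5
  have h6 := absF_lt_one_of_mem h5
  have h7 : (a j : F) = 1 := inv_mul_cancel₀ hj
  rw [h7, absF_one] at h6
  exact lt_irrefl _ h6

-- This is the inequality n ≤ e f. The products ζ_i ϖ^t with t < e, where the ζ_i lift a residue
-- basis, generate the maximal order modulo ϖ^e, that is modulo the uniformiser of F; Nakayama's
-- lemma then makes them generate it.
variable {F A} in
theorem finrank_le_ramification_mul_residue {ϖ : Aˣ} {e : ℕ} (h1 : algAbs F (ϖ : A) < 1)
    (hϖ : ∀ x : A, x ≠ 0 → ∃ n : ℤ, algAbs F x = algAbs F (ϖ : A) ^ n)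
    (he : algAbs F (ϖ : A) ^ e = algAbs F (algebraMap F A (uniformiser F : F))) :
    Module.finrank F A ≤ e * Module.finrank 𝓀[F] (ResidueAlgebra F A) := by
  classical
  set f := Module.finrank 𝓀[F] (ResidueAlgebra F A)
  let b := Module.finBasis 𝓀[F] (ResidueAlgebra F A)
  choose ζ hζ using fun i => residueMap_surjective (b i)
  have hp := algAbs_pos F ϖ.ne_zero
  have hlt : ∀ x : A, algAbs F x < 1 → algAbs F (x * ((ϖ⁻¹ : Aˣ) : A)) ≤ 1 := by
    intro x hx
    by_cases hx0 : x = 0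
    · simp [hx0]
    obtain ⟨n, hn⟩ := hϖ x hx0
    rw [algAbs_mul, algAbs_units_inv, hn, mul_inv_le_iff₀ hp, one_mul]
    rw [hn] at hx
    have : 0 < n := by
      by_contra! hn0
      exact absurd hx (not_lt.2 (one_le_zpow_of_nonpos₀ hp h1.le hn0))
    calc algAbs F (ϖ : A) ^ n ≤ algAbs F (ϖ : A) ^ (1 : ℤ) :=
          zpow_le_zpow_right_of_le_one₀ hp h1.le (by omega)
      _ = _ := zpow_one _
  let N : ℕ → Submodule 𝒪[F] A := fun t =>
    Submodule.span 𝒪[F] (Set.range fun p : Fin t × Fin f => (ζ p.2 : A) * (ϖ : A) ^ (p.1 : ℕ))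
  -- ϖ-adic expansion to t digits: the remainder r is expressed in the ζ_i up to an element of
  -- absolute value < 1, from which a factor ϖ is split off on the right.
  have hstep : ∀ t (x : A), algAbs F x ≤ 1 → ∃ y ∈ N t, ∃ r : A, algAbs F r ≤ 1 ∧
      x = y + r * (ϖ : A) ^ t := by
    intro t
    induction t with
    | zero => exact fun x hx => ⟨0, Submodule.zero_mem _, x, hx, by simp⟩
    | succ t ih =>
      intro x hx
      obtain ⟨y, hy, r, hr, rfl⟩ := ih x hx
      let r' : maxOrder F A := ⟨r, (mem_maxOrder F).2 hr⟩
      choose c hc using fun i => IsLocalRing.residue_surjective (b.repr (residueMap F A r') i)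
      have hres : residueMap F A (r' - ∑ i, c i • ζ i) = 0 := by
        rw [map_sub, map_sum, sub_eq_zero]
        conv_lhs => rw [← b.sum_repr (residueMap F A r')]
        refine Finset.sum_congr rfl fun i _ => ?_
        rw [map_smul, hζ, ← hc, Algebra.smul_def, Algebra.smul_def, algebraMap_residue]
      rw [residueMap_eq_zero] at hres
      set z : A := ((r' - ∑ i, c i • ζ i : maxOrder F A) : A)
      have hrz : r = ∑ i, c i • (ζ i : A) + z := by
        simp only [z, Subalgebra.coe_sub, AddSubmonoidClass.coe_finsetSum]
        change r = _ + (r - ∑ i, c i • (ζ i : A))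
        abel
      refine ⟨y + (∑ i, c i • (ζ i : A)) * (ϖ : A) ^ t, ?_, z * ((ϖ⁻¹ : Aˣ) : A), hlt z hres, ?_⟩
      · refine Submodule.add_mem _ ?_ ?_
        · refine Submodule.span_mono ?_ hy
          rintro _ ⟨p, rfl⟩
          exact ⟨(p.1.castSucc, p.2), rfl⟩
        · rw [Finset.sum_mul]
          refine Submodule.sum_mem _ fun i _ => ?_
          rw [smul_mul_assoc]
          exact Submodule.smul_mem _ _ (Submodule.subset_span ⟨(Fin.last t, i), rfl⟩)
      · rw [pow_succ', ← mul_assoc, mul_assoc z, Units.inv_mul, mul_one, add_assoc, ← add_mul, ← hrz]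
  have hle : Subalgebra.toSubmodule (maxOrder F A) ≤ N e := by
    refine Submodule.le_of_le_smul_of_le_jacobson_bot (I := 𝓂[F]) (maxOrder_fg F)
      (IsLocalRing.maximalIdeal_le_jacobson _) ?_
    intro x hx
    obtain ⟨y, hy, r, hr, rfl⟩ := hstep e x ((mem_maxOrder F).1 hx)
    refine Submodule.add_mem_sup hy ?_
    have hr' : algAbs F ((uniformiser F : F)⁻¹ • (r * (ϖ : A) ^ e)) ≤ 1 := by
      have := algAbs_smul F (uniformiser F : F)⁻¹ (r * (ϖ : A) ^ e)
      rw [this, algAbs_mul, algAbs_pow, he, algAbs_algebraMap, mul_comm (algAbs F r), ← mul_assoc,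
        ← mul_pow, ← absF_mul, inv_mul_cancel₀ (uniformiser_ne_zero F), absF_one, one_pow, one_mul]
      exact hr
    have h2 : r * (ϖ : A) ^ e = uniformiser F • ((uniformiser F : F)⁻¹ • (r * (ϖ : A) ^ e)) := by
      change _ = (uniformiser F : F) • ((uniformiser F : F)⁻¹ • (r * (ϖ : A) ^ e))
      rw [smul_smul, mul_inv_cancel₀ (uniformiser_ne_zero F), one_smul]
    rw [h2]
    refine Submodule.smul_mem_smul ?_ ((mem_maxOrder F).2 hr')
    rw [(uniformiser_irreducible F).maximalIdeal_eq]
    exact Ideal.mem_span_singleton_self _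
  have htop : Submodule.span F
      (Set.range fun p : Fin e × Fin f => (ζ p.2 : A) * (ϖ : A) ^ (p.1 : ℕ)) = ⊤ := by
    rw [eq_top_iff]
    intro x _
    obtain ⟨c, hc0, hc⟩ := exists_lt_absF (F := F) (max 1 (algAbs F x))
    have hn : Module.finrank F A ≠ 0 := Module.finrank_pos.ne'
    have hx1 : algAbs F (c⁻¹ • x) ≤ 1 := by
      have h1c : 1 < absF F c := (le_max_left _ _).trans_lt hc
      rw [algAbs_smul, absF_inv, inv_pow, inv_mul_le_iff₀ (pow_pos (absF_pos hc0) _), mul_one]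
      exact ((le_max_right _ _).trans hc.le).trans (le_self_pow₀ h1c.le hn)
    have h2 := Submodule.span_le_restrictScalars 𝒪[F] F _ (hle ((mem_maxOrder F).2 hx1))
    have h3 := Submodule.smul_mem _ c h2
    rwa [smul_smul, mul_inv_cancel₀ hc0, one_smul] at h3
  have := finrank_range_le_card (R := F)
    (b := fun p : Fin e × Fin f => (ζ p.2 : A) * (ϖ : A) ^ (p.1 : ℕ))
  rw [Set.finrank, htop, finrank_top] at this
  simpa using this

end Uniformiser

/-! ### Subfields of a central division algebra -/

section Subfields

variable {F D : Type*} [Field F] [DivisionRing D] [Algebra F D]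

/-- In effect D ⊗ Dᵒᵖ acts faithfully on D. Normalise one coefficient to 1; comparing the relation
at c y with c times the relation at y leaves a shorter relation whose coefficients are commutators.
So all coefficients are central, hence in F, and y = 1 contradicts the independence of v. -/
theorem eq_zero_of_forall_sum_mul_mul [Algebra.IsCentral F D] {ι : Type*} (v : ι → D)
    (hv : LinearIndependent F v) (s : Finset ι) :
    ∀ a : ι → D, (∀ y, ∑ i ∈ s, a i * y * v i = 0) → ∀ i ∈ s, a i = 0 := by
  classical
  induction s using Finset.induction_on with
  | empty => simp
  | insert j s hj ih =>
    intro a ha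
    have haj : a j = 0 := by
      by_contra haj
      have h1 : ∀ y, y * v j + ∑ i ∈ s, ((a j)⁻¹ * a i) * y * v i = 0 := by
        intro y
        have h := congrArg ((a j)⁻¹ * ·) (ha y)
        simp only [Finset.sum_insert hj, mul_add, Finset.mul_sum, mul_zero] at h
        rw [← h]
        congr 1
        · simp [mul_assoc, haj]
        · exact Finset.sum_congr rfl fun i _ => by simp only [mul_assoc]
      have hcent : ∀ i ∈ s, ∀ c : D, ((a j)⁻¹ * a i) * c = c * ((a j)⁻¹ * a i) := by
        intro i hi c
        have := ih (fun i => ((a j)⁻¹ * a i) * c - c * ((a j)⁻¹ * a i)) (fun y => by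
          have e1 := h1 (c * y)
          have e2 := congrArg (c * ·) (h1 y)
          simp only [mul_add, mul_zero, Finset.mul_sum] at e2
          have e3 := e1.trans e2.symm
          rw [mul_assoc, add_left_cancel_iff] at e3
          rw [← sub_eq_zero, ← Finset.sum_sub_distrib] at e3
          rw [← e3]
          refine Finset.sum_congr rfl fun i _ => ?_
          simp only [sub_mul, mul_assoc]) i hi
        exact sub_eq_zero.1 this
      have hF : ∀ i ∈ s, ∃ r : F, algebraMap F D r = (a j)⁻¹ * a i := by
        intro i hi
        have hmem : (a j)⁻¹ * a i ∈ Subalgebra.center F D :=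
          Subalgebra.mem_center_iff.2 fun b => (hcent i hi b).symm
        rw [Algebra.IsCentral.center_eq_bot, Algebra.mem_bot] at hmem
        exact hmem
      choose! r hr using hF
      have h2 := h1 1
      rw [one_mul] at h2
      have h3 : ∑ i ∈ insert j s, (if i = j then (1 : F) else r i) • v i = 0 := by
        rw [Finset.sum_insert hj, ← h2]
        congr 1
        · simp
        · refine Finset.sum_congr rfl fun i hi => ?_
          rw [if_neg (show i ≠ j from fun h => hj (h ▸ hi)), mul_one, ← hr i hi, Algebra.smul_def]
      have := linearIndependent_iff'.1 hv _ _ h3 j (Finset.mem_insert_self _ _)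
      simp at this
    intro i hi
    rcases Finset.mem_insert.1 hi with rfl | hi
    · exact haj
    · refine ih a (fun y => ?_) i hi
      have := ha y
      rwa [Finset.sum_insert hj, haj, zero_mul, zero_mul, zero_add] at this

/-- The powers of an element of a central division algebra of degree `d` span a space of
dimension at most `d`. -/
theorem le_of_linearIndependent_pow [Algebra.IsCentral F D] [FiniteDimensional F D] {d : ℕ}
    (hd : Module.finrank F D = d ^ 2) (x : D) {m : ℕ}
    (hx : LinearIndependent F fun i : Fin m => x ^ (i : ℕ)) : m ≤ d := by
  classical
  -- S is the field F[x], put in the opposite algebra so that it acts on D by right multiplication.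
  let S : Subalgebra F Dᵐᵒᵖ := Algebra.adjoin F {MulOpposite.op x}
  have : IsMulCommutative S := Algebra.isMulCommutative_adjoin F (by simp)
  have : FiniteDimensional F Dᵐᵒᵖ := Module.Finite.equiv (MulOpposite.opLinearEquiv F : D ≃ₗ[F] Dᵐᵒᵖ)
  have hfd : Module.Finite F S := inferInstance
  have hfield : IsField S := by
    refine isField_of_isIntegral_of_isField' (R := F) (Field.toIsField F)
  let : Field S := hfield.toField
  have : Module.Finite S D := Module.Finite.of_restrictScalars_finite F S D
  have hmul := Module.finrank_mul_finrank F S D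
  have hmS : m ≤ Module.finrank F S := by
    have hli : LinearIndependent F fun i : Fin m =>
        (⟨MulOpposite.op x, Algebra.subset_adjoin rfl⟩ : S) ^ (i : ℕ) := by
      refine LinearIndependent.of_comp (S.val.toLinearMap) ?_
      have := hx.map' (MulOpposite.opLinearEquiv F : D ≃ₗ[F] Dᵐᵒᵖ).toLinearMap
        (LinearEquiv.ker _)
      exact this
    simpa using hli.fintype_card_le_finrank
  let b := Module.finBasis S D
  -- A relation ∑ a_i y x^i = 0 is right S-linear in y, so testing it on an S-basis of D suffices.
  -- Injectivity of Φ gives m ≤ dim_S D; as also m ≤ dim_F S, it follows that m² ≤ d².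
  let Φ : (Fin m → D) →ₗ[F] (Fin (Module.finrank S D) → D) :=
    { toFun := fun a k => ∑ i, a i * b k * x ^ (i : ℕ)
      map_add' := fun a a' => by
        funext k; simp [add_mul, Finset.sum_add_distrib]
      map_smul' := fun c a => by
        funext k; simp [Finset.smul_sum] }
  have hΦ : Function.Injective Φ := by
    rw [← LinearMap.ker_eq_bot, LinearMap.ker_eq_bot']
    intro a ha
    have hall : ∀ y, ∑ i, a i * y * x ^ (i : ℕ) = 0 := by
      intro y
      let ψ : D →ₗ[S] D :=
        { toFun := fun y => ∑ i, a i * y * x ^ (i : ℕ)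
          map_add' := fun y y' => by simp [mul_add, add_mul, Finset.sum_add_distrib]
          map_smul' := fun s y => by
            have hs : ∀ z : D, s • z = z * MulOpposite.unop (s : Dᵐᵒᵖ) := fun z => rfl
            have hcomm : ∀ i : ℕ, MulOpposite.unop (s : Dᵐᵒᵖ) * x ^ i =
                x ^ i * MulOpposite.unop (s : Dᵐᵒᵖ) := by
              intro i
              have := congrArg (fun z : S => MulOpposite.unop (z : Dᵐᵒᵖ))
                (mul_comm s ((⟨MulOpposite.op x, Algebra.subset_adjoin rfl⟩ : S) ^ i))
              exact this.symm
            simp only [hs, RingHom.id_apply, Finset.sum_mul]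
            refine Finset.sum_congr rfl fun i _ => ?_
            rw [mul_assoc, mul_assoc, mul_assoc, hcomm, ← mul_assoc y, ← mul_assoc, ← mul_assoc]
            simp only [mul_assoc] }
      have hψ : ψ = 0 := b.ext fun k => congrFun ha k
      exact LinearMap.congr_fun hψ y
    funext i
    exact eq_zero_of_forall_sum_mul_mul _ hx Finset.univ a hall i (Finset.mem_univ _)
  have hle := LinearMap.finrank_le_finrank_of_injective hΦ
  rw [Module.finrank_pi_fintype, Module.finrank_pi_fintype] at hle
  simp only [Finset.sum_const, Finset.card_univ, Fintype.card_fin, smul_eq_mul] at hle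
  have hpos : 0 < Module.finrank F D := Module.finrank_pos
  have hle' := Nat.le_of_mul_le_mul_right hle hpos
  rw [hd] at hmul
  by_contra! hlt
  nlinarith

end Subfields

/-! ### The structure of a central division algebra over a local field -/

section Structure

variable {F : Type*} [Field F] [ValuativeRel F] [TopologicalSpace F]
  [IsNonarchimedeanLocalField F] {D : Type*} [DivisionRing D] [Algebra F D]
  [Algebra.IsCentral F D] [FiniteDimensional F D]

/-- The residue degree of a central division algebra of degree `d` is `d`, and its value group
is generated by `q ^ d`. -/
theorem exists_uniformiser_of_central {d : ℕ} (hd : Module.finrank F D = d ^ 2) :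
    Module.finrank 𝓀[F] (ResidueAlgebra F D) = d ∧
      (∃ ϖ : Dˣ, algAbs F (ϖ : D) = ((residueCard F : ℝ) ^ d)⁻¹) ∧
      ∀ x : D, x ≠ 0 → ∃ n : ℤ, algAbs F x = ((residueCard F : ℝ) ^ d) ^ n := by
  obtain ⟨ϖ, h1, hϖ⟩ := exists_algUniformiser F D
  have hp := algAbs_pos F ϖ.ne_zero
  have hu0 : algebraMap F D (uniformiser F : F) ≠ 0 := by simpa using uniformiser_ne_zero F
  obtain ⟨e', he'⟩ := hϖ _ hu0
  have hd0 : d ≠ 0 := by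
    rintro rfl
    have : 0 < Module.finrank F D := Module.finrank_pos
    omega
  have hq := one_lt_residueCard_real F
  have hpos : 0 ≤ e' := by
    by_contra! hneg
    have h2 : algAbs F (algebraMap F D (uniformiser F : F)) < 1 := by
      rw [algAbs_uniformiser]
      exact inv_lt_one_of_one_lt₀ (one_lt_pow₀ hq Module.finrank_pos.ne')
    rw [he'] at h2
    exact absurd h2 (not_lt.2 (one_le_zpow_of_nonpos₀ hp h1.le hneg.le))
  lift e' to ℕ using hpos with e
  rw [zpow_natCast] at he'
  have hle := finrank_le_ramification_mul_residue h1 hϖ he'.symm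
  have he := le_of_linearIndependent_pow hd _ (linearIndependent_pow_uniformiser ϖ.ne_zero h1 he'.symm)
  obtain ⟨ζ, hζ⟩ := exists_linearIndependent_pow_residue F D
  have hf := le_of_linearIndependent_pow hd _ hζ
  rw [hd] at hle
  -- From d² ≤ e f with e ≤ d and f ≤ d, both factors equal d.
  have hfd : Module.finrank 𝓀[F] (ResidueAlgebra F D) = d := by nlinarith
  have hed : e = d := by
    rw [hfd] at hle
    nlinarith [Nat.pos_of_ne_zero hd0]
  have hval : algAbs F (ϖ : D) = ((residueCard F : ℝ) ^ d)⁻¹ := by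
    rw [algAbs_uniformiser, hd, hed, sq, pow_mul, ← inv_pow] at he'
    exact ((pow_left_inj₀ (by positivity) hp.le hd0).1 he').symm
  refine ⟨hfd, ⟨ϖ, hval⟩, fun x hx => ?_⟩
  obtain ⟨n, hn⟩ := hϖ x hx
  exact ⟨-n, by rw [hn, hval, inv_zpow']⟩

end Structure


/-! ### Quadratic field extensions -/

section Quadratic

variable {K L : Type*} [Field K] [Field L] [Algebra K L] (hL : Module.finrank K L = 2)
  {θ : L} (hθ : θ ∉ Set.range (algebraMap K L))

/-- The basis `1, θ` of a quadratic extension. -/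
def quadBasis (hL : Module.finrank K L = 2) {θ : L} (hθ : θ ∉ Set.range (algebraMap K L)) :
    Module.Basis (Fin 2) K L :=
  basisOfLinearIndependentOfCardEqFinrank (b := ![1, θ])
    (by
      rw [LinearIndependent.pair_iff]
      intro s t h
      have ht : t = 0 := by
        by_contra ht
        refine hθ ⟨-(t⁻¹ * s), ?_⟩
        rw [Algebra.smul_def, Algebra.smul_def, mul_one] at h
        have ht' : algebraMap K L t ≠ 0 := by simpa using ht
        rw [map_neg, map_mul, map_inv₀]
        field_simp
        linear_combination -h
      refine ⟨?_, ht⟩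
      simpa [ht] using h)
    (by simp [hL])

theorem quadBasis_zero : quadBasis hL hθ 0 = 1 := by simp [quadBasis]
theorem quadBasis_one : quadBasis hL hθ 1 = θ := by simp [quadBasis]

include hL hθ in
theorem exists_eq_add_mul (e : L) : ∃ a b : K, e = algebraMap K L a + algebraMap K L b * θ := by
  refine ⟨(quadBasis hL hθ).repr e 0, (quadBasis hL hθ).repr e 1, ?_⟩
  conv_lhs => rw [← (quadBasis hL hθ).sum_repr e]
  rw [Fin.sum_univ_two, quadBasis_zero, quadBasis_one, Algebra.smul_def, Algebra.smul_def, mul_one]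

theorem quadBasis_repr (a b : K) :
    (quadBasis hL hθ).repr (algebraMap K L a + algebraMap K L b * θ) = ![a, b] := by
  have : algebraMap K L a + algebraMap K L b * θ =
      a • quadBasis hL hθ 0 + b • quadBasis hL hθ 1 := by
    rw [quadBasis_zero, quadBasis_one, Algebra.smul_def, Algebra.smul_def, mul_one]
  rw [this]
  funext i
  fin_cases i <;> simp

include hL hθ in
theorem norm_quadratic {t n : K} (h : θ ^ 2 = algebraMap K L t * θ - algebraMap K L n) (a b : K) :
    Algebra.norm K (algebraMap K L a + algebraMap K L b * θ) = a ^ 2 + t * a * b + n * b ^ 2 := by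
  rw [Algebra.norm_eq_matrix_det (quadBasis hL hθ), Matrix.det_fin_two]
  simp only [Algebra.leftMulMatrix_eq_repr_mul, quadBasis_zero, quadBasis_one]
  have h1 : (algebraMap K L a + algebraMap K L b * θ) * θ =
      algebraMap K L (-(n * b)) + algebraMap K L (a + t * b) * θ := by
    simp only [map_neg, map_add, map_mul]
    linear_combination (algebraMap K L b) * h
  rw [mul_one, h1, quadBasis_repr, quadBasis_repr]
  simp
  ring

variable {l : L} (hl : l ∉ Set.range (algebraMap K L)) (hl2 : l ^ 2 ∈ Set.range (algebraMap K L))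

/-- The nontrivial automorphism of a quadratic extension generated by a square root. -/
def quadConjHom (hL : Module.finrank K L = 2) {l : L} (hl : l ∉ Set.range (algebraMap K L))
    (hl2 : l ^ 2 ∈ Set.range (algebraMap K L)) : L →ₐ[K] L :=
  AlgHom.ofLinearMap ((quadBasis hL hl).constr K ![1, -l])
    (by
      conv_lhs => rw [← quadBasis_zero hL hl]
      rw [Module.Basis.constr_basis]
      exact quadBasis_zero hL hl)
    (by
      obtain ⟨c, hc⟩ := hl2
      have key : ∀ a b : K, (quadBasis hL hl).constr K ![1, -l]
          (algebraMap K L a + algebraMap K L b * l) = algebraMap K L a - algebraMap K L b * l := by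
        intro a b
        rw [Module.Basis.constr_apply_fintype]
        have := quadBasis_repr hL hl a b
        simp only [Module.Basis.equivFun_apply, this, Fin.sum_univ_two]
        simp [Algebra.smul_def]
        ring
      intro x y
      obtain ⟨a, b, rfl⟩ := exists_eq_add_mul hL hl x
      obtain ⟨a', b', rfl⟩ := exists_eq_add_mul hL hl y
      have : (algebraMap K L a + algebraMap K L b * l) * (algebraMap K L a' + algebraMap K L b' * l) =
          algebraMap K L (a * a' + b * b' * c) + algebraMap K L (a * b' + a' * b) * l := by
        simp only [map_add, map_mul, hc]; ring
      rw [this, key, key, key]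
      simp only [map_add, map_mul, hc]
      ring)

theorem quadConjHom_apply (a b : K) :
    quadConjHom hL hl hl2 (algebraMap K L a + algebraMap K L b * l) =
      algebraMap K L a - algebraMap K L b * l := by
  change (quadBasis hL hl).constr K ![1, -l] _ = _
  rw [Module.Basis.constr_apply_fintype]
  have := quadBasis_repr hL hl a b
  simp only [Module.Basis.equivFun_apply, this, Fin.sum_univ_two]
  simp [Algebra.smul_def]
  ring

theorem quadConjHom_gen : quadConjHom hL hl hl2 l = -l := by
  have := quadConjHom_apply hL hl hl2 0 1
  simpa using this

theorem quadConjHom_quadConjHom (x : L) : quadConjHom hL hl hl2 (quadConjHom hL hl hl2 x) = x := by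
  obtain ⟨a, b, rfl⟩ := exists_eq_add_mul hL hl x
  rw [quadConjHom_apply, map_sub, map_mul, quadConjHom_gen, AlgHom.commutes, AlgHom.commutes]
  ring

/-- The nontrivial automorphism of a quadratic extension generated by a square root. -/
def quadConj (hL : Module.finrank K L = 2) {l : L} (hl : l ∉ Set.range (algebraMap K L))
    (hl2 : l ^ 2 ∈ Set.range (algebraMap K L)) : L ≃ₐ[K] L :=
  AlgEquiv.ofAlgHom (quadConjHom hL hl hl2) (quadConjHom hL hl hl2)
    (AlgHom.ext (quadConjHom_quadConjHom hL hl hl2)) (AlgHom.ext (quadConjHom_quadConjHom hL hl hl2))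

theorem quadConj_apply (a b : K) :
    quadConj hL hl hl2 (algebraMap K L a + algebraMap K L b * l) =
      algebraMap K L a - algebraMap K L b * l := quadConjHom_apply hL hl hl2 a b

theorem quadConj_gen : quadConj hL hl hl2 l = -l := quadConjHom_gen hL hl hl2

theorem quadConj_quadConj (x : L) : quadConj hL hl hl2 (quadConj hL hl hl2 x) = x :=
  quadConjHom_quadConjHom hL hl hl2 x

theorem algebraMap_norm_eq (x : L) :
    algebraMap K L (Algebra.norm K x) = x * quadConj hL hl hl2 x := by
  obtain ⟨a, b, rfl⟩ := exists_eq_add_mul hL hl x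
  obtain ⟨c, hc⟩ := id hl2
  rw [norm_quadratic hL hl (t := 0) (n := -c) (by rw [← hc]; simp), quadConj_apply]
  simp only [map_add, map_mul, map_pow, map_neg, map_zero, hc]
  ring

theorem exists_trace (x : L) : ∃ t : K, algebraMap K L t = x + quadConj hL hl hl2 x := by
  obtain ⟨a, b, rfl⟩ := exists_eq_add_mul hL hl x
  exact ⟨2 * a, by rw [quadConj_apply, map_mul, map_ofNat]; ring⟩

end Quadratic

/-! ### The algebra `D ⊗ E` -/

section TensorDomain

variable {F E D : Type*} [Field F] [Field E] [Algebra F E] [DivisionRing D] [Algebra F D]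
  (hE : Module.finrank F E = 2) {θ : E} (hθ : θ ∉ Set.range (algebraMap F E))

include hE hθ in
theorem exists_eq_tmul_add_tmul (z : D ⊗[F] E) : ∃ x y : D, z = x ⊗ₜ 1 + y ⊗ₜ θ := by
  induction z with
  | zero => exact ⟨0, 0, by simp⟩
  | tmul x e =>
    obtain ⟨a, b, rfl⟩ := exists_eq_add_mul hE hθ e
    refine ⟨a • x, b • x, ?_⟩
    rw [TensorProduct.tmul_add, TensorProduct.smul_tmul, TensorProduct.smul_tmul, Algebra.smul_def,
      Algebra.smul_def, mul_one]
  | add z w hz hw =>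
    obtain ⟨x, y, rfl⟩ := hz
    obtain ⟨x', y', rfl⟩ := hw
    refine ⟨x + x', y + y', ?_⟩
    rw [TensorProduct.add_tmul, TensorProduct.add_tmul]
    abel

include hE hθ in
theorem tmul_add_tmul_inj {x y x' y' : D}
    (h : x ⊗ₜ[F] (1 : E) + y ⊗ₜ θ = x' ⊗ₜ 1 + y' ⊗ₜ θ) : x = x' ∧ y = y' := by
  let b := Algebra.TensorProduct.basis D (quadBasis hE hθ)
  have key : ∀ u v : D, u ⊗ₜ[F] (1 : E) + v ⊗ₜ θ = u • b 0 + v • b 1 := by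
    intro u v
    simp only [b, Algebra.TensorProduct.basis_apply, quadBasis_zero, quadBasis_one,
      TensorProduct.smul_tmul', smul_eq_mul, mul_one]
  rw [key, key] at h
  have h0 := congrArg (fun z => b.repr z 0) h
  have h1 := congrArg (fun z => b.repr z 1) h
  constructor
  · simpa using h0
  · simpa using h1

/-- A scalar that is not a square in `F` is not a square in an algebra of odd dimension. -/
theorem sq_ne_algebraMap {d : ℕ} (hd : Odd d) (hD : Module.finrank F D = d ^ 2) {a : F}
    (ha : ¬ IsSquare a) (c : D) : c ^ 2 ≠ algebraMap F D a := by
  intro h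
  have hodd : Odd (d ^ 2) := hd.pow
  obtain ⟨k, hk⟩ := hodd
  have h1 := congrArg (Algebra.norm F) h
  rw [map_pow, Algebra.norm_algebraMap, hD, hk] at h1
  have ha0 : a ≠ 0 := fun h => ha (by rw [h]; exact ⟨0, by simp⟩)
  -- With d² = 2k + 1, taking norms gives N(c)² = a^(2k+1), so a is the square of N(c) / a^k.
  refine ha ⟨Algebra.norm F c * (a ^ k)⁻¹, ?_⟩
  have : a ^ k ≠ 0 := pow_ne_zero _ ha0
  field_simp
  rw [h1]
  ring

-- For y ≠ 0 write x + y l = y (c + l). Then (c + l)(c - l) = c² - a lies in D and is nonzero since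
-- a is not a square in F and D has odd dimension; so every nonzero element is invertible.
include hE in
theorem isDomain_tensor {d : ℕ} (hd : Odd d) (hD : Module.finrank F D = d ^ 2) {l : E}
    (hl : l ∉ Set.range (algebraMap F E)) (hl2 : l ^ 2 ∈ Set.range (algebraMap F E)) :
    IsDomain (D ⊗[F] E) := by
  obtain ⟨a, ha⟩ := hl2
  have hns : ¬ IsSquare a := by
    rintro ⟨c, rfl⟩
    have : (l - algebraMap F E c) * (l + algebraMap F E c) = 0 := by
      rw [map_mul] at ha; linear_combination -ha
    rcases mul_eq_zero.1 this with h | h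
    · exact hl ⟨c, (sub_eq_zero.1 h).symm⟩
    · exact hl ⟨-c, by rw [map_neg]; exact (eq_neg_of_add_eq_zero_left h).symm⟩
  have hunitD : ∀ x : D, x ≠ 0 → IsUnit (x ⊗ₜ[F] (1 : E)) := fun x hx =>
    (IsUnit.mk0 x hx).map (Algebra.TensorProduct.includeLeft : D →ₐ[F] D ⊗[F] E)
  have hunit : ∀ z : D ⊗[F] E, z ≠ 0 → IsUnit z := by
    intro z hz
    obtain ⟨x, y, rfl⟩ := exists_eq_tmul_add_tmul hE hl z
    by_cases hy : y = 0
    · subst hy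
      rw [TensorProduct.zero_tmul, add_zero] at hz ⊢
      exact hunitD x fun h => hz (by rw [h, TensorProduct.zero_tmul])
    have hfac : x ⊗ₜ[F] (1 : E) + y ⊗ₜ l =
        (y ⊗ₜ 1) * ((y⁻¹ * x) ⊗ₜ 1 + 1 ⊗ₜ l) := by
      rw [mul_add, Algebra.TensorProduct.tmul_mul_tmul, Algebra.TensorProduct.tmul_mul_tmul,
        mul_inv_cancel_left₀ hy]
      simp
    rw [hfac]
    refine (hunitD y hy).mul ?_
    set c := y⁻¹ * x
    have hc : IsUnit ((c ^ 2 - algebraMap F D a) ⊗ₜ[F] (1 : E)) :=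
      hunitD _ (sub_ne_zero.2 (sq_ne_algebraMap hd hD hns c))
    have hla : (algebraMap F D a) ⊗ₜ[F] (1 : E) = 1 ⊗ₜ[F] (l ^ 2) := by
      rw [← ha, Algebra.algebraMap_eq_smul_one, Algebra.algebraMap_eq_smul_one,
        TensorProduct.smul_tmul]
    have h1 : (c ⊗ₜ[F] (1 : E) + 1 ⊗ₜ l) * (c ⊗ₜ 1 - 1 ⊗ₜ l) = (c ^ 2 - algebraMap F D a) ⊗ₜ 1 := by
      rw [TensorProduct.sub_tmul, hla]
      simp only [add_mul, mul_sub, Algebra.TensorProduct.tmul_mul_tmul, mul_one, one_mul, sq]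
      abel
    have h2 : (c ⊗ₜ[F] (1 : E) - 1 ⊗ₜ l) * (c ⊗ₜ 1 + 1 ⊗ₜ l) = (c ^ 2 - algebraMap F D a) ⊗ₜ 1 := by
      rw [TensorProduct.sub_tmul, hla]
      simp only [sub_mul, mul_add, Algebra.TensorProduct.tmul_mul_tmul, mul_one, one_mul, sq]
      abel
    obtain ⟨w, hw⟩ := hc
    refine isUnit_iff_exists_and_exists.2
      ⟨⟨(c ⊗ₜ 1 - 1 ⊗ₜ l) * ((w⁻¹ : (D ⊗[F] E)ˣ) : D ⊗[F] E), ?_⟩,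
        ⟨((w⁻¹ : (D ⊗[F] E)ˣ) : D ⊗[F] E) * (c ⊗ₜ 1 - 1 ⊗ₜ l), ?_⟩⟩
    · rw [← mul_assoc, h1, ← hw, Units.mul_inv]
    · rw [mul_assoc, h2, ← hw, Units.inv_mul]
  have : NoZeroDivisors (D ⊗[F] E) := ⟨by
    intro z w hzw
    by_contra! hne
    have := (hunit z hne.1).mul_right_injective (hzw.trans (mul_zero z).symm)
    exact hne.2 this⟩
  exact NoZeroDivisors.to_isDomain _

end TensorDomain

/-! ### Absolute values under embeddings of algebras -/

section AlgHom

variable {F : Type*} [Field F] [ValuativeRel F] [TopologicalSpace F]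
  [IsNonarchimedeanLocalField F] {A B : Type*} [Ring A] [Algebra F A] [IsDomain A]
  [FiniteDimensional F A] [Ring B] [Algebra F B] [IsDomain B] [FiniteDimensional F B]

/-- The composite of φ with the absolute value of B is multiplicative and bounded on integral
elements, so its values on scalars determine it; this replaces transitivity of the norm, with c the
relative degree. -/
theorem algAbs_algHom (φ : A →ₐ[F] B) {c : ℕ} (h : Module.finrank F B = Module.finrank F A * c)
    (x : A) : algAbs F (φ x) = algAbs F x ^ c := by
  by_cases hx : x = 0
  · have hc : c ≠ 0 := by
      rintro rfl
      have : 0 < Module.finrank F B := Module.finrank_pos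
      omega
    simp [hx, hc]
  let χ : A →* ℝ :=
    { toFun := fun x => algAbs F (φ x)
      map_one' := by simp
      map_mul' := fun x y => by rw [map_mul, algAbs_mul] }
  refine eq_algAbs_pow_of_scalar F χ (fun x => algAbs_nonneg F _) c (fun x hx => ?_) (fun a => ?_) hx
  · change algAbs F (φ x) ≤ 1
    rw [← isIntegral_iff_algAbs_le_one] at hx ⊢
    exact hx.map (φ.restrictScalars 𝒪[F])
  · change algAbs F (φ (algebraMap F A a)) = _
    rw [AlgHom.commutes, algAbs_algebraMap, h, pow_mul]

end AlgHom


/-! ### Balls and their indices -/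

section Balls

variable (F : Type*) [Field F] [ValuativeRel F] [TopologicalSpace F]
  [IsNonarchimedeanLocalField F] {A : Type*} [Ring A] [Algebra F A]
  [IsDomain A] [FiniteDimensional F A]

/-- The additive group of elements of absolute value at most that of `c`. -/
def ballOf (c : A) : AddSubgroup A where
  carrier := {x | algAbs F x ≤ algAbs F c}
  zero_mem' := by simp [algAbs_nonneg]
  add_mem' {x y} hx hy := (algAbs_add_le F x y).trans (max_le hx hy)
  neg_mem' {x} hx := by simpa using hx

variable {F}

theorem mem_ballOf {c x : A} : x ∈ ballOf F c ↔ algAbs F x ≤ algAbs F c := Iff.rfl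

theorem map_mulRight_ballOf (c : A) (u : Aˣ) :
    (ballOf F c).map (AddMonoidHom.mulRight (u : A)) = ballOf F (c * u) := by
  ext x
  simp only [AddSubgroup.mem_map, mem_ballOf, AddMonoidHom.mulRight_apply]
  have hp := algAbs_pos F u.ne_zero
  constructor
  · rintro ⟨y, hy, rfl⟩
    rw [algAbs_mul, algAbs_mul]
    exact mul_le_mul_of_nonneg_right hy hp.le
  · intro hx
    refine ⟨x * ((u⁻¹ : Aˣ) : A), ?_, by rw [mul_assoc, Units.inv_mul, mul_one]⟩
    rw [algAbs_mul] at hx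
    rwa [algAbs_mul, algAbs_units_inv, mul_inv_le_iff₀ hp]

theorem relIndex_ballOf_uniformiser {ϖ : Aˣ} (h1 : algAbs F (ϖ : A) < 1)
    (hϖ : ∀ x : A, algAbs F x < 1 → algAbs F x ≤ algAbs F (ϖ : A)) :
    (ballOf F (ϖ : A)).relIndex (ballOf F (1 : A)) = Nat.card (ResidueAlgebra F A) := by
  let f : ballOf F (1 : A) →+ ResidueAlgebra F A :=
    { toFun := fun x => residueMap F A
        ⟨x, (mem_maxOrder F).2 (by simpa using mem_ballOf.1 x.2)⟩
      map_zero' := map_zero (residueMap F A)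
      map_add' := fun x y => map_add (residueMap F A)
        ⟨x, (mem_maxOrder F).2 (by simpa using mem_ballOf.1 x.2)⟩
        ⟨y, (mem_maxOrder F).2 (by simpa using mem_ballOf.1 y.2)⟩ }
  have hsurj : Function.Surjective f := by
    intro z
    obtain ⟨x, rfl⟩ := residueMap_surjective z
    exact ⟨⟨x, by rw [mem_ballOf, algAbs_one]; exact (mem_maxOrder F).1 x.2⟩, rfl⟩
  have hker : f.ker = (ballOf F (ϖ : A)).addSubgroupOf (ballOf F (1 : A)) := by
    ext x
    rw [AddMonoidHom.mem_ker, AddSubgroup.mem_addSubgroupOf, mem_ballOf]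
    change residueMap F A _ = 0 ↔ _
    rw [residueMap_eq_zero]
    exact ⟨fun h => hϖ _ h, fun h => h.trans_lt h1⟩
  rw [AddSubgroup.relIndex, ← hker, AddSubgroup.index_ker, AddMonoidHom.range_eq_top.2 hsurj]
  exact Nat.card_congr AddSubgroup.topEquiv.toEquiv

theorem relIndex_ballOf_pow {ϖ : Aˣ} (h1 : algAbs F (ϖ : A) < 1)
    (hϖ : ∀ x : A, algAbs F x < 1 → algAbs F x ≤ algAbs F (ϖ : A)) (m : ℕ) :
    (ballOf F ((ϖ : A) ^ m)).relIndex (ballOf F (1 : A)) = Nat.card (ResidueAlgebra F A) ^ m := by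
  induction m with
  | zero => simp
  | succ m ih =>
    have hle : ∀ k, ballOf F ((ϖ : A) ^ (k + 1)) ≤ ballOf F ((ϖ : A) ^ k) := by
      intro k x hx
      rw [mem_ballOf] at hx ⊢
      refine hx.trans ?_
      rw [algAbs_pow, algAbs_pow]
      exact pow_le_pow_of_le_one (algAbs_nonneg F _) h1.le k.le_succ
    have hle1 : ballOf F ((ϖ : A) ^ m) ≤ ballOf F (1 : A) := by
      intro x hx
      rw [mem_ballOf] at hx ⊢
      refine hx.trans ?_
      rw [algAbs_pow, algAbs_one]
      exact pow_le_one₀ (algAbs_nonneg F _) h1.le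
    rw [← AddSubgroup.relIndex_mul_relIndex _ _ _ (hle m) hle1, ih,
      pow_succ' (Nat.card _)]
    congr 1
    rw [← relIndex_ballOf_uniformiser h1 hϖ]
    have e1 : ballOf F ((ϖ : A) ^ (m + 1)) =
        (ballOf F (ϖ : A)).map (AddMonoidHom.mulRight ((ϖ ^ m : Aˣ) : A)) := by
      rw [map_mulRight_ballOf, Units.val_pow_eq_pow_val, pow_succ']
    have e2 : ballOf F ((ϖ : A) ^ m) =
        (ballOf F (1 : A)).map (AddMonoidHom.mulRight ((ϖ ^ m : Aˣ) : A)) := by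
      rw [map_mulRight_ballOf, Units.val_pow_eq_pow_val, one_mul]
    rw [e1, e2]
    exact AddSubgroup.relIndex_map_map_of_injective _ _
      fun x y h => mul_right_cancel₀ (ϖ ^ m : Aˣ).ne_zero h

/-- Needed for F itself and for a ramified E, where the residue field does not grow. -/
theorem card_residueAlgebra_eq_of_scalars
    (H : ∀ x : A, algAbs F x ≤ 1 → ∃ a : 𝒪[F], algAbs F (x - algebraMap F A a) < 1) :
    Nat.card (ResidueAlgebra F A) = residueCard F := by
  refine (Nat.card_congr (Equiv.ofBijective (algebraMap 𝓀[F] (ResidueAlgebra F A))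
    ⟨(algebraMap 𝓀[F] (ResidueAlgebra F A)).injective, fun z => ?_⟩)).symm
  obtain ⟨x, rfl⟩ := residueMap_surjective z
  obtain ⟨a, ha⟩ := H x ((mem_maxOrder F).1 x.2)
  refine ⟨IsLocalRing.residue _ a, ?_⟩
  rw [algebraMap_residue, ← (residueMap F A).commutes, eq_comm, ← sub_eq_zero, ← map_sub,
    residueMap_eq_zero]
  exact ha

variable (F) in
theorem algAbs_self (x : F) : algAbs F x = absF F x := by
  have := algAbs_algebraMap F (A := F) x
  simpa using this

variable (F) in
theorem absF_le_of_lt_one {x : F} (hx : absF F x < 1) : absF F x ≤ (residueCard F : ℝ)⁻¹ := by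
  by_cases h0 : x = 0
  · rw [h0, absF_zero]; positivity
  have hq := one_lt_residueCard_real F
  obtain ⟨n, hn⟩ := exists_absF_eq_zpow h0
  rw [hn] at hx ⊢
  have : n < 0 := by
    by_contra! h
    exact absurd hx (not_lt.2 (one_le_zpow₀ hq.le h))
  rw [← zpow_neg_one]
  exact zpow_le_zpow_right₀ hq.le (by omega)

variable (F) in
theorem relIndex_ballOf_self (m : ℕ) :
    (ballOf F ((uniformiser F : F) ^ m)).relIndex (ballOf F (1 : F)) = residueCard F ^ m := by
  have h1 : algAbs F ((Units.mk0 _ (uniformiser_ne_zero F) : Fˣ) : F) = (residueCard F : ℝ)⁻¹ := by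
    rw [algAbs_self, Units.val_mk0, absF_uniformiser]
  have h2 := relIndex_ballOf_pow (F := F) (A := F) (ϖ := Units.mk0 _ (uniformiser_ne_zero F))
    (by rw [h1]; exact inv_lt_one_of_one_lt₀ (one_lt_residueCard_real F))
    (fun x hx => by
      rw [h1]
      rw [algAbs_self] at hx ⊢
      exact absF_le_of_lt_one F hx) m
  rw [Units.val_mk0] at h2
  rw [h2, card_residueAlgebra_eq_of_scalars]
  intro x hx
  rw [algAbs_self] at hx
  exact ⟨⟨x, absF_le_one_iff.1 hx⟩, by simp⟩

end Balls

/-! ### Norms from a ramified quadratic extension -/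

section Ramified

variable {F E : Type*} [Field F] [ValuativeRel F] [TopologicalSpace F]
  [IsNonarchimedeanLocalField F] [Field E] [Algebra F E]

theorem absF_norm (z : E) : absF F (Algebra.norm F z) = algAbs F z := rfl

variable (hE : Module.finrank F E = 2) {l : E} (hl : l ∉ Set.range (algebraMap F E))
  (hl2 : l ^ 2 ∈ Set.range (algebraMap F E))

include hE

/-- An extension with an element of absolute value `q⁻¹` is ramified: its integers are spanned by
`1` and that element. -/
theorem algAbs_add_mul_uniformiser {π : E} (hπ : algAbs F π = (residueCard F : ℝ)⁻¹) (a b : F) :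
    algAbs F (algebraMap F E a + algebraMap F E b * π) =
      max (absF F a ^ 2) (absF F b ^ 2 * (residueCard F : ℝ)⁻¹) := by
  have : FiniteDimensional F E := Module.finite_of_finrank_pos (by omega)
  have hq := one_lt_residueCard_real F
  have hq0 : (0 : ℝ) < residueCard F := zero_lt_one.trans hq
  have e1 : algAbs F (algebraMap F E a) = absF F a ^ 2 := by rw [algAbs_algebraMap, hE]
  have e2 : algAbs F (algebraMap F E b * π) = absF F b ^ 2 * (residueCard F : ℝ)⁻¹ := by
    rw [algAbs_mul, algAbs_algebraMap, hE, hπ]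
  rw [← e1, ← e2]
  by_cases ha : a = 0
  · simp [ha, algAbs_nonneg]
  by_cases hb : b = 0
  · simp [hb, algAbs_nonneg]
  refine algAbs_add_eq_max F fun h => ?_
  rw [e1, e2] at h
  obtain ⟨n, hn⟩ := exists_absF_eq_zpow ha
  obtain ⟨k, hk⟩ := exists_absF_eq_zpow hb
  rw [hn, hk, ← zpow_natCast, ← zpow_mul, ← zpow_natCast, ← zpow_mul, ← zpow_neg_one,
    ← zpow_add₀ hq0.ne'] at h
  have := zpow_right_injective₀ hq0 hq.ne' h
  push_cast at this
  omega

-- A counting argument. Put δ = σπ - π, so |δ| = q^(-m). The norm induces a map from the integers of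
-- E modulo δ to the integers of F modulo ϖ^m, two sets with q^m elements. If every unit were a
-- norm, this map would be onto, hence injective. But 1 and σπ/π both have norm 1, and they differ
-- by δ/π, which is larger than δ.
include hl hl2 in
theorem exists_unit_not_norm (h2 : (2 : F) ≠ 0) {π : E} (hπ : algAbs F π = (residueCard F : ℝ)⁻¹) :
    ∃ u : Fˣ, absF F (u : F) = 1 ∧ ¬ ∃ y : E, Algebra.norm F y = (u : F) := by
  have : FiniteDimensional F E := Module.finite_of_finrank_pos (by omega)
  by_contra! hall
  have hq := one_lt_residueCard_real F
  have hq0 : (0 : ℝ) < residueCard F := zero_lt_one.trans hq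
  have hπ0 : π ≠ 0 := fun h => by
    rw [h, algAbs_zero] at hπ
    exact (inv_pos.2 hq0).ne hπ
  have hπF : π ∉ Set.range (algebraMap F E) := by
    rintro ⟨a, rfl⟩
    have ha : a ≠ 0 := fun h => hπ0 (by rw [h, map_zero])
    obtain ⟨n, hn⟩ := exists_absF_eq_zpow ha
    rw [algAbs_algebraMap, hE, hn, ← zpow_natCast, ← zpow_mul, ← zpow_neg_one] at hπ
    have := zpow_right_injective₀ hq0 hq.ne' hπ
    push_cast at this
    omega
  set σ := quadConj hE hl hl2
  set δ := σ π - π with hδ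
  have hσδ : σ δ = -δ := by
    rw [hδ, map_sub, quadConj_quadConj]; ring
  have hδ0 : δ ≠ 0 := by
    intro h
    have hfix : σ π = π := sub_eq_zero.1 h
    obtain ⟨a, b, hab⟩ := exists_eq_add_mul hE hl π
    rw [hab, quadConj_apply] at hfix
    have h2l : (2 : E) * (algebraMap F E b * l) = 0 := by linear_combination -hfix
    have h2E : (2 : E) ≠ 0 := by
      rw [← map_ofNat (algebraMap F E) 2]; simpa using h2
    have hbl := (mul_eq_zero.1 h2l).resolve_left h2E
    rw [hbl, add_zero] at hab
    exact hπF ⟨a, hab.symm⟩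
  have hσabs : ∀ z, algAbs F (σ z) = algAbs F z := algAbs_algEquiv F σ
  -- every integral scalar is the norm of an integral element
  have hnorm : ∀ c : F, ∃ z : E, Algebra.norm F z = c := by
    intro c
    by_cases hc : c = 0
    · exact ⟨0, by rw [hc, Algebra.norm_zero]⟩
    obtain ⟨n, hn⟩ := exists_absF_eq_zpow hc
    have hN0 : Algebra.norm F (π ^ (-n)) ≠ 0 := Algebra.norm_ne_zero_iff.2 (zpow_ne_zero _ hπ0)
    have hN : absF F (Algebra.norm F (π ^ (-n))) = (residueCard F : ℝ) ^ n := by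
      rw [Algebra.norm_zpow, absF_zpow, absF_norm, hπ, inv_zpow', neg_neg]
    obtain ⟨y, hy⟩ := hall (Units.mk0 (c * (Algebra.norm F (π ^ (-n)))⁻¹)
      (mul_ne_zero hc (inv_ne_zero hN0))) (by
        rw [Units.val_mk0, absF_mul, absF_inv, hN, hn, mul_inv_cancel₀ (zpow_ne_zero _ hq0.ne')])
    refine ⟨y * π ^ (-n), ?_⟩
    rw [map_mul, hy, Units.val_mk0, inv_mul_cancel_right₀ hN0]
  -- the norm is compatible with congruences
  have hcongr : ∀ z w : E, algAbs F z ≤ 1 → algAbs F w ≤ algAbs F δ →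
      absF F (Algebra.norm F (z + w) - Algebra.norm F z) ≤ algAbs F δ := by
    intro z w hz hw
    have hdpos := algAbs_pos F hδ0
    obtain ⟨e, b, heb⟩ := exists_eq_add_mul hE hπF (w * σ z * δ⁻¹)
    have hint : algAbs F (w * σ z * δ⁻¹) ≤ 1 := by
      have hinv : algAbs F δ⁻¹ = (algAbs F δ)⁻¹ := by
        refine eq_inv_of_mul_eq_one_left ?_
        rw [← algAbs_mul, inv_mul_cancel₀ hδ0, algAbs_one]
      rw [algAbs_mul, algAbs_mul, hσabs, hinv, mul_inv_le_iff₀ hdpos, one_mul]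
      exact (mul_le_of_le_one_right (algAbs_nonneg F w) hz).trans hw
    have hb : absF F b ≤ 1 := by
      rw [heb, algAbs_add_mul_uniformiser hE hπ] at hint
      have h1 := (le_max_right _ _).trans hint
      rw [mul_inv_le_iff₀ hq0, one_mul] at h1
      by_contra! hlt
      have hb0 : b ≠ 0 := fun h => by rw [h, absF_zero] at hlt; linarith
      obtain ⟨n, hn⟩ := exists_absF_eq_zpow hb0
      rw [hn] at hlt h1
      have hn1 : 0 < n := by
        by_contra! hn0
        exact absurd hlt (not_lt.2 (zpow_le_one_of_nonpos₀ hq.le hn0))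
      have h3 : (residueCard F : ℝ) ^ (1 : ℤ) < ((residueCard F : ℝ) ^ n) ^ 2 := by
        rw [← zpow_natCast, ← zpow_mul]
        exact zpow_lt_zpow_right₀ hq (by push_cast; omega)
      rw [zpow_one] at h3
      linarith
    have hwz : w * σ z = (algebraMap F E e + algebraMap F E b * π) * δ := by
      rw [← heb, inv_mul_cancel_right₀ hδ0]
    have hσwz : σ w * z = -(algebraMap F E e + algebraMap F E b * σ π) * δ := by
      have := congrArg σ hwz
      rw [map_mul, map_mul, map_add, map_mul, quadConj_quadConj, AlgEquiv.commutes,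
        AlgEquiv.commutes, hσδ] at this
      rw [this]; ring
    -- With w σ(z) = (e + b π) δ and σδ = -δ, the trace w σ(z) + σ(w) z is b (π - σπ) δ = -b δ² = b
    -- N(δ). Since |N(δ)| = |δ| in this normalisation, the increment of the norm has size at most
    -- |δ|.
    have hkey : Algebra.norm F (z + w) - Algebra.norm F z =
        Algebra.norm F w + b * Algebra.norm F δ := by
      apply (algebraMap F E).injective
      rw [map_sub, (algebraMap F E).map_add, (algebraMap F E).map_mul]
      simp only [algebraMap_norm_eq hE hl hl2, map_add]
      change (z + w) * (σ z + σ w) - z * σ z = w * σ w + algebraMap F E b * (δ * σ δ)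
      rw [hσδ]
      linear_combination hwz + hσwz - (algebraMap F E b * δ) * hδ
    rw [hkey]
    refine (absF_add_le _ _).trans (max_le ?_ ?_)
    · exact hw
    · rw [absF_mul]
      exact mul_le_of_le_one_left (absF_nonneg _) hb
  -- compare the residue classes modulo `δ` and modulo its norm
  obtain ⟨n, hn⟩ := exists_algAbs_eq_zpow F hδ0
  have hδ1 : algAbs F δ ≤ algAbs F π := by
    have := algAbs_sub_le F (σ π) π
    rwa [hσabs, max_self] at this
  have hn0 : n ≤ 0 := by
    by_contra! hpos
    rw [hn, hπ, ← zpow_neg_one] at hδ1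
    have := (zpow_le_zpow_iff_right₀ hq).1 hδ1
    omega
  obtain ⟨m, rfl⟩ := Int.exists_eq_neg_ofNat hn0
  have hB : ballOf F δ = ballOf F (π ^ m) := by
    ext x
    rw [mem_ballOf, mem_ballOf, hn, algAbs_pow, hπ, inv_pow, zpow_neg, zpow_natCast]
  have hπlt : ∀ x : E, algAbs F x < 1 → algAbs F x ≤ algAbs F π := by
    intro x hx
    rw [hπ]
    exact absF_le_of_lt_one F hx
  have hπ1 : algAbs F π < 1 := by rw [hπ]; exact inv_lt_one_of_one_lt₀ hq
  have hcardE : (ballOf F δ).relIndex (ballOf F (1 : E)) = residueCard F ^ m := by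
    rw [hB]
    have := relIndex_ballOf_pow (F := F) (ϖ := Units.mk0 π hπ0) hπ1 hπlt m
    rw [Units.val_mk0] at this
    rw [this, card_residueAlgebra_eq_of_scalars]
    intro x hx
    obtain ⟨a, b, rfl⟩ := exists_eq_add_mul hE hπF x
    have h1 := hx
    rw [algAbs_add_mul_uniformiser hE hπ] at h1
    have ha : absF F a ≤ 1 := by
      have := (le_max_left _ _).trans h1
      exact (pow_le_one_iff_of_nonneg (absF_nonneg a) two_ne_zero).1 this
    refine ⟨⟨a, absF_le_one_iff.1 ha⟩, ?_⟩
    have hle : algAbs F (algebraMap F E b * π) ≤ 1 := by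
      have e2 : algAbs F (algebraMap F E b * π) = absF F b ^ 2 * (residueCard F : ℝ)⁻¹ := by
        rw [algAbs_mul, algAbs_algebraMap, hE, hπ]
      rw [e2]; exact (le_max_right _ _).trans h1
    rw [add_sub_cancel_left]
    refine lt_of_le_of_ne hle fun h => ?_
    have hb0 : b ≠ 0 := fun h0 => by
      rw [h0, map_zero, zero_mul, algAbs_zero] at h
      exact zero_ne_one h
    obtain ⟨k, hk⟩ := exists_absF_eq_zpow hb0
    rw [algAbs_mul, algAbs_algebraMap, hE, hπ, hk, ← zpow_natCast, ← zpow_mul, ← zpow_neg_one,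
      ← zpow_add₀ hq0.ne', ← zpow_zero (residueCard F : ℝ)] at h
    have := zpow_right_injective₀ hq0 hq.ne' h
    push_cast at this
    omega
  have hcardF : (ballOf F ((uniformiser F : F) ^ m)).relIndex (ballOf F (1 : F)) =
      residueCard F ^ m := relIndex_ballOf_self F m
  have hBF : ∀ x : F, x ∈ ballOf F ((uniformiser F : F) ^ m) ↔ absF F x ≤ algAbs F δ := by
    intro x
    rw [mem_ballOf, algAbs_self, algAbs_self, hn, absF_pow, absF_uniformiser, inv_pow, zpow_neg,
      zpow_natCast]
  let X := ballOf F (1 : E) ⧸ (ballOf F δ).addSubgroupOf (ballOf F (1 : E))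
  let Y := ballOf F (1 : F) ⧸ (ballOf F ((uniformiser F : F) ^ m)).addSubgroupOf (ballOf F (1 : F))
  have hX : Nat.card X = residueCard F ^ m := hcardE
  have hY : Nat.card Y = residueCard F ^ m := hcardF
  have hpos : 0 < residueCard F ^ m := pow_pos (zero_lt_one.trans (one_lt_residueCard F)) _
  have hXfin : Finite X := Nat.finite_of_card_ne_zero (by omega)
  have hYfin : Finite Y := Nat.finite_of_card_ne_zero (by omega)
  choose ν hν using hnorm
  have hνint : ∀ c : ballOf F (1 : F), ν c ∈ ballOf F (1 : E) := by
    intro c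
    rw [mem_ballOf, ← absF_norm, hν, algAbs_one, ← algAbs_self, ← algAbs_one F (A := F)]
    exact c.2
  -- A section of the norm map modulo δ. Being injective between sets of equal size it is onto, so a
  -- class modulo δ is determined by its norm.
  let g : Y → X := fun y => QuotientAddGroup.mk ⟨ν y.out, hνint y.out⟩
  have hgeq : ∀ (y : Y) (z : ballOf F (1 : E)), g y = QuotientAddGroup.mk z →
      absF F (Algebra.norm F (z : E) - (y.out : F)) ≤ algAbs F δ := by
    intro y z h
    have hmem : -(ν y.out) + (z : E) ∈ ballOf F δ := by
      have := QuotientAddGroup.eq.1 h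
      exact AddSubgroup.mem_addSubgroupOf.1 this
    have h1 := hνint y.out
    rw [mem_ballOf, algAbs_one] at h1
    have := hcongr (ν y.out) (-(ν y.out) + (z : E)) h1 hmem
    rwa [add_neg_cancel_left, hν] at this
  have hsame : ∀ y y' : Y, absF F ((y.out : F) - (y'.out : F)) ≤ algAbs F δ → y = y' := by
    intro y y' h
    rw [← Quotient.out_eq y, ← Quotient.out_eq y']
    refine QuotientAddGroup.eq.2 ?_
    change -((y.out : ballOf F (1 : F)) : F) + (y'.out : F) ∈ ballOf F ((uniformiser F : F) ^ m)
    rw [hBF, ← absF_neg, neg_add, neg_neg, ← sub_eq_add_neg]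
    exact h
  have hinj : Function.Injective g := by
    intro y y' h
    refine hsame y y' ?_
    have := hgeq y ⟨ν y'.out, hνint y'.out⟩ h
    rw [hν, ← absF_neg, neg_sub] at this
    exact this
  have hbij := (Nat.bijective_iff_injective_and_card g).2 ⟨hinj, hY.trans hX.symm⟩
  have hσπ0 : σ π ≠ 0 := by simpa using hπ0
  have hu1 : algAbs F (σ π * π⁻¹) = 1 := by
    have : σ π = σ π * π⁻¹ * π := by rw [inv_mul_cancel_right₀ hπ0]
    have h1 := congrArg (algAbs F) this
    rw [algAbs_mul F _ π, hσabs] at h1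
    exact mul_right_cancel₀ (algAbs_pos F hπ0).ne' (by rw [one_mul]; exact h1.symm)
  have hNu : Algebra.norm F (σ π * π⁻¹) = 1 := by
    have h1 : Algebra.norm F (σ π) = Algebra.norm F π := Algebra.norm_eq_of_algEquiv σ π
    rw [map_mul, h1, ← map_mul, mul_inv_cancel₀ hπ0, map_one]
  obtain ⟨y₁, hy₁⟩ := hbij.2 (QuotientAddGroup.mk ⟨1, mem_ballOf.2 le_rfl⟩)
  obtain ⟨y₂, hy₂⟩ := hbij.2 (QuotientAddGroup.mk
    ⟨σ π * π⁻¹, mem_ballOf.2 (by rw [hu1, algAbs_one])⟩)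
  have h₁ := hgeq _ _ hy₁
  have h₂ := hgeq _ _ hy₂
  simp only [map_one, hNu] at h₁ h₂
  have h12 : y₁ = y₂ := by
    refine hsame _ _ ?_
    have := absF_add_le (1 - (y₂.out : F)) (-(1 - (y₁.out : F)))
    rw [absF_neg] at this
    refine le_trans (le_of_eq ?_) (this.trans (max_le h₂ h₁))
    congr 1
    ring
  rw [h12, hy₂] at hy₁
  have hmem : -(σ π * π⁻¹) + 1 ∈ ballOf F δ := by
    have := QuotientAddGroup.eq.1 hy₁
    exact AddSubgroup.mem_addSubgroupOf.1 this
  rw [mem_ballOf] at hmem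
  -- If 1 - σπ/π were bounded by |δ|, this identity would give |δ| ≤ |δ| |π|, which is absurd since
  -- |π| < 1.
  have hδe : δ = -(-(σ π * π⁻¹) + 1) * π := by
    rw [neg_mul, add_mul, neg_mul, inv_mul_cancel_right₀ hπ0, one_mul]
    rw [hδ]; ring
  have := congrArg (algAbs F) hδe
  rw [algAbs_mul, algAbs_neg] at this
  have hdpos := algAbs_pos F hδ0
  nlinarith

end Ramified


/-! ### Norms from an unramified quadratic extension -/

section Unramified

variable {F : Type*} [Field F] [ValuativeRel F] [TopologicalSpace F]
  [IsNonarchimedeanLocalField F]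

/-- Hensel's lemma for monic quadratic polynomials. -/
theorem exists_quadratic_root (s r a₀ : 𝒪[F])
    (h : IsLocalRing.residue 𝒪[F] (a₀ ^ 2 + s * a₀ + r) = 0)
    (h' : IsLocalRing.residue 𝒪[F] (2 * a₀ + s) ≠ 0) : ∃ a : 𝒪[F], a ^ 2 + s * a + r = 0 := by
  let := IsTopologicalAddGroup.rightUniformSpace F
  have := isUniformAddGroup_of_addCommGroup (G := F)
  let f : Polynomial 𝒪[F] := .X ^ 2 + .C s * .X + .C r
  have hmonic : f.Monic := by
    have := Polynomial.leadingCoeff_quadratic (R := 𝒪[F]) (a := 1) (b := s) (c := r) one_ne_zero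
    simpa [f, Polynomial.Monic] using this
  obtain ⟨a, ha, -⟩ := HenselianRing.is_henselian (I := 𝓂[F]) f hmonic a₀
    (by
      rw [← IsLocalRing.residue_eq_zero_iff]
      simpa [f] using h)
    (by
      have : f.derivative.eval a₀ = 2 * a₀ + s := by
        simp [f, one_add_one_eq_two]
      rw [this]
      exact isUnit_iff_ne_zero.2 h')
  exact ⟨a, by simpa [f] using ha⟩

/-- An anisotropic binary form over a finite field represents every element. -/
theorem exists_form_eq_of_finite {k : Type*} [Field k] [Finite k] {t n : k}
    (H : ∀ c : k, c ^ 2 + t * c + n ≠ 0) (u : k) :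
    ∃ a b : k, a ^ 2 + t * a * b + n * b ^ 2 = u := by
  let p : Polynomial k := .X ^ 2 + .C t * .X + .C n
  have hdeg : p.natDegree = 2 := by
    have := Polynomial.natDegree_quadratic (R := k) (a := 1) (b := t) (c := n) one_ne_zero
    simpa [p] using this
  have hirr : Irreducible p := by
    rw [Polynomial.irreducible_iff_roots_eq_zero_of_degree_le_three (by omega) (by omega),
      Multiset.eq_zero_iff_forall_notMem]
    intro c hc
    have := (Polynomial.mem_roots'.1 hc).2
    exact H c (by simpa [p] using this)
  have : Fact (Irreducible p) := ⟨hirr⟩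
  have hp0 : p ≠ 0 := hirr.ne_zero
  have hfin : Module.finrank k (AdjoinRoot p) = 2 := by
    rw [(AdjoinRoot.powerBasis hp0).finrank, AdjoinRoot.powerBasis_dim, hdeg]
  have : Module.Finite k (AdjoinRoot p) := Module.finite_of_finrank_pos (by omega)
  have : Finite (AdjoinRoot p) := Module.finite_of_finite k
  have hroot : AdjoinRoot.root p ^ 2 = algebraMap k (AdjoinRoot p) (-t) * AdjoinRoot.root p -
      algebraMap k (AdjoinRoot p) n := by
    have h0 : Polynomial.aeval (AdjoinRoot.root p) p = 0 := by
      rw [AdjoinRoot.aeval_eq, AdjoinRoot.mk_self]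
    have h1 : Polynomial.aeval (AdjoinRoot.root p) p = AdjoinRoot.root p ^ 2 +
        algebraMap k (AdjoinRoot p) t * AdjoinRoot.root p + algebraMap k (AdjoinRoot p) n := by
      generalize AdjoinRoot.root p = r
      simp [p]
    rw [h1] at h0
    rw [map_neg]
    linear_combination h0
  have hnot : AdjoinRoot.root p ∉ Set.range (algebraMap k (AdjoinRoot p)) := by
    rintro ⟨c, hc⟩
    refine H c ((algebraMap k (AdjoinRoot p)).injective ?_)
    rw [map_zero, map_add, map_add, map_mul, map_pow, hc]
    rw [map_neg] at hroot
    linear_combination hroot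
  obtain ⟨α, hα⟩ := FiniteField.norm_surjective k (AdjoinRoot p) u
  obtain ⟨a, b, rfl⟩ := exists_eq_add_mul hfin hnot α
  rw [norm_quadratic hfin hnot hroot] at hα
  -- The root r of p satisfies r² = -t r - n, so the norm of a + b r is a² - t a b + n b²; hence the
  -- sign.
  exact ⟨a, -b, by linear_combination hα⟩

/-- A binary form without zeros modulo the maximal ideal represents every unit. -/
theorem exists_quadratic_form_eq {t n u : 𝒪[F]}
    (H : ∀ c : 𝒪[F], absF F ((c : F) ^ 2 + t * c + n) = 1) (hu : absF F (u : F) = 1) :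
    ∃ a b : 𝒪[F], a ^ 2 + t * a * b + n * b ^ 2 = u := by
  have hn : absF F (n : F) = 1 := by simpa using H 0
  have hn0 : (n : F) ≠ 0 := fun h => by simp [h] at hn
  let n' : 𝒪[F] := ⟨(n : F)⁻¹, absF_le_one_iff.1 (by rw [absF_inv, hn, inv_one])⟩
  have hnn' : n * n' = 1 := Subtype.ext (mul_inv_cancel₀ hn0)
  set ρ := IsLocalRing.residue 𝒪[F]
  have hρu : ρ u ≠ 0 := by
    intro h
    rw [IsLocalRing.residue_eq_zero_iff] at h
    exact (absF_lt_one_of_mem h).ne hu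
  have hH : ∀ c : 𝓀[F], c ^ 2 + ρ t * c + ρ n ≠ 0 := fun c => by
    have := eval_residueQuadratic_ne_zero H c
    simpa [residueQuadratic] using this
  obtain ⟨a, b, hab⟩ := exists_form_eq_of_finite hH (ρ u)
  obtain ⟨a, rfl⟩ := IsLocalRing.residue_surjective a
  obtain ⟨b, rfl⟩ := IsLocalRing.residue_surjective b
  have hform : ρ (a ^ 2 + t * a * b + n * b ^ 2 - u) = 0 := by
    simp only [map_sub, map_add, map_mul, map_pow]
    linear_combination hab
  -- The two partial derivatives of the form decide the variable in which Hensel's lemma applies. By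
  -- Euler's identity a ∂_a + b ∂_b is twice the form, so both can vanish only in residue
  -- characteristic 2.
  by_cases h1 : ρ (2 * a + t * b) = 0
  · by_cases h2 : ρ (t * a + 2 * (n * b)) = 0
    · exfalso
      have h2u : (2 : 𝓀[F]) * ρ u = 0 := by
        simp only [map_sub, map_add, map_mul, map_pow, map_ofNat] at hform h1 h2
        linear_combination -2 * hform + ρ a * h1 + ρ b * h2
      have h20 : (2 : 𝓀[F]) = 0 := (mul_eq_zero.1 h2u).resolve_right hρu
      simp only [map_add, map_mul, map_ofNat, h20, zero_mul, zero_add, add_zero] at h1 h2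
      -- Otherwise a and b would vanish modulo the maximal ideal, against the form taking the unit
      -- value u. With t = 0 the polynomial becomes X² + n, which has a root because squaring is
      -- onto in a finite field of characteristic 2.
      have ht : ρ t = 0 := by
        by_contra ht
        have hb0 := (mul_eq_zero.1 h1).resolve_left ht
        have ha0 := (mul_eq_zero.1 h2).resolve_left ht
        simp only [map_sub, map_add, map_mul, map_pow, hb0, ha0] at hform
        apply hρu
        linear_combination -hform
      have hchar : ringChar 𝓀[F] = 2 := by
        have hdvd : ringChar 𝓀[F] ∣ 2 := ringChar.dvd (by exact_mod_cast h20)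
        exact ((Nat.prime_dvd_prime_iff_eq (CharP.char_is_prime 𝓀[F] _) Nat.prime_two).1 hdvd)
      obtain ⟨c, hc⟩ := FiniteField.isSquare_of_char_two hchar (-(ρ n))
      refine hH c ?_
      rw [ht]
      linear_combination -hc
    · obtain ⟨b', hb'⟩ := exists_quadratic_root (n' * (t * a)) (n' * (a ^ 2 - u)) b
        (by
          -- The form minus u is made monic in b by dividing by the unit n.
          have : b ^ 2 + n' * (t * a) * b + n' * (a ^ 2 - u) =
              n' * (a ^ 2 + t * a * b + n * b ^ 2 - u) := by
            linear_combination (-b ^ 2) * hnn'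
          rw [this, map_mul, hform, mul_zero])
        (by
          intro h0
          apply h2
          have : t * a + 2 * (n * b) = n * (2 * b + n' * (t * a)) := by
            linear_combination (-t * a) * hnn'
          rw [this, map_mul]
          exact (congrArg _ h0).trans (mul_zero _))
      refine ⟨a, b', ?_⟩
      linear_combination n * hb' - (t * a * b' + (a ^ 2 - u)) * hnn'
  · obtain ⟨a', ha'⟩ := exists_quadratic_root (t * b) (n * b ^ 2 - u) a
      (by
        rw [← hform]
        congr 1
        ring) h1
    exact ⟨a', b, by linear_combination ha'⟩

theorem exists_quadratic_form_eq_of_absF {t n u : F} (ht : absF F t ≤ 1) (hn : absF F n ≤ 1)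
    (hu : absF F u = 1) (H : ∀ c : F, absF F c ≤ 1 → absF F (c ^ 2 + t * c + n) = 1) :
    ∃ a b : F, a ^ 2 + t * a * b + n * b ^ 2 = u := by
  obtain ⟨t, rfl⟩ : ∃ t' : 𝒪[F], (t' : F) = t := ⟨⟨t, absF_le_one_iff.1 ht⟩, rfl⟩
  obtain ⟨n, rfl⟩ : ∃ n' : 𝒪[F], (n' : F) = n := ⟨⟨n, absF_le_one_iff.1 hn⟩, rfl⟩
  obtain ⟨u, rfl⟩ : ∃ u' : 𝒪[F], (u' : F) = u := ⟨⟨u, absF_le_one_iff.1 hu.le⟩, rfl⟩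
  have H' : ∀ c : 𝒪[F], absF F ((c : F) ^ 2 + t * c + n) = 1 := fun c => H c (absF_coe_le_one c)
  obtain ⟨a, b, hab⟩ := exists_quadratic_form_eq H' hu
  refine ⟨a, b, ?_⟩
  rw [← hab]
  simp only [Subring.coe_add, Subring.coe_mul, Subring.coe_pow]

variable {E : Type*} [Field E] [Algebra F E] (hE : Module.finrank F E = 2) {l : E}
  (hl : l ∉ Set.range (algebraMap F E)) (hl2 : l ^ 2 ∈ Set.range (algebraMap F E))

include hE hl hl2 in
/-- If all absolute values of the extension are attained on scalars, it has an integral generator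
that is not congruent to a scalar. -/
theorem exists_unramified_generator (h2 : (2 : F) ≠ 0)
    (hU : ∀ z : E, z ≠ 0 → ∃ k : ℤ, algAbs F z = (residueCard F : ℝ) ^ (2 * k)) :
    ∃ θ : E, θ ∉ Set.range (algebraMap F E) ∧ algAbs F θ = 1 ∧
      ∀ c : F, 1 ≤ algAbs F (algebraMap F E c + θ) := by
  have : FiniteDimensional F E := Module.finite_of_finrank_pos (by omega)
  have hq := one_lt_residueCard_real F
  have hq0 : (0 : ℝ) < residueCard F := zero_lt_one.trans hq
  have h2E : (2 : E) ≠ 0 := by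
    rw [← map_ofNat (algebraMap F E) 2]; simpa using h2
  have hl0 : l ≠ 0 := fun h => hl ⟨0, by rw [h, map_zero]⟩
  have hne : ∀ c : F, algebraMap F E c + l ≠ 0 := fun c h =>
    hl ⟨-c, by rw [map_neg]; linear_combination -h⟩
  set σ := quadConj hE hl hl2
  obtain ⟨k₀, hk₀⟩ := hU (2 * l) (mul_ne_zero h2E hl0)
  -- The difference of c + l and its conjugate is 2 l, which bounds |c + l| from below; so the
  -- discrete set of these values has a least element q^(2k), attained at c₀.
  have hlow : ∀ c : F, algAbs F (2 * l) ≤ algAbs F (algebraMap F E c + l) := by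
    intro c
    have h1 := algAbs_sub_le F (algebraMap F E c + l) (σ (algebraMap F E c + l))
    rw [algAbs_algEquiv, max_self] at h1
    have h3 : algebraMap F E c + l - σ (algebraMap F E c + l) = 2 * l := by
      rw [map_add, AlgEquiv.commutes, quadConj_gen]; ring
    rwa [h3] at h1
  choose κ hκ using fun c : F => hU _ (hne c)
  obtain ⟨k, ⟨c₀, hc₀⟩, hmin⟩ := Int.exists_least_of_bdd (P := fun k => ∃ c, κ c = k)
    ⟨k₀, by
      rintro _ ⟨c, rfl⟩
      have := hlow c
      rw [hk₀, hκ, zpow_le_zpow_iff_right₀ hq] at this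
      omega⟩ ⟨κ 0, 0, rfl⟩
  have hϖ := uniformiser_ne_zero F
  -- By hypothesis the minimum is an even power of q, so it can be scaled to 1 by an element of F.
  set s : F := (uniformiser F : F) ^ k with hs
  have hs0 : s ≠ 0 := zpow_ne_zero _ hϖ
  have hsabs : algAbs F (algebraMap F E s) = ((residueCard F : ℝ) ^ (2 * k))⁻¹ := by
    rw [algAbs_algebraMap, hE, hs, absF_zpow, absF_uniformiser, inv_zpow, inv_pow, ← zpow_natCast,
      ← zpow_mul, mul_comm]
    rfl
  have hpos : (0 : ℝ) < (residueCard F : ℝ) ^ (2 * k) := zpow_pos hq0 _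
  refine ⟨algebraMap F E s * (algebraMap F E c₀ + l), ?_, ?_, fun c => ?_⟩
  · rintro ⟨c, hc⟩
    refine hl ⟨s⁻¹ * c - c₀, ?_⟩
    have hs' : algebraMap F E s ≠ 0 := by simpa using hs0
    rw [map_sub, map_mul, map_inv₀, hc]
    field_simp
    ring
  · rw [algAbs_mul, hsabs, hκ, hc₀, inv_mul_cancel₀ hpos.ne']
  · have : algebraMap F E c + algebraMap F E s * (algebraMap F E c₀ + l) =
        algebraMap F E s * (algebraMap F E (s⁻¹ * c + c₀) + l) := by
      have hs' : algebraMap F E s ≠ 0 := by simpa using hs0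
      rw [map_add, map_mul, map_inv₀]
      field_simp
      ring
    rw [this, algAbs_mul, hsabs, hκ, le_inv_mul_iff₀ hpos, mul_one]
    exact zpow_le_zpow_right₀ hq.le (by have := hmin _ ⟨s⁻¹ * c + c₀, rfl⟩; omega)

end Unramified

/-! ### The absolute value of `D ⊗ E` -/

section Theta

variable {F : Type*} [Field F] [ValuativeRel F] [TopologicalSpace F]
  [IsNonarchimedeanLocalField F] {E : Type*} [Field E] [Algebra F E]
  {D : Type*} [DivisionRing D] [Algebra F D] [Algebra.IsCentral F D]
  [FiniteDimensional F E] [FiniteDimensional F D] [IsDomain (D ⊗[F] E)]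

omit [Algebra.IsCentral F D] in
theorem algAbs_tmul_one (hE : Module.finrank F E = 2) {d : ℕ} (hD : Module.finrank F D = d ^ 2)
    (x : D) : algAbs F (x ⊗ₜ[F] (1 : E)) = algAbs F x ^ 2 :=
  algAbs_algHom (Algebra.TensorProduct.includeLeft : D →ₐ[F] D ⊗[F] E)
    (by rw [Module.finrank_tensorProduct, hD, hE]) x

omit [Algebra.IsCentral F D] in
theorem algAbs_one_tmul (hE : Module.finrank F E = 2) {d : ℕ} (hD : Module.finrank F D = d ^ 2)
    (e : E) : algAbs F ((1 : D) ⊗ₜ[F] e) = algAbs F e ^ (d ^ 2) :=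
  algAbs_algHom (Algebra.TensorProduct.includeRight : E →ₐ[F] D ⊗[F] E)
    (by rw [Module.finrank_tensorProduct, hD, hE, mul_comm]) e

omit [Algebra.IsCentral F D] in
theorem algAbs_tmul (hE : Module.finrank F E = 2) {d : ℕ} (hD : Module.finrank F D = d ^ 2)
    (y : D) (e : E) : algAbs F (y ⊗ₜ[F] e) = algAbs F y ^ 2 * algAbs F e ^ (d ^ 2) := by
  have : y ⊗ₜ[F] e = (y ⊗ₜ 1) * (1 ⊗ₜ e) := by
    rw [Algebra.TensorProduct.tmul_mul_tmul, mul_one, one_mul]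
  rw [this, algAbs_mul, algAbs_tmul_one hE hD, algAbs_one_tmul hE hD]

/-- Here θ is a uniformiser π of E, obtained from an element of odd valuation, and m = d because |1
⊗ π| = q^(-d²) = Q^(-d). -/
theorem exists_orthogonal_generator_of_ramified (h2 : (2 : F) ≠ 0) (hE : Module.finrank F E = 2)
    {d : ℕ} (hd : Odd d) (hD : Module.finrank F D = d ^ 2) {l : E}
    (hl : l ∉ Set.range (algebraMap F E)) (hl2 : l ^ 2 ∈ Set.range (algebraMap F E))
    (hR : ∃ z : E, z ≠ 0 ∧ ∀ k : ℤ, algAbs F z ≠ (residueCard F : ℝ) ^ (2 * k)) :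
    ∃ θ : E, θ ∉ Set.range (algebraMap F E) ∧ ∃ m : ℤ,
      (∀ x y : D, algAbs F (x ⊗ₜ[F] (1 : E) + y ⊗ₜ θ) =
        max (algAbs F x ^ 2) (((residueCard F : ℝ) ^ d) ^ (-m) * algAbs F y ^ 2)) ∧
      Odd m ∧ ∃ u : Fˣ, absF F (u : F) = 1 ∧ ¬ ∃ y : E, Algebra.norm F y = (u : F) := by
  have hq := one_lt_residueCard_real F
  have hq0 : (0 : ℝ) < residueCard F := zero_lt_one.trans hq
  have habsD := algAbs_tmul_one (D := D) hE hD
  have habsE := algAbs_one_tmul (D := D) hE hD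
  obtain ⟨hres, -, hval⟩ := exists_uniformiser_of_central hD
  have hQ : (1 : ℝ) < (residueCard F : ℝ) ^ d := one_lt_pow₀ hq hd.pos.ne'
  have hQ0 : (0 : ℝ) < (residueCard F : ℝ) ^ d := zero_lt_one.trans hQ
  obtain ⟨z, hz0, hz⟩ := hR
  obtain ⟨n, hn⟩ := exists_algAbs_eq_zpow F hz0
  have hodd : Odd n := by
    rw [← Int.not_even_iff_odd]
    rintro ⟨k, rfl⟩
    exact hz k (by rw [hn]; congr 1; ring)
  obtain ⟨k, hk⟩ := hodd
  set π : E := algebraMap F E ((uniformiser F : F) ^ (k + 1)) * z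
  have hπ : algAbs F π = (residueCard F : ℝ)⁻¹ := by
    rw [algAbs_mul, algAbs_algebraMap, hE, absF_zpow, absF_uniformiser, hn, inv_zpow', ← zpow_natCast,
      ← zpow_mul, ← zpow_add₀ hq0.ne', ← zpow_neg_one]
    congr 1
    push_cast
    omega
  have hπF : π ∉ Set.range (algebraMap F E) := by
    rintro ⟨a, ha⟩
    have ha0 : a ≠ 0 := fun h => by
      rw [← ha, h, map_zero, algAbs_zero] at hπ
      exact (inv_pos.2 hq0).ne hπ
    obtain ⟨j, hj⟩ := exists_absF_eq_zpow ha0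
    rw [← ha, algAbs_algebraMap, hE, hj, ← zpow_natCast, ← zpow_mul, ← zpow_neg_one] at hπ
    have := zpow_right_injective₀ hq0 hq.ne' hπ
    push_cast at this
    omega
  have habsπ : algAbs F ((1 : D) ⊗ₜ[F] π) = ((residueCard F : ℝ) ^ d) ^ (-(d : ℤ)) := by
    rw [habsE, hπ, inv_pow, sq, pow_mul, zpow_neg, zpow_natCast]
  refine ⟨π, hπF, d, fun x y => ?_, by exact_mod_cast hd,
    exists_unit_not_norm hE hl hl2 h2 hπ⟩
  have e2 : algAbs F (y ⊗ₜ[F] π) = ((residueCard F : ℝ) ^ d) ^ (-(d : ℤ)) * algAbs F y ^ 2 := by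
    rw [algAbs_tmul hE hD, ← habsE, habsπ, mul_comm]
  rw [← habsD, ← e2]
  by_cases hx : x = 0
  · simp [hx, algAbs_nonneg]
  by_cases hy : y = 0
  · simp [hy, algAbs_nonneg]
  -- The exponents of Q in the two summands are 2i and 2j - d, of different parity as d is odd.
  refine algAbs_add_eq_max F fun h => ?_
  obtain ⟨i, hi⟩ := hval x hx
  obtain ⟨j, hj⟩ := hval y hy
  rw [e2, habsD, hi, hj, ← zpow_natCast, ← zpow_mul, ← zpow_natCast _ 2, ← zpow_mul,
    ← zpow_add₀ hQ0.ne'] at h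
  have := zpow_right_injective₀ hQ0 hQ.ne' h
  obtain ⟨r, rfl⟩ := hd
  push_cast at this
  omega

/-- Here θ is a unit with |c + θ| = 1 for all integral c in F. Its minimal polynomial takes unit
values at integral scalars, hence also at integral elements of D, whose residue degree is odd; so no
cancellation occurs in x + y θ even when the summands have equal size. -/
theorem exists_orthogonal_generator_of_unramified (h2 : (2 : F) ≠ 0) (hE : Module.finrank F E = 2)
    {d : ℕ} (hd : Odd d) (hD : Module.finrank F D = d ^ 2) {l : E}
    (hl : l ∉ Set.range (algebraMap F E)) (hl2 : l ^ 2 ∈ Set.range (algebraMap F E))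
    (hR : ∀ z : E, z ≠ 0 → ∃ k : ℤ, algAbs F z = (residueCard F : ℝ) ^ (2 * k)) :
    ∃ θ : E, θ ∉ Set.range (algebraMap F E) ∧
      (∀ x y : D, algAbs F (x ⊗ₜ[F] (1 : E) + y ⊗ₜ θ) = max (algAbs F x ^ 2) (algAbs F y ^ 2)) ∧
      (∀ u : Fˣ, absF F (u : F) = 1 → ∃ y : E, Algebra.norm F y = (u : F)) ∧
      ¬ ∃ y : E, Algebra.norm F y = (uniformiser F : F) := by
  have hq := one_lt_residueCard_real F
  have hq0 : (0 : ℝ) < residueCard F := zero_lt_one.trans hq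
  have habsD := algAbs_tmul_one (D := D) hE hD
  have habsE := algAbs_one_tmul (D := D) hE hD
  obtain ⟨hres, -, hval⟩ := exists_uniformiser_of_central hD
  obtain ⟨θ, hθF, hθ1, hθ⟩ := exists_unramified_generator hE hl hl2 h2 hR
  set σ := quadConj hE hl hl2
  obtain ⟨t, ht⟩ := exists_trace hE hl hl2 θ
  set n := Algebra.norm F θ
  have hnσ : algebraMap F E n = θ * σ θ := algebraMap_norm_eq hE hl hl2 θ
  have hsq : θ ^ 2 = algebraMap F E t * θ - algebraMap F E n := by
    rw [hnσ, ht]; change _ = (θ + σ θ) * θ - _; ring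
  have hform : ∀ a b : F, Algebra.norm F (algebraMap F E a + algebraMap F E b * θ) =
    a ^ 2 + t * a * b + n * b ^ 2 := norm_quadratic hE hθF hsq
  have hn1 : absF F n = 1 := hθ1
  have hone : ∀ c : F, absF F c ≤ 1 → algAbs F (algebraMap F E c + θ) = 1 := by
    intro c hc
    refine le_antisymm ((algAbs_add_le F _ _).trans (max_le ?_ hθ1.le)) (hθ c)
    rw [algAbs_algebraMap]
    exact pow_le_one₀ (absF_nonneg c) hc
  have hH : ∀ c : F, absF F c ≤ 1 → absF F (c ^ 2 + t * c + n) = 1 := by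
    intro c hc
    rw [← hone c hc, ← absF_norm]
    have := hform c 1
    rw [map_one, one_mul, mul_one, one_pow, mul_one] at this
    rw [this]
  have htO : absF F t ≤ 1 := by
    -- The trace t is integral because 1 + t + n and n are.
    have h1 := hH 1 (by simp)
    have h3 : t = (1 ^ 2 + t * 1 + n) + -(1 + n) := by ring
    rw [h3]
    refine (absF_add_le _ _).trans (max_le h1.le ?_)
    rw [absF_neg]
    exact (absF_add_le _ _).trans (max_le (by simp) hn1.le)
  let t' : 𝒪[F] := ⟨t, absF_le_one_iff.1 htO⟩
  let n' : 𝒪[F] := ⟨n, absF_le_one_iff.1 hn1.le⟩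
  have hH' : ∀ c : 𝒪[F], absF F ((c : F) ^ 2 + t' * c + n') = 1 := fun c =>
    hH c (absF_coe_le_one c)
  refine ⟨θ, hθF, ?_, ?_, ?_⟩
  -- The elements w + θ and w + σθ are conjugate over D, so have the same absolute value, and their
  -- product w² + t w + n lies in D.
  · have hσabs : ∀ w : D, algAbs F (w ⊗ₜ[F] (1 : E) + 1 ⊗ₜ σ θ) =
        algAbs F (w ⊗ₜ[F] (1 : E) + 1 ⊗ₜ θ) := by
      intro w
      have := algAbs_algEquiv F
        (Algebra.TensorProduct.congr (AlgEquiv.refl : D ≃ₐ[F] D) σ) (w ⊗ₜ[F] (1 : E) + 1 ⊗ₜ θ)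
      simpa using this
    have hunit : ∀ w : D, algAbs F w ≤ 1 → algAbs F (w ⊗ₜ[F] (1 : E) + 1 ⊗ₜ θ) = 1 := by
      intro w hw
      have h1 := algAbs_quadratic_eq_one (F := F) (A := D) (by rw [hres]; exact hd) t' n' hH' hw
      have h3 : (w ⊗ₜ[F] (1 : E) + 1 ⊗ₜ θ) * (w ⊗ₜ[F] (1 : E) + 1 ⊗ₜ σ θ) =
          (w ^ 2 + t • w + algebraMap F D n) ⊗ₜ[F] (1 : E) := by
        rw [TensorProduct.add_tmul, TensorProduct.add_tmul, Algebra.algebraMap_eq_smul_one (A := D),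
          TensorProduct.smul_tmul, TensorProduct.smul_tmul, ← Algebra.algebraMap_eq_smul_one,
          ← Algebra.algebraMap_eq_smul_one, hnσ, ht]
        simp only [add_mul, mul_add, Algebra.TensorProduct.tmul_mul_tmul, mul_one, one_mul, sq,
          TensorProduct.tmul_add]
        change _ + _ + (_ + _) = _ + (w ⊗ₜ θ + w ⊗ₜ σ θ) + _
        abel
      have h4 := congrArg (algAbs F) h3
      rw [algAbs_mul, hσabs, habsD] at h4
      change algAbs F (w ^ 2 + t • w + algebraMap F D n) = 1 at h1
      rw [h1, one_pow, ← sq] at h4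
      exact (pow_eq_one_iff_of_nonneg (algAbs_nonneg F _) two_ne_zero).1 h4
    intro x y
    have e2 : algAbs F (y ⊗ₜ[F] θ) = algAbs F y ^ 2 := by
      rw [algAbs_tmul hE hD, hθ1, one_pow, mul_one]
    by_cases hxy : algAbs F x ^ 2 = algAbs F y ^ 2
    · rw [hxy, max_self]
      by_cases hy : y = 0
      · have hx : x = 0 := by
          rw [hy, algAbs_zero] at hxy
          simpa using hxy
        simp [hx, hy]
      have hxy' : algAbs F x = algAbs F y :=
        (pow_left_inj₀ (algAbs_nonneg F x) (algAbs_nonneg F y) two_ne_zero).1 hxy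
      have hfac : x ⊗ₜ[F] (1 : E) + y ⊗ₜ θ = (y ⊗ₜ 1) * ((y⁻¹ * x) ⊗ₜ 1 + 1 ⊗ₜ θ) := by
        rw [mul_add, Algebra.TensorProduct.tmul_mul_tmul, Algebra.TensorProduct.tmul_mul_tmul,
          mul_inv_cancel_left₀ hy]
        simp
      have hw : algAbs F (y⁻¹ * x) ≤ 1 := by
        refine le_of_eq (mul_left_cancel₀ (algAbs_pos F hy).ne' ?_)
        rw [← algAbs_mul, mul_inv_cancel_left₀ hy, mul_one, hxy']
      rw [hfac, algAbs_mul, hunit _ hw, habsD, mul_one]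
    · rw [← habsD, ← e2] at hxy ⊢
      exact algAbs_add_eq_max F hxy
  · intro u hu
    obtain ⟨a, b, hab⟩ := exists_quadratic_form_eq_of_absF htO hn1.le hu hH
    exact ⟨algebraMap F E a + algebraMap F E b * θ, (hform a b).trans hab⟩
  -- All norms have even valuation here, whereas a uniformiser has valuation 1.
  · rintro ⟨y, hy⟩
    have hy0 : y ≠ 0 := fun h => by
      rw [h, Algebra.norm_zero] at hy
      exact uniformiser_ne_zero F hy.symm
    obtain ⟨k, hk⟩ := hR y hy0
    rw [← absF_norm, hy, absF_uniformiser, ← zpow_neg_one] at hk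
    have := zpow_right_injective₀ hq0 hq.ne' hk
    omega

/-- There is a generator `θ` of `E` for which the absolute value of `x + y θ` is the larger of the
absolute values of the summands; the parity of the valuation of `θ` determines the ramification of
the quadratic character. -/
theorem exists_orthogonal_generator (h2 : (2 : F) ≠ 0) (hE : Module.finrank F E = 2)
    {d : ℕ} (hd : Odd d) (hD : Module.finrank F D = d ^ 2) {l : E}
    (hl : l ∉ Set.range (algebraMap F E)) (hl2 : l ^ 2 ∈ Set.range (algebraMap F E)) :
    ∃ θ : E, θ ∉ Set.range (algebraMap F E) ∧ ∃ m : ℤ,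
      (∀ x y : D, algAbs F (x ⊗ₜ[F] (1 : E) + y ⊗ₜ θ) =
        max (algAbs F x ^ 2) (((residueCard F : ℝ) ^ d) ^ (-m) * algAbs F y ^ 2)) ∧
      ((Even m ∧ (∀ u : Fˣ, absF F (u : F) = 1 → ∃ y : E, Algebra.norm F y = (u : F)) ∧
          ¬ ∃ y : E, Algebra.norm F y = (uniformiser F : F)) ∨
        (Odd m ∧ ∃ u : Fˣ, absF F (u : F) = 1 ∧ ¬ ∃ y : E, Algebra.norm F y = (u : F))) := by
  by_cases hR : ∃ z : E, z ≠ 0 ∧ ∀ k : ℤ, algAbs F z ≠ (residueCard F : ℝ) ^ (2 * k)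
  · obtain ⟨θ, hθ, m, hm, h⟩ := exists_orthogonal_generator_of_ramified (D := D) h2 hE hd hD hl hl2 hR
    exact ⟨θ, hθ, m, hm, Or.inr h⟩
  · push Not at hR
    obtain ⟨θ, hθ, hm, h⟩ := exists_orthogonal_generator_of_unramified (D := D) h2 hE hd hD hl hl2 hR
    exact ⟨θ, hθ, 0, by simpa using hm, Or.inl ⟨Even.zero, h⟩⟩

end Theta


/-! ### Iwasawa decomposition and the spherical section -/

section Iwasawa

variable {F : Type*} [Field F] [ValuativeRel F] [TopologicalSpace F]
  [IsNonarchimedeanLocalField F] {A : Type*} [Ring A] [Algebra F A] [IsDomain A]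
  [FiniteDimensional F A]

theorem modulus_eq (p : GL2 A) : modulus F p = algAbs F (p.val 0 0) * algAbs F (p⁻¹.val 1 1) := by
  rw [modulus, LinearMap.det_comp, absF_mul, absF_det_mulRight]
  rfl

omit [IsDomain A] [FiniteDimensional F A] [Algebra F A] in
theorem borel_mul_apply_zero {p : GL2 A} (q : GL2 A) (hq : q ∈ borelSubgroup A) :
    (p * q).val 0 0 = p.val 0 0 * q.val 0 0 := by
  simp [Matrix.mul_apply, Fin.sum_univ_two, hq.1]

omit [IsDomain A] [FiniteDimensional F A] [Algebra F A] in
theorem borel_mul_apply_one {p : GL2 A} (hp : p ∈ borelSubgroup A) (q : GL2 A) :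
    (p * q).val 1 1 = p.val 1 1 * q.val 1 1 := by
  simp [Matrix.mul_apply, Fin.sum_univ_two, hp.1]

theorem modulus_mul (p : GL2 A) {q : GL2 A} (hq : q ∈ borelSubgroup A) :
    modulus F (p * q) = modulus F p * modulus F q := by
  rw [modulus_eq, modulus_eq, modulus_eq, mul_inv_rev, borel_mul_apply_zero q hq,
    borel_mul_apply_one (inv_mem hq), algAbs_mul, algAbs_mul]
  ring

theorem modulus_one : modulus F (1 : GL2 A) = 1 := by
  rw [modulus_eq]
  simp [algAbs_one]

theorem modulus_nonneg (p : GL2 A) : 0 ≤ modulus F p := by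
  rw [modulus_eq]
  exact mul_nonneg (algAbs_nonneg F _) (algAbs_nonneg F _)

theorem mem_maxCompact {g : GL2 A} : g ∈ maxCompact F A ↔
    ∀ i j, algAbs F (g.val i j) ≤ 1 ∧ algAbs F (g⁻¹.val i j) ≤ 1 := by
  simp only [maxCompact, Set.mem_ofPred_eq, isIntegral_iff_algAbs_le_one F]

theorem algAbs_matrix_mul_le {g h : Matrix (Fin 2) (Fin 2) A} {r r' : ℝ}
    (hg : ∀ i j, algAbs F (g i j) ≤ r) (hh : ∀ i j, algAbs F (h i j) ≤ r') (i j : Fin 2) :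
    algAbs F ((g * h) i j) ≤ r * r' := by
  rw [Matrix.mul_apply, Fin.sum_univ_two]
  have hr : 0 ≤ r := (algAbs_nonneg F _).trans (hg 0 0)
  have key : ∀ k, algAbs F (g i k * h k j) ≤ r * r' := fun k => by
    rw [algAbs_mul]
    exact mul_le_mul (hg _ _) (hh _ _) (algAbs_nonneg F _) hr
  exact (algAbs_add_le F _ _).trans (max_le (key 0) (key 1))

theorem mul_mem_maxCompact {g h : GL2 A} (hg : g ∈ maxCompact F A) (hh : h ∈ maxCompact F A) :
    g * h ∈ maxCompact F A := by
  rw [mem_maxCompact] at *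
  intro i j
  rw [mul_inv_rev, Units.val_mul, Units.val_mul]
  constructor
  · simpa using algAbs_matrix_mul_le (fun i j => (hg i j).1) (fun i j => (hh i j).1) i j
  · simpa using algAbs_matrix_mul_le (fun i j => (hh i j).2) (fun i j => (hg i j).2) i j

theorem inv_mem_maxCompact {g : GL2 A} (hg : g ∈ maxCompact F A) : g⁻¹ ∈ maxCompact F A := by
  rw [mem_maxCompact] at *
  intro i j
  rw [inv_inv]
  exact (hg i j).symm

variable (F) in
theorem one_mem_maxCompact : (1 : GL2 A) ∈ maxCompact F A := by
  rw [mem_maxCompact]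
  intro i j
  rw [inv_one, Units.val_one, Matrix.one_apply]
  split_ifs <;> simp [algAbs_one, algAbs_zero]

theorem modulus_eq_one_of_mem {p : GL2 A} (hp : p ∈ borelSubgroup A) (hk : p ∈ maxCompact F A) :
    modulus F p = 1 := by
  rw [mem_maxCompact] at hk
  have aux : ∀ a b : A, a * b = 1 → algAbs F a ≤ 1 → algAbs F b ≤ 1 →
      algAbs F a = 1 ∧ algAbs F b = 1 := by
    intro a b hab ha hb
    have h := congrArg (algAbs F) hab
    rw [algAbs_mul, algAbs_one] at h
    constructor
    · exact le_antisymm ha (h ▸ mul_le_of_le_one_right (algAbs_nonneg F _) hb)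
    · exact le_antisymm hb (h ▸ mul_le_of_le_one_left (algAbs_nonneg F _) ha)
  have h0 : p.val 0 0 * p⁻¹.val 0 0 = 1 := by
    rw [← borel_mul_apply_zero p⁻¹ (inv_mem hp), mul_inv_cancel]; simp
  have h1 : p.val 1 1 * p⁻¹.val 1 1 = 1 := by
    rw [← borel_mul_apply_one hp, mul_inv_cancel]; simp
  rw [modulus_eq, (aux _ _ h0 (hk 0 0).1 (hk 0 0).2).1, (aux _ _ h1 (hk 1 1).1 (hk 1 1).2).2,
    one_mul]

/-- Two Iwasawa decompositions of g differ by an element of P ∩ K, on which the modulus is 1, so the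
chosen p in the definition does not matter. -/
theorem sphericalSection_eq (s : ℂ) {p g : GL2 A} (hp : p ∈ borelSubgroup A)
    (hk : p⁻¹ * g ∈ maxCompact F A) : sphericalSection F s g = ((modulus F p : ℝ) : ℂ) ^ s := by
  have h : ∃ p ∈ borelSubgroup A, p⁻¹ * g ∈ maxCompact F A := ⟨p, hp, hk⟩
  rw [sphericalSection, dif_pos h]
  obtain ⟨hp', hk'⟩ := h.choose_spec
  set p' := h.choose
  have hb : p⁻¹ * p' ∈ borelSubgroup A := mul_mem (inv_mem hp) hp'
  have hK : p⁻¹ * p' ∈ maxCompact F A := by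
    have := mul_mem_maxCompact hk (inv_mem_maxCompact hk')
    simpa [mul_assoc] using this
  have : p' = p * (p⁻¹ * p') := by group
  rw [this, modulus_mul p hb, modulus_eq_one_of_mem hb hK, mul_one]

omit [FiniteDimensional F A] [Algebra F A] in
theorem mem_borel_of_apply {p : GL2 A} (h : p.val 1 0 = 0) : p ∈ borelSubgroup A := by
  refine ⟨h, ?_⟩
  have h1 : (p * p⁻¹).val 1 1 = 1 := by simp
  have h0 : (p * p⁻¹).val 1 0 = 0 := by simp
  rw [Units.val_mul, Matrix.mul_apply, Fin.sum_univ_two, h, zero_mul, zero_add] at h0 h1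
  exact (mul_eq_zero.1 h0).resolve_left (left_ne_zero_of_mul (h1.trans_ne one_ne_zero))

/-- The lower unipotent matrix with entry `x`. -/
def lowerUnit (x : A) : GL2 A where
  val := !![1, 0; x, 1]
  inv := !![1, 0; -x, 1]
  val_inv := by simp [Matrix.one_fin_two]
  inv_val := by simp [Matrix.one_fin_two]

/-- The matrix with rows `(0, 1)` and `(1, x)`. -/
def weylUnit (x : A) : GL2 A where
  val := !![0, 1; 1, x]
  inv := !![-x, 1; 1, 0]
  val_inv := by simp [Matrix.one_fin_two]
  inv_val := by simp [Matrix.one_fin_two]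

theorem lowerUnit_mem_maxCompact {x : A} (hx : algAbs F x ≤ 1) : lowerUnit x ∈ maxCompact F A := by
  rw [mem_maxCompact]
  change ∀ i j, algAbs F ((!![1, 0; x, 1] : Matrix (Fin 2) (Fin 2) A) i j) ≤ 1 ∧
    algAbs F ((!![1, 0; -x, 1] : Matrix (Fin 2) (Fin 2) A) i j) ≤ 1
  simp [Fin.forall_fin_two, algAbs_one, algAbs_zero, algAbs_neg, hx]

theorem weylUnit_mem_maxCompact {x : A} (hx : algAbs F x ≤ 1) : weylUnit x ∈ maxCompact F A := by
  rw [mem_maxCompact]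
  change ∀ i j, algAbs F ((!![0, 1; 1, x] : Matrix (Fin 2) (Fin 2) A) i j) ≤ 1 ∧
    algAbs F ((!![-x, 1; 1, 0] : Matrix (Fin 2) (Fin 2) A) i j) ≤ 1
  simp [Fin.forall_fin_two, algAbs_one, algAbs_zero, algAbs_neg, hx]

variable (F) in
/-- The Iwasawa decomposition. -/
theorem exists_borel_mul (g : GL2 A) :
    ∃ p ∈ borelSubgroup A, ∃ k ∈ maxCompact F A, g = p * k := by
  -- Column operations from K clear the lower left entry; which of the two is integral depends on
  -- the larger entry of the bottom row.
  obtain ⟨k, hk, h⟩ : ∃ k ∈ maxCompact F A, (g * k⁻¹).val 1 0 = 0 := by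
    rcases le_or_gt (algAbs F (g.val 1 0)) (algAbs F (g.val 1 1)) with h | h
    · have he : g.val 1 1 ≠ 0 := by
        intro he
        rw [he, algAbs_zero] at h
        have hc : g.val 1 0 = 0 := by
          by_contra hc
          exact (algAbs_pos F hc).not_ge h
        have h1 : (g * g⁻¹).val 1 1 = 1 := by simp
        rw [Units.val_mul, Matrix.mul_apply, Fin.sum_univ_two, hc, he] at h1
        simp at h1
      obtain ⟨e, he'⟩ := isUnit_of_ne_zero F he
      refine ⟨lowerUnit (↑e⁻¹ * g.val 1 0), lowerUnit_mem_maxCompact ?_, ?_⟩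
      · rw [algAbs_mul, algAbs_units_inv, he', inv_mul_le_iff₀ (algAbs_pos F he), mul_one]
        exact h
      · change (g.val * !![1, 0; -(↑e⁻¹ * g.val 1 0), 1]) 1 0 = 0
        simp [Matrix.mul_apply, Fin.sum_univ_two, ← he']
    · have hc : g.val 1 0 ≠ 0 := by
        intro hc
        rw [hc, algAbs_zero] at h
        exact (algAbs_nonneg F _).not_gt h
      obtain ⟨c, hc'⟩ := isUnit_of_ne_zero F hc
      refine ⟨weylUnit (↑c⁻¹ * g.val 1 1), weylUnit_mem_maxCompact ?_, ?_⟩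
      · rw [algAbs_mul, algAbs_units_inv, hc', inv_mul_le_iff₀ (algAbs_pos F hc), mul_one]
        exact h.le
      · change (g.val * !![-(↑c⁻¹ * g.val 1 1), 1; 1, 0]) 1 0 = 0
        simp [Matrix.mul_apply, Fin.sum_univ_two, ← hc']
  exact ⟨_, mem_borel_of_apply h, k, hk, by simp⟩

theorem sphericalSection_one (s : ℂ) : sphericalSection F s (1 : GL2 A) = 1 := by
  rw [sphericalSection_eq s (one_mem _) (by simpa using one_mem_maxCompact F), modulus_one]
  simp

theorem sphericalSection_mul (s : ℂ) {p k : GL2 A} (hp : p ∈ borelSubgroup A)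
    (hk : k ∈ maxCompact F A) (g : GL2 A) :
    sphericalSection F s (p * g * k) = ((modulus F p : ℝ) : ℂ) ^ s * sphericalSection F s g := by
  obtain ⟨p', hp', k', hk', rfl⟩ := exists_borel_mul F g
  rw [sphericalSection_eq s (mul_mem hp hp') (g := p * (p' * k') * k)
      (by simpa [mul_assoc] using mul_mem_maxCompact hk' hk),
    sphericalSection_eq s hp' (g := p' * k') (by simpa using hk'), modulus_mul p hp',
    Complex.ofReal_mul, Complex.mul_cpow_ofReal_nonneg (modulus_nonneg _) (modulus_nonneg _)]

/-- The value of the spherical section at a matrix with rows `(1, v)` and `(1, w)`. -/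
theorem sphericalSection_rows (s : ℂ) {g : GL2 A} {v w : A} (hg : g.val = !![1, v; 1, w]) :
    sphericalSection F s g = ((algAbs F (v - w) / max 1 (algAbs F w) ^ 2 : ℝ) : ℂ) ^ s := by
  have main : ∀ k ∈ maxCompact F A, (g * k⁻¹).val 1 0 = 0 →
      modulus F (g * k⁻¹) = algAbs F (v - w) / max 1 (algAbs F w) ^ 2 →
      sphericalSection F s g = ((algAbs F (v - w) / max 1 (algAbs F w) ^ 2 : ℝ) : ℂ) ^ s := by
    intro k hk h h'
    rw [← h', sphericalSection_eq s (mem_borel_of_apply h)]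
    simpa using hk
  have hmod : ∀ p : GL2 A, p.val 1 0 = 0 →
      modulus F p = algAbs F (p.val 0 0) / algAbs F (p.val 1 1) := by
    intro p hp
    have h1 : p.val 1 1 * p⁻¹.val 1 1 = 1 := by
      rw [← borel_mul_apply_one (mem_borel_of_apply hp), mul_inv_cancel]; simp
    have h2 := congrArg (algAbs F) h1
    rw [algAbs_mul, algAbs_one] at h2
    rw [modulus_eq, eq_inv_of_mul_eq_one_right h2, div_eq_mul_inv]
  -- The two cases are the two cells of the Iwasawa decomposition: the bottom row (1, w) is reduced
  -- by a Weyl element if |w| ≤ 1, and by a lower unipotent with entry w⁻¹ otherwise.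
  rcases le_or_gt (algAbs F w) 1 with hw | hw
  · have hp : (g * (weylUnit w)⁻¹).val = !![v - w, 1; 0, 1] := by
      change g.val * !![-w, 1; 1, 0] = _
      rw [hg, Matrix.mul_fin_two]
      simp [sub_eq_neg_add]
    refine main _ (weylUnit_mem_maxCompact hw) (by rw [hp]; simp) ?_
    rw [hmod _ (by rw [hp]; simp), hp]
    simp [max_eq_left hw, algAbs_one]
  · have hw0 : w ≠ 0 := by
      rintro rfl
      rw [algAbs_zero] at hw
      linarith
    obtain ⟨c, rfl⟩ := isUnit_of_ne_zero F hw0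
    have hp : (g * (lowerUnit (↑c⁻¹ : A))⁻¹).val = !![1 - v * ↑c⁻¹, v; 0, (c : A)] := by
      change g.val * !![1, 0; -(↑c⁻¹ : A), 1] = _
      rw [hg, Matrix.mul_fin_two]
      simp [sub_eq_add_neg]
    refine main _ (lowerUnit_mem_maxCompact ?_) (by rw [hp]; simp) ?_
    · rw [algAbs_units_inv]
      exact inv_le_one_of_one_le₀ hw.le
    rw [hmod _ (by rw [hp]; simp), hp]
    have : 1 - v * ↑c⁻¹ = -((v - c) * (↑c⁻¹ : A)) := by rw [sub_mul, Units.mul_inv]; abel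
    simp only [Matrix.of_apply, Matrix.cons_val', Matrix.cons_val_zero, Matrix.cons_val_one,
      Matrix.cons_val_fin_one]
    rw [this, algAbs_neg, algAbs_mul, algAbs_units_inv, max_eq_right hw.le]
    field_simp

end Iwasawa


/-! ### The stabilizer and representatives of its cosets -/

section Stabilizer

variable {F E : Type*} [Field F] [Field E] [Algebra F E] {D : Type*} [DivisionRing D]
  [Algebra F D] (h2 : (2 : F) ≠ 0) {l : E} (hl : l ∉ Set.range (algebraMap F E))

theorem uZero_val : (uZero D h2 hl).val =
    !![1, -((1 : D) ⊗ₜ[F] l); 1, (1 : D) ⊗ₜ[F] l] := by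
  ext i j
  fin_cases i <;> fin_cases j <;>
    simp [uZero, Matrix.GeneralLinearGroup.mkOfDetNeZero, Algebra.TensorProduct.one_def, TensorProduct.tmul_neg]

theorem embH_val (h : GL2 D) (i j : Fin 2) : (embH F E D h).val i j = h.val i j ⊗ₜ[F] (1 : E) := rfl

/-- The first entry of the bottom row of `u₀ h`. -/
def bottomLeft (l : E) (h : GL2 D) : D ⊗[F] E := h.val 0 0 ⊗ₜ 1 + h.val 1 0 ⊗ₜ l

/-- The second entry of the bottom row of `u₀ h`. -/
def bottomRight (l : E) (h : GL2 D) : D ⊗[F] E := h.val 0 1 ⊗ₜ 1 + h.val 1 1 ⊗ₜ l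

theorem uZero_mul_embH_val (h : GL2 D) : (uZero D h2 hl * embH F E D h).val =
    !![h.val 0 0 ⊗ₜ 1 - h.val 1 0 ⊗ₜ l, h.val 0 1 ⊗ₜ 1 - h.val 1 1 ⊗ₜ l;
      bottomLeft l h, bottomRight l h] := by
  ext i j
  rw [Units.val_mul, Matrix.mul_apply, Fin.sum_univ_two, uZero_val, embH_val, embH_val]
  fin_cases i <;> fin_cases j <;>
    simp [bottomLeft, bottomRight, Algebra.TensorProduct.tmul_mul_tmul, sub_eq_add_neg]

theorem bottomLeft_mul (h g : GL2 D) : bottomLeft (F := F) l (h * g) =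
    bottomLeft l h * (g.val 0 0 ⊗ₜ 1) + bottomRight l h * (g.val 1 0 ⊗ₜ 1) := by
  simp only [bottomLeft, bottomRight, Units.val_mul, Matrix.mul_apply, Fin.sum_univ_two,
    TensorProduct.add_tmul, add_mul, Algebra.TensorProduct.tmul_mul_tmul, mul_one]
  abel

theorem bottomRight_mul (h g : GL2 D) : bottomRight (F := F) l (h * g) =
    bottomLeft l h * (g.val 0 1 ⊗ₜ 1) + bottomRight l h * (g.val 1 1 ⊗ₜ 1) := by
  simp only [bottomLeft, bottomRight, Units.val_mul, Matrix.mul_apply, Fin.sum_univ_two,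
    TensorProduct.add_tmul, add_mul, Algebra.TensorProduct.tmul_mul_tmul, mul_one]
  abel

/-- The upper triangular matrix with rows `(1, x)` and `(0, y)`. -/
def upperUnit (x : D) (y : Dˣ) : GL2 D where
  val := !![1, x; 0, (y : D)]
  inv := !![1, -(x * (↑y⁻¹ : D)); 0, (↑y⁻¹ : D)]
  val_inv := by
    rw [Matrix.mul_fin_two, Matrix.one_fin_two]
    simp only [Units.mul_inv]
    simp
  inv_val := by
    rw [Matrix.mul_fin_two, Matrix.one_fin_two]
    simp only [Units.inv_mul, neg_mul, mul_assoc]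
    simp

theorem upperUnit_val (x : D) (y : Dˣ) : (upperUnit x y).val = !![1, x; 0, (y : D)] := rfl

theorem upperUnit_inv_val (x : D) (y : Dˣ) :
    (upperUnit x y)⁻¹.val = !![1, -(x * (↑y⁻¹ : D)); 0, (↑y⁻¹ : D)] := rfl

theorem upperUnit_mul (x b : D) (y c : Dˣ) :
    upperUnit x y * upperUnit b c = upperUnit (b + x * c) (y * c) := by
  apply Units.ext
  rw [Units.val_mul, upperUnit_val, upperUnit_val, upperUnit_val, Matrix.mul_fin_two]
  simp

theorem upperUnit_inv (x : D) (y : Dˣ) : (upperUnit x y)⁻¹ = upperUnit (-(x * (↑y⁻¹ : D))) y⁻¹ := by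
  apply Units.ext
  rw [upperUnit_inv_val, upperUnit_val]

variable [IsDomain (D ⊗[F] E)]

/-- Put p = u₀ h u₀⁻¹. Since p u₀ = u₀ h, the bottom row of u₀ h is (p₁₀ + p₁₁, (p₁₁ - p₁₀) l). It
is a left multiple of (1, l) exactly when 2 p₁₀ l = 0, that is, when p lies in P. -/
theorem mem_stabilizerH_iff_bottom {h : GL2 D} : h ∈ stabilizerH D (uZero D h2 hl) ↔
    bottomRight l h = bottomLeft l h * ((1 : D) ⊗ₜ[F] l) := by
  set p : GL2 (D ⊗[F] E) := uZero D h2 hl * embH F E D h * (uZero D h2 hl)⁻¹ with hp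
  have hpu : p * uZero D h2 hl = uZero D h2 hl * embH F E D h := by rw [hp]; group
  have hv := congrArg Units.val hpu
  rw [uZero_mul_embH_val, Units.val_mul, uZero_val] at hv
  have h0 := congrFun (congrFun hv 1) 0
  have h1 := congrFun (congrFun hv 1) 1
  simp only [Matrix.mul_apply, Fin.sum_univ_two, Matrix.of_apply, Matrix.cons_val', Matrix.cons_val_zero,
    Matrix.cons_val_one, Matrix.cons_val_fin_one, mul_one] at h0 h1
  have hmem : h ∈ stabilizerH D (uZero D h2 hl) ↔ p ∈ borelSubgroup (D ⊗[F] E) := Iff.rfl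
  have hl0 : (1 : D) ⊗ₜ[F] l ≠ 0 := by
    intro h
    have : IsUnit ((1 : D) ⊗ₜ[F] l) := by
      have hl0 : l ≠ 0 := by
        rintro rfl
        exact hl ⟨0, map_zero _⟩
      exact (isUnit_iff_ne_zero.2 hl0).map (Algebra.TensorProduct.includeRight : E →ₐ[F] D ⊗[F] E)
    exact this.ne_zero h
  have h20 : (2 : D ⊗[F] E) ≠ 0 := by
    have : IsUnit (algebraMap F (D ⊗[F] E) 2) := (isUnit_iff_ne_zero.2 h2).map _
    rw [map_ofNat] at this
    exact this.ne_zero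
  rw [hmem, ← h0, ← h1]
  constructor
  · intro hb
    rw [hb.1]
    simp
  · intro he
    refine mem_borel_of_apply ?_
    have h3 : 2 * p.val 1 0 * ((1 : D) ⊗ₜ[F] l) = 0 := by
      rw [mul_neg, add_mul] at he
      rw [mul_assoc, two_mul]
      nth_rw 1 [← add_right_cancel_iff (a := p.val 1 1 * ((1 : D) ⊗ₜ[F] l))]
      rw [zero_add, add_assoc, ← he]
      abel
    exact (mul_eq_zero.1 ((mul_eq_zero.1 h3).resolve_right hl0)).resolve_left h20

variable (hE : Module.finrank F E = 2)

-- Comparing coordinates with respect to 1, l turns the previous criterion into equations over D: T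
-- is the image of the units of D ⊗ E, the element x + y l acting as the matrix with rows (x, a y)
-- and (y, x).
include hE in
theorem mem_stabilizerH_iff {a : F} (ha : algebraMap F E a = l ^ 2) {h : GL2 D} :
    h ∈ stabilizerH D (uZero D h2 hl) ↔ h.val 0 1 = a • h.val 1 0 ∧ h.val 1 1 = h.val 0 0 := by
  rw [mem_stabilizerH_iff_bottom]
  have : bottomLeft l h * ((1 : D) ⊗ₜ[F] l) = (a • h.val 1 0) ⊗ₜ 1 + h.val 0 0 ⊗ₜ l := by
    rw [bottomLeft, add_mul, Algebra.TensorProduct.tmul_mul_tmul, Algebra.TensorProduct.tmul_mul_tmul,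
      mul_one, mul_one, one_mul, ← sq, ← ha, Algebra.algebraMap_eq_smul_one, TensorProduct.tmul_smul,
      TensorProduct.smul_tmul', add_comm]
  rw [this, bottomRight]
  constructor
  · exact fun h => tmul_add_tmul_inj hE hl h
  · rintro ⟨h1, h2⟩
    rw [h1, h2]

variable [ValuativeRel F] [TopologicalSpace F] [IsNonarchimedeanLocalField F]
  [FiniteDimensional F D] [FiniteDimensional F E]

omit [ValuativeRel F] [TopologicalSpace F] [IsNonarchimedeanLocalField F] in
include hE in
/-- Every coset has a representative with rows `(1, x)` and `(0, y)`. -/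
theorem exists_eq_mul_upperUnit (h : GL2 D) :
    ∃ t ∈ stabilizerH D (uZero D h2 hl), ∃ x y, h = t * upperUnit x y := by
  have hc : bottomLeft (F := F) l h ≠ 0 := by
    intro h0
    have : h.val 0 0 ⊗ₜ[F] (1 : E) + h.val 1 0 ⊗ₜ l = 0 ⊗ₜ 1 + 0 ⊗ₜ l := by
      rw [TensorProduct.zero_tmul, TensorProduct.zero_tmul, add_zero]; exact h0
    obtain ⟨h1, h3⟩ := tmul_add_tmul_inj hE hl this
    have h4 : (h⁻¹ * h).val 0 0 = 1 := by simp
    rw [Units.val_mul, Matrix.mul_apply, Fin.sum_univ_two, h1, h3] at h4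
    simp at h4
  obtain ⟨c, hc'⟩ := isUnit_of_ne_zero F hc
  obtain ⟨x, y, hxy⟩ := exists_eq_tmul_add_tmul hE hl ((↑c⁻¹ : D ⊗[F] E) * bottomRight (F := F) l h)
  have he : bottomRight (F := F) l h = bottomLeft l h * (x ⊗ₜ 1 + y ⊗ₜ l) := by
    rw [← hxy, ← hc', Units.mul_inv_cancel_left]
  have hy : y ≠ 0 := by
    rintro rfl
    rw [TensorProduct.zero_tmul, add_zero, bottomLeft, add_mul, Algebra.TensorProduct.tmul_mul_tmul,
      Algebra.TensorProduct.tmul_mul_tmul, mul_one, mul_one] at he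
    obtain ⟨h1, h3⟩ := tmul_add_tmul_inj hE hl he
    -- If y = 0, the second column of h is the first one times x, so the invertible h would kill the
    -- column (-x, 1).
    have h4 : h.val * !![-x, 0; 1, 0] = 0 := by
      ext i j
      fin_cases i <;> fin_cases j <;> simp [Matrix.mul_apply, Fin.sum_univ_two, h1, h3]
    have h5 := congrArg (fun M => h⁻¹.val * M) h4
    simp only [← mul_assoc, Units.inv_mul, one_mul, mul_zero] at h5
    have h6 := congrFun (congrFun h5 1) 0
    simp at h6
  refine ⟨h * (upperUnit x (Units.mk0 y hy))⁻¹, ?_, x, Units.mk0 y hy, by group⟩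
  rw [mem_stabilizerH_iff_bottom, bottomLeft_mul, bottomRight_mul, upperUnit_inv_val, he]
  have hyi : y ⊗ₜ[F] l * (↑(Units.mk0 y hy)⁻¹ : D) ⊗ₜ[F] (1 : E) = 1 ⊗ₜ l := by
    rw [Algebra.TensorProduct.tmul_mul_tmul, mul_one]
    simp [hy]
  simp only [Matrix.of_apply, Matrix.cons_val', Matrix.cons_val_zero, Matrix.cons_val_one,
      Matrix.cons_val_fin_one, TensorProduct.zero_tmul, mul_zero, add_zero]
  rw [mul_assoc, add_mul, hyi, Algebra.TensorProduct.tmul_mul_tmul, mul_one, ← mul_add,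
    ← Algebra.TensorProduct.one_def, mul_one, TensorProduct.neg_tmul, neg_add_cancel_left]

include hE in
omit [ValuativeRel F] [TopologicalSpace F] [IsNonarchimedeanLocalField F]
  [FiniteDimensional F D] [FiniteDimensional F E] in
theorem upperUnit_mem_stabilizerH (hl2 : l ^ 2 ∈ Set.range (algebraMap F E)) {x : D} {y : Dˣ}
    (h : upperUnit x y ∈ stabilizerH D (uZero D h2 hl)) : x = 0 ∧ y = 1 := by
  obtain ⟨a, ha⟩ := hl2
  rw [mem_stabilizerH_iff h2 hl hE ha, upperUnit_val] at h
  simpa using h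

variable (F) in
/-- The conjugation of `D ⊗ E` over `D`. -/
def tensorConj (D : Type*) [DivisionRing D] [Algebra F D] (hE : Module.finrank F E = 2) {l : E}
    (hl : l ∉ Set.range (algebraMap F E))
    (hl2 : l ^ 2 ∈ Set.range (algebraMap F E)) : D ⊗[F] E ≃ₐ[F] D ⊗[F] E :=
  Algebra.TensorProduct.congr AlgEquiv.refl (quadConj hE hl hl2)

omit [ValuativeRel F] [TopologicalSpace F] [IsNonarchimedeanLocalField F]
  [FiniteDimensional F D] [FiniteDimensional F E] [IsDomain (D ⊗[F] E)] in
theorem tensorConj_apply (hl2 : l ^ 2 ∈ Set.range (algebraMap F E)) (x y : D) :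
    tensorConj F D hE hl hl2 (x ⊗ₜ 1 + y ⊗ₜ l) = x ⊗ₜ 1 - y ⊗ₜ l := by
  simp [tensorConj, quadConj_gen, sub_eq_add_neg, TensorProduct.tmul_neg]

-- Conjugation τ of D ⊗ E over D fixes the entries of t and swaps the rows of u₀, so p = u₀ t u₀⁻¹
-- satisfies τ(p) W = W p. Hence its diagonal entries are conjugate and have the same absolute
-- value.
include hE in
theorem modulus_conj_eq_one (hl2 : l ^ 2 ∈ Set.range (algebraMap F E)) {t : GL2 D}
    (ht : t ∈ stabilizerH D (uZero D h2 hl)) :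
    modulus F (uZero D h2 hl * embH F E D t * (uZero D h2 hl)⁻¹) = 1 := by
  set u := uZero D h2 hl
  set p := u * embH F E D t * u⁻¹ with hp
  have hpB : p ∈ borelSubgroup (D ⊗[F] E) := ht
  have hpu : p.val * u.val = u.val * (embH F E D t).val := by
    rw [← Units.val_mul, ← Units.val_mul, hp]; congr 1; group
  set τ := (tensorConj F D hE hl hl2).toAlgHom.toRingHom.mapMatrix (m := Fin 2)
  let W : Matrix (Fin 2) (Fin 2) (D ⊗[F] E) := !![0, 1; 1, 0]
  have hτu : τ u.val = W * u.val := by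
    have h1 : tensorConj F D hE hl hl2 ((1 : D) ⊗ₜ l) = -((1 : D) ⊗ₜ l) := by
      have := tensorConj_apply hl hE hl2 (0 : D) 1
      simpa using this
    rw [uZero_val]
    ext i j
    fin_cases i <;> fin_cases j <;> simp [τ, W, h1, Matrix.mul_apply, Fin.sum_univ_two]
  have hτt : τ (embH F E D t).val = (embH F E D t).val := by
    ext i j
    have := tensorConj_apply hl hE hl2 (t.val i j) 0
    simpa [τ, embH_val] using this
  have h1 : τ p.val * W = W * p.val := by
    have h3 := congrArg τ hpu
    rw [map_mul, map_mul, hτu, hτt, mul_assoc W, ← hpu, ← mul_assoc, ← mul_assoc] at h3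
    have h4 := congrArg (fun M => M * u⁻¹.val) h3
    simpa [mul_assoc] using h4
  have h3 : tensorConj F D hE hl hl2 (p.val 0 0) = p.val 1 1 := by
    have := congrFun (congrFun h1 0) 1
    simpa [W, τ, Matrix.mul_apply, Fin.sum_univ_two] using this
  rw [modulus_eq, ← algAbs_algEquiv F (tensorConj F D hE hl hl2) (p.val 0 0), h3, ← algAbs_mul,
    ← borel_mul_apply_one hpB, mul_inv_cancel]
  simp [algAbs_one]

include hE in
theorem periodIntegrand_mul (hl2 : l ^ 2 ∈ Set.range (algebraMap F E)) (s : ℂ) {t : GL2 D}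
    (ht : t ∈ stabilizerH D (uZero D h2 hl)) (h : GL2 D) :
    periodIntegrand D (uZero D h2 hl) s (t * h) = periodIntegrand D (uZero D h2 hl) s h := by
  have hpB : uZero D h2 hl * embH F E D t * (uZero D h2 hl)⁻¹ ∈ borelSubgroup (D ⊗[F] E) := ht
  have := sphericalSection_mul (F := F) s hpB (one_mem_maxCompact F)
    (uZero D h2 hl * embH F E D h)
  rw [modulus_conj_eq_one h2 hl hE hl2 ht, Complex.ofReal_one, Complex.one_cpow, one_mul] at this
  rw [periodIntegrand, periodIntegrand, ← this, map_mul]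
  congr 1
  group

theorem periodIntegrand_upperUnit (s : ℂ) (x : D) (y : Dˣ) :
    periodIntegrand D (uZero D h2 hl) s (upperUnit x y) =
      ((algAbs F ((2 * y : D) ⊗ₜ[F] l) /
        max 1 (algAbs F (x ⊗ₜ[F] (1 : E) + (y : D) ⊗ₜ l)) ^ 2 : ℝ) : ℂ) ^ s := by
  rw [periodIntegrand, sphericalSection_rows s (v := x ⊗ₜ[F] (1 : E) - (y : D) ⊗ₜ l)
    (w := x ⊗ₜ[F] (1 : E) + (y : D) ⊗ₜ l)]
  · rw [← algAbs_neg]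
    congr 6
    rw [two_mul, TensorProduct.add_tmul]
    abel
  · rw [uZero_mul_embH_val, bottomLeft, bottomRight, upperUnit_val]
    simp [Algebra.TensorProduct.one_def]

end Stabilizer


/-! ### Topology of `D` and `GL(2, D)` -/

section Topology

variable (F : Type*) [Field F] [ValuativeRel F] [TopologicalSpace F]
  [IsNonarchimedeanLocalField F]

theorem t2Space_localField : T2Space F := by
  let := IsTopologicalAddGroup.rightUniformSpace F
  have := isUniformAddGroup_of_addCommGroup (G := F)
  infer_instance

theorem isCompact_absF_le (r : ℝ) : IsCompact {x : F | absF F x ≤ r} := by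
  obtain ⟨c, hc0, hc⟩ := exists_lt_absF (F := F) r
  have h1 : IsCompact ((fun x : F => c * x) '' {x : F | absF F x ≤ 1}) :=
    isCompact_absF_le_one.image (by fun_prop)
  refine h1.of_isClosed_subset (isClosed_le continuous_absF continuous_const) fun x hx => ?_
  refine ⟨c⁻¹ * x, ?_, mul_inv_cancel_left₀ hc0 x⟩
  change absF F (c⁻¹ * x) ≤ 1
  rw [absF_mul, absF_inv, inv_mul_le_iff₀ (absF_pos hc0), mul_one]
  exact le_trans hx hc.le

variable {D : Type*} [Ring D] [Algebra F D] [IsDomain D] [FiniteDimensional F D]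
  [TopologicalSpace D] [IsModuleTopology F D]

variable (D) in
/-- Coordinates on a finite-dimensional space with the module topology. -/
def coordEquiv : D ≃L[F] (Fin (Module.finrank F D) → F) :=
  have := IsModuleTopology.topologicalAddGroup F D
  { (Module.finBasis F D).equivFun with
    continuous_toFun := IsModuleTopology.continuous_of_linearMap (R := F)
      (Module.finBasis F D).equivFun.toLinearMap
    continuous_invFun := IsModuleTopology.continuous_of_linearMap (R := F)
      (Module.finBasis F D).equivFun.symm.toLinearMap }

variable (D) in
include F in
theorem t2Space_of_isModuleTopology : T2Space D := by
  have := t2Space_localField F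
  exact (coordEquiv F D).toHomeomorph.isEmbedding.t2Space

variable (D) in
include F in
theorem locallyCompactSpace_of_isModuleTopology : LocallyCompactSpace D :=
  (coordEquiv F D).toHomeomorph.isClosedEmbedding.locallyCompactSpace

theorem continuous_algAbs : Continuous fun x : D => algAbs F x := by
  have h := (continuous_algAbs_coord F (A := D)).comp (coordEquiv F D).continuous
  refine h.congr fun x => ?_
  change algAbs F ((Module.finBasis F D).equivFun.symm ((Module.finBasis F D).equivFun x)) = _
  rw [LinearEquiv.symm_apply_apply]

theorem isCompact_algAbs_le (r : ℝ) : IsCompact {x : D | algAbs F x ≤ r} := by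
  obtain ⟨c, hc0, hc⟩ := exists_coordBounded_of_algAbs_le F (A := D)
  obtain ⟨b, hb0, hb⟩ := exists_lt_absF (F := F) (max 1 r)
  have hK : IsCompact (Set.univ.pi fun _ : Fin (Module.finrank F D) =>
      {x : F | absF F x ≤ absF F b * absF F c}) :=
    isCompact_univ_pi fun _ => isCompact_absF_le F _
  refine (hK.image (coordEquiv F D).symm.continuous).of_isClosed_subset
    (isClosed_le (continuous_algAbs F) continuous_const) fun x hx => ?_
  refine ⟨coordEquiv F D x, fun i _ => ?_, (coordEquiv F D).symm_apply_apply x⟩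
  have h1 : algAbs F (b⁻¹ • x) ≤ 1 := by
    rw [algAbs_smul, absF_inv, inv_pow, inv_mul_le_iff₀ (pow_pos (absF_pos hb0) _), mul_one]
    refine (le_trans hx ((le_max_right 1 r).trans hb.le)).trans (le_self_pow₀ ?_ ?_)
    · exact (le_max_left 1 r).trans hb.le
    · exact Module.finrank_pos.ne'
  have h2 := hc _ h1 i
  rw [map_smul, Finsupp.smul_apply, smul_eq_mul, absF_mul, absF_inv,
    inv_mul_le_iff₀ (absF_pos hb0)] at h2
  simpa [coordEquiv] using h2

variable [IsTopologicalRing D] [T2Space D]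

/-- The inverse must be bounded as well, since the topology of the unit group is induced from the
pair (g, g⁻¹). -/
theorem isCompact_of_entries_le {S : Set (GL2 D)} (hS : IsClosed S) (r : ℝ)
    (hr : ∀ g ∈ S, ∀ i j, algAbs F (g.val i j) ≤ r ∧ algAbs F (g⁻¹.val i j) ≤ r) :
    IsCompact S := by
  have hK : IsCompact {M : Matrix (Fin 2) (Fin 2) D | ∀ i j, algAbs F (M i j) ≤ r} := by
    have : IsCompact (Set.univ.pi fun _ : Fin 2 => Set.univ.pi fun _ : Fin 2 =>
        {x : D | algAbs F x ≤ r}) :=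
      isCompact_univ_pi fun _ => isCompact_univ_pi fun _ => isCompact_algAbs_le F r
    have h : {M : Matrix (Fin 2) (Fin 2) D | ∀ i j, algAbs F (M i j) ≤ r} =
        Set.univ.pi fun _ : Fin 2 => Set.univ.pi fun _ : Fin 2 => {x : D | algAbs F x ≤ r} :=
      Set.ext fun M =>
        ⟨fun h i _ j _ => h i j, fun h i j => h i trivial j trivial⟩
    exact h ▸ this
  refine (Units.isClosedEmbedding_embedProduct.isCompact_preimage
    (hK.prod (MulOpposite.opHomeomorph.isCompact_image.2 hK))).of_isClosed_subset hS fun g hg => ?_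
  exact ⟨fun i j => (hr g hg i j).1, g⁻¹.val, fun i j => (hr g hg i j).2, rfl⟩

omit [IsDomain D] [IsTopologicalRing D] [T2Space D] in
theorem continuous_entry (i j : Fin 2) : Continuous fun g : GL2 D => g.val i j :=
  Units.continuous_val.matrix_elem i j

omit [IsDomain D] [T2Space D] in
theorem continuous_inv_entry (i j : Fin 2) : Continuous fun g : GL2 D => g⁻¹.val i j :=
  (continuous_entry i j).comp continuous_inv

end Topology

/-! ### The quotient space -/

section QuotientTopology

open scoped Pointwise

variable {H : Type*} [Group H] {T : Subgroup H}

/-- The projection to the space of cosets. -/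
def RightCosets.mk (T : Subgroup H) (h : H) : RightCosets T := Quotient.mk _ h

theorem RightCosets.mk_eq {a b : H} : mk T a = mk T b ↔ b * a⁻¹ ∈ T :=
  Quotient.eq.trans QuotientGroup.rightRel_apply

theorem RightCosets.mk_rep (x : RightCosets T) : mk T x.rep = x := Quotient.out_eq x

theorem RightCosets.mk_surjective : Function.Surjective (mk T) := Quotient.mk_surjective

theorem RightCosets.translate_mk (g h : H) : translate g (mk T h) = mk T (h * g) := rfl

theorem RightCosets.exists_rep_eq (h : H) : ∃ t ∈ T, (mk T h).rep = t * h := by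
  have := mk_eq.1 (mk_rep (mk T h)).symm
  exact ⟨_, this, by group⟩

theorem RightCosets.preimage_image_mk (S : Set H) : mk T ⁻¹' (mk T '' S) = (T : Set H) * S := by
  ext h
  simp only [Set.mem_preimage, Set.mem_image, Set.mem_mul, SetLike.mem_coe, mk_eq]
  constructor
  · rintro ⟨g, hg, h1⟩
    exact ⟨_, h1, g, hg, by group⟩
  · rintro ⟨t, ht, g, hg, rfl⟩
    exact ⟨g, hg, by simpa using ht⟩

variable [TopologicalSpace H]

theorem RightCosets.continuous_mk : Continuous (mk T) := continuous_quotient_mk'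

theorem RightCosets.isOpen_iff {S : Set (RightCosets T)} : IsOpen S ↔ IsOpen (mk T ⁻¹' S) := Iff.rfl

variable [IsTopologicalGroup H]

theorem RightCosets.isOpenMap_mk : IsOpenMap (mk T) := by
  intro U hU
  rw [isOpen_iff, preimage_image_mk]
  exact hU.mul_left

theorem RightCosets.isClosed_image_mk (hT : IsClosed (T : Set H)) {C : Set H} (hC : IsCompact C) :
    IsClosed (mk T '' C) := by
  rw [← isOpen_compl_iff, isOpen_iff, Set.preimage_compl, isOpen_compl_iff, preimage_image_mk]
  exact hT.mul_right_of_isCompact hC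

theorem RightCosets.continuous_translate (g : H) : Continuous (translate (T := T) g) :=
  Continuous.quotient_map' (continuous_mul_const g) _

theorem RightCosets.exists_isCompact_image [LocallyCompactSpace H] {C : Set (RightCosets T)}
    (hC : IsCompact C) : ∃ N : Set H, IsCompact N ∧ C ⊆ mk T '' N := by
  choose K hK hmem using fun h : H => exists_compact_mem_nhds h
  obtain ⟨I, hI⟩ := hC.elim_finite_subcover (fun h : H => mk T '' interior (K h))
    (fun h => isOpenMap_mk _ isOpen_interior) fun x _ => by
      obtain ⟨h, rfl⟩ := mk_surjective x
      exact Set.mem_iUnion.2 ⟨h, h, mem_interior_iff_mem_nhds.2 (hmem h), rfl⟩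
  refine ⟨⋃ h ∈ I, K h, I.isCompact_biUnion fun h _ => hK h, hI.trans ?_⟩
  rw [Set.image_iUnion₂]
  exact Set.iUnion₂_mono fun h _ => Set.image_mono interior_subset

/-- If `T` is compact modulo a central subgroup, then `T \ H` carries an invariant measure. -/
theorem exists_isInvariantQuotientMeasure [LocallyCompactSpace H] (hTc : IsClosed (T : Set H))
    (Z : Subgroup H) [Z.Normal] (hZT : Z ≤ T) {T₀ : Set H} (hT₀ : IsCompact T₀) (hT : ∀ t ∈ T, ∃ z ∈ Z, z * t ∈ T₀) :
    ∃ μ : Measure (RightCosets T), IsInvariantQuotientMeasure μ := by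
  let : MeasurableSpace (H ⧸ Z) := borel _
  have : BorelSpace (H ⧸ Z) := ⟨rfl⟩
  -- Inversion turns left translation on H ⧸ Z into right translation on T \ H, so left Haar measure
  -- pushes forward to an invariant measure.
  let f : H ⧸ Z → RightCosets T := Quotient.lift (fun h : H => RightCosets.mk T h⁻¹) fun a b hab => by
    rw [RightCosets.mk_eq]
    simpa using inv_mem (hZT (QuotientGroup.leftRel_apply.1 hab))
  have hf : ∀ h : H, f (QuotientGroup.mk h) = RightCosets.mk T h⁻¹ := fun h => rfl
  have hfc : Continuous f := (RightCosets.continuous_mk.comp continuous_inv).quotient_lift _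
  let m : Measure (H ⧸ Z) := Measure.haar
  refine ⟨m.map f, ?_, fun C hC => ?_, fun g => ?_⟩
  · rw [Ne, Measure.map_eq_zero_iff hfc.aemeasurable]
    exact NeZero.ne m
  · obtain ⟨N, hN, hCN⟩ := RightCosets.exists_isCompact_image hC
    refine (measure_mono hCN).trans_lt ?_
    rw [Measure.map_apply hfc.measurable (RightCosets.isClosed_image_mk hTc hN).measurableSet]
    have hK : IsCompact ((QuotientGroup.mk : H → H ⧸ Z) '' (N⁻¹ * T₀)) :=
      (hN.inv.mul hT₀).image continuous_quotient_mk'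
    refine (measure_mono fun x hx => ?_).trans_lt hK.measure_lt_top
    obtain ⟨h, rfl⟩ := QuotientGroup.mk_surjective x
    obtain ⟨n, hn, h1⟩ := hx
    rw [hf, RightCosets.mk_eq] at h1
    -- The preimage of the image of N is contained in N⁻¹ T₀ modulo Z, which is compact because T is
    -- compact modulo Z; this gives finiteness on compact sets.
    obtain ⟨z, hz, h2⟩ := hT _ (inv_mem h1)
    refine ⟨n⁻¹ * (z * (h⁻¹ * n⁻¹)⁻¹), Set.mul_mem_mul (Set.inv_mem_inv.2 hn) h2, ?_⟩
    have hz1 : (QuotientGroup.mk z : H ⧸ Z) = 1 := (QuotientGroup.eq_one_iff z).2 hz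
    rw [QuotientGroup.mk_mul, QuotientGroup.mk_mul, hz1, one_mul, ← QuotientGroup.mk_mul]
    congr 1
    group
  · rw [Measure.map_map (RightCosets.continuous_translate g).measurable hfc.measurable]
    have : RightCosets.translate g ∘ f = f ∘ fun x => (QuotientGroup.mk g⁻¹ : H ⧸ Z) * x := by
      funext x
      obtain ⟨h, rfl⟩ := QuotientGroup.mk_surjective x
      simp only [Function.comp_apply, ← QuotientGroup.mk_mul, hf, RightCosets.translate_mk,
        mul_inv_rev, inv_inv]
    rw [this, ← Measure.map_map hfc.measurable (measurable_const_mul _), map_mul_left_eq_self]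

end QuotientTopology


/-! ### Existence of the invariant measure -/

section Existence

variable {F E : Type*} [Field F] [Field E] [Algebra F E] {D : Type*} [DivisionRing D]
  [Algebra F D] (h2 : (2 : F) ≠ 0) {l : E} (hl : l ∉ Set.range (algebraMap F E))
  (hl2 : l ^ 2 ∈ Set.range (algebraMap F E)) (hE : Module.finrank F E = 2)

variable (D) in
/-- The scalar matrices. -/
def scalarUnit : Fˣ →* GL2 D := Units.map (algebraMap F (Matrix (Fin 2) (Fin 2) D)).toMonoidHom

theorem scalarUnit_mul_apply (c : Fˣ) (h : GL2 D) (i j : Fin 2) :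
    (scalarUnit D c * h).val i j = (c : F) • h.val i j := by
  change (algebraMap F (Matrix (Fin 2) (Fin 2) D) c * h.val) i j = _
  rw [← Algebra.smul_def]
  rfl

theorem scalarUnit_mul_comm (c : Fˣ) (h : GL2 D) : scalarUnit D c * h = h * scalarUnit D c :=
  Units.ext (Algebra.commutes (c : F) h.val)

theorem bottomLeft_scalarUnit_mul (c : Fˣ) (h : GL2 D) :
    bottomLeft (F := F) l (scalarUnit D c * h) = (c : F) • bottomLeft l h := by
  rw [bottomLeft, bottomLeft, scalarUnit_mul_apply, scalarUnit_mul_apply, smul_add,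
    TensorProduct.smul_tmul', TensorProduct.smul_tmul']

variable [IsDomain (D ⊗[F] E)]

include hE hl2 in
theorem scalarUnit_mem_stabilizerH (c : Fˣ) : scalarUnit D c ∈ stabilizerH D (uZero D h2 hl) := by
  obtain ⟨a, ha⟩ := hl2
  rw [mem_stabilizerH_iff h2 hl hE ha, ← mul_one (scalarUnit D c)]
  simp only [scalarUnit_mul_apply]
  simp

theorem bottomLeft_mul_of_mem {t : GL2 D} (ht : t ∈ stabilizerH D (uZero D h2 hl)) (h : GL2 D) :
    bottomLeft (F := F) l (t * h) = bottomLeft l t * bottomLeft l h := by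
  rw [bottomLeft_mul, (mem_stabilizerH_iff_bottom h2 hl).1 ht, mul_assoc, ← mul_add,
    Algebra.TensorProduct.tmul_mul_tmul, one_mul, mul_one]
  rfl

variable [ValuativeRel F] [TopologicalSpace F] [IsNonarchimedeanLocalField F]
  [FiniteDimensional F D] [FiniteDimensional F E]

-- With w = t₀₀ + t₁₀ l and its conjugate, which has the same absolute value, 2 t₀₀ and 2 t₁₀ l are
-- their sum and difference; so |w| controls all entries of t.
include hE hl2 in
theorem exists_entries_le {d : ℕ} (hD : Module.finrank F D = d ^ 2) (B : ℝ) : ∃ r : ℝ,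
    ∀ t ∈ stabilizerH D (uZero D h2 hl), algAbs F (bottomLeft (F := F) l t) ≤ B →
      ∀ i j, algAbs F (t.val i j) ≤ r := by
  have hl0 : l ≠ 0 := by
    rintro rfl
    exact hl ⟨0, map_zero _⟩
  obtain ⟨a, ha⟩ := hl2
  have h20 : algAbs F (2 : D ⊗[F] E) ≠ 0 := by
    have : IsUnit (algebraMap F (D ⊗[F] E) 2) := (isUnit_iff_ne_zero.2 h2).map _
    rw [map_ofNat] at this
    exact (algAbs_pos F this.ne_zero).ne'
  set c₂ := algAbs F (2 : D ⊗[F] E)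
  set cl := algAbs F l ^ (d ^ 2)
  have hcl : 0 < cl := pow_pos (algAbs_pos F hl0) _
  have hc₂ : 0 < c₂ := lt_of_le_of_ne (algAbs_nonneg F _) (Ne.symm h20)
  have hsq : ∀ x : D, ∀ R : ℝ, algAbs F x ^ 2 ≤ R → algAbs F x ≤ max 1 R := by
    intro x R h
    rcases le_or_gt (algAbs F x) 1 with h1 | h1
    · exact h1.trans (le_max_left _ _)
    · exact ((le_self_pow₀ h1.le two_ne_zero).trans h).trans (le_max_right _ _)
  set r₀ := max 1 (c₂⁻¹ * B)
  set r₁ := max 1 (c₂⁻¹ * B * cl⁻¹)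
  set r₂ := absF F a ^ (d ^ 2) * r₁
  refine ⟨max r₀ (max r₁ r₂), fun t ht hB => ?_⟩
  set w := bottomLeft (F := F) l t with hw
  have hτw : algAbs F (t.val 0 0 ⊗ₜ[F] (1 : E) - t.val 1 0 ⊗ₜ l) ≤ B := by
    rw [← tensorConj_apply hl hE ⟨a, ha⟩, algAbs_algEquiv]
    exact hB
  have h0 : algAbs F (t.val 0 0) ≤ r₀ := by
    refine hsq _ _ ?_
    rw [← algAbs_tmul_one hE hD, le_inv_mul_iff₀ hc₂, ← algAbs_mul]
    have : 2 * t.val 0 0 ⊗ₜ[F] (1 : E) = w + (t.val 0 0 ⊗ₜ[F] (1 : E) - t.val 1 0 ⊗ₜ l) := by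
      rw [hw, bottomLeft, two_mul]; abel
    rw [this]
    exact (algAbs_add_le F _ _).trans (max_le hB hτw)
  have h1 : algAbs F (t.val 1 0) ≤ r₁ := by
    refine hsq _ _ ?_
    rw [← div_eq_mul_inv, le_div_iff₀ hcl, ← algAbs_tmul hE hD, le_inv_mul_iff₀ hc₂, ← algAbs_mul]
    have : 2 * t.val 1 0 ⊗ₜ[F] l = w - (t.val 0 0 ⊗ₜ[F] (1 : E) - t.val 1 0 ⊗ₜ l) := by
      rw [hw, bottomLeft, two_mul]; abel
    rw [this]
    exact (algAbs_sub_le F _ _).trans (max_le hB hτw)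
  obtain ⟨e1, e2⟩ := (mem_stabilizerH_iff h2 hl hE ha).1 ht
  intro i j
  fin_cases i <;> fin_cases j <;> simp only [Fin.zero_eta, Fin.mk_one, Fin.isValue]
  · exact h0.trans (le_max_left _ _)
  · rw [e1, algAbs_smul, hD]
    exact (mul_le_mul_of_nonneg_left h1 (pow_nonneg (absF_nonneg _) _)).trans
      ((le_max_right _ _).trans (le_max_right _ _))
  · exact h1.trans ((le_max_left _ _).trans (le_max_right _ _))
  · rw [e2]
    exact h0.trans (le_max_left _ _)

variable [TopologicalSpace D] [IsModuleTopology F D] [IsTopologicalRing D] [T2Space D]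

omit [ValuativeRel F] [TopologicalSpace F] [IsNonarchimedeanLocalField F] [FiniteDimensional F D]
  [FiniteDimensional F E] [IsModuleTopology F D] in
include hE hl2 in
theorem isClosed_stabilizerH : IsClosed (stabilizerH D (uZero D h2 hl) : Set (GL2 D)) := by
  obtain ⟨a, ha⟩ := hl2
  have : (stabilizerH D (uZero D h2 hl) : Set (GL2 D)) =
      {h | h.val 0 1 = a • h.val 1 0} ∩ {h | h.val 1 1 = h.val 0 0} :=
    Set.ext fun h => mem_stabilizerH_iff h2 hl hE ha
  rw [this]
  exact (isClosed_eq (continuous_entry 0 1) ((continuous_entry 1 0).const_smul a)).inter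
    (isClosed_eq (continuous_entry 1 1) (continuous_entry 0 0))

-- T modulo the scalars of F is compact: `bottomLeft` is multiplicative on T, a scalar brings its
-- absolute value into a bounded interval, and then the entries of t and t⁻¹ are bounded.
include hE hl2 in
theorem exists_invariant_measure {d : ℕ} (hD : Module.finrank F D = d ^ 2)
    [LocallyCompactSpace D] :
    ∃ μ : Measure (RightCosets (stabilizerH D (uZero D h2 hl))), IsInvariantQuotientMeasure μ := by
  set T := stabilizerH D (uZero D h2 hl)
  have hTc : IsClosed (T : Set (GL2 D)) := isClosed_stabilizerH h2 hl hl2 hE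
  have : LocallyCompactSpace (Matrix (Fin 2) (Fin 2) D) :=
    inferInstanceAs (LocallyCompactSpace (Fin 2 → Fin 2 → D))
  set Z : Subgroup (GL2 D) := (scalarUnit (F := F) D).range
  have : Z.Normal := ⟨by
    rintro _ ⟨c, rfl⟩ g
    rw [← scalarUnit_mul_comm, mul_inv_cancel_right]
    exact ⟨c, rfl⟩⟩
  have hq := one_lt_residueCard_real F
  set N := Module.finrank F (D ⊗[F] E) with hN
  have hN0 : N ≠ 0 := Module.finrank_pos.ne'
  set B := (residueCard F : ℝ) ^ N
  have hB : 1 < B := one_lt_pow₀ hq hN0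
  obtain ⟨r, hr⟩ := exists_entries_le h2 hl hl2 hE hD B
  let T₀ : Set (GL2 D) := (T : Set (GL2 D)) ∩
    ⋂ i, ⋂ j, ({t | algAbs F (t.val i j) ≤ r} ∩ {t | algAbs F (t⁻¹.val i j) ≤ r})
  have hT₀ : IsCompact T₀ := by
    refine isCompact_of_entries_le F (hTc.inter (isClosed_iInter fun i => isClosed_iInter fun j =>
      ?_)) r fun g hg i j => ?_
    · exact (isClosed_le ((continuous_algAbs F).comp (continuous_entry i j)) continuous_const).inter
        (isClosed_le ((continuous_algAbs F).comp (continuous_inv_entry i j)) continuous_const)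
    · exact Set.mem_iInter.1 (Set.mem_iInter.1 hg.2 i) j
  refine exists_isInvariantQuotientMeasure hTc Z ?_ hT₀ fun t ht => ?_
  · rintro _ ⟨c, rfl⟩
    exact scalarUnit_mem_stabilizerH h2 hl hl2 hE c
  have hinv : ∀ t ∈ T, algAbs F (bottomLeft (F := F) l t) * algAbs F (bottomLeft (F := F) l t⁻¹) = 1 := by
    intro t ht
    rw [← algAbs_mul, ← bottomLeft_mul_of_mem h2 hl ht, mul_inv_cancel, bottomLeft]
    simp [← Algebra.TensorProduct.one_def, algAbs_one]
  have hpos : 0 < algAbs F (bottomLeft (F := F) l t) := by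
    refine lt_of_le_of_ne (algAbs_nonneg F _) fun h => ?_
    have := hinv t ht
    rw [← h, zero_mul] at this
    exact zero_ne_one this
  -- B is the factor by which the uniformiser of F scales the absolute value of D ⊗ E, so a power of
  -- it moves |w| into [1, B).
  obtain ⟨n, hn1, hn2⟩ := exists_mem_Ico_zpow hpos hB
  set z := scalarUnit D (uniformiserUnit F ^ n)
  have hz : z ∈ T := scalarUnit_mem_stabilizerH h2 hl hl2 hE _
  have hzt : z * t ∈ T := mul_mem hz ht
  have habs : algAbs F (bottomLeft (F := F) l (z * t)) =
      (B ^ n)⁻¹ * algAbs F (bottomLeft (F := F) l t) := by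
    rw [bottomLeft_scalarUnit_mul, algAbs_smul, Units.val_zpow_eq_zpow_val, absF_zpow]
    congr 1
    change (absF F (uniformiser F : F) ^ n) ^ N = _
    rw [absF_uniformiser, inv_zpow, inv_pow, ← zpow_natCast, ← zpow_mul, mul_comm n, zpow_mul,
      zpow_natCast]
  have hBn : 0 < B ^ n := zpow_pos (zero_lt_one.trans hB) n
  have hlow : 1 ≤ algAbs F (bottomLeft (F := F) l (z * t)) := by
    rw [habs, le_inv_mul_iff₀ hBn, mul_one]
    exact hn1
  have hup : algAbs F (bottomLeft (F := F) l (z * t)) ≤ B := by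
    rw [habs, inv_mul_le_iff₀ hBn, ← zpow_add_one₀ (zero_lt_one.trans hB).ne']
    exact hn2.le
  have hup' : algAbs F (bottomLeft (F := F) l (z * t)⁻¹) ≤ B := by
    have h := hinv _ hzt
    rw [eq_inv_of_mul_eq_one_right h]
    exact (inv_le_one_of_one_le₀ hlow).trans hB.le
  refine ⟨z, ⟨_, rfl⟩, hzt, Set.mem_iInter.2 fun i => Set.mem_iInter.2 fun j => ⟨?_, ?_⟩⟩
  · exact hr _ hzt hup i j
  · exact hr _ (inv_mem hzt) hup' i j

end Existence


/-! ### Coordinates on the quotient and volumes -/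

section Coordinates

variable {F E : Type*} [Field F] [Field E] [Algebra F E] {D : Type*} [DivisionRing D]
  [Algebra F D] (h2 : (2 : F) ≠ 0) {l : E} (hl : l ∉ Set.range (algebraMap F E))
  (hl2 : l ^ 2 ∈ Set.range (algebraMap F E)) (hE : Module.finrank F E = 2)
  [IsDomain (D ⊗[F] E)] [FiniteDimensional F D] [FiniteDimensional F E]

variable (D) in
/-- The upper triangular matrices with upper left entry `1` represent the cosets. -/
def cosetEquiv : D × Dˣ ≃ RightCosets (stabilizerH D (uZero D h2 hl)) :=
  Equiv.ofBijective (fun a => RightCosets.mk _ (upperUnit a.1 a.2)) (by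
    constructor
    · rintro ⟨x, y⟩ ⟨x', y'⟩ h
      rw [RightCosets.mk_eq, upperUnit_inv, upperUnit_mul] at h
      obtain ⟨h1, h3⟩ := upperUnit_mem_stabilizerH h2 hl hE hl2 h
      obtain rfl : y' = y := by rwa [mul_inv_eq_one] at h3
      have h4 : (x' - x) * (↑y'⁻¹ : D) = 0 := by rw [sub_mul, sub_eq_neg_add]; exact h1
      rw [Units.mul_left_eq_zero, sub_eq_zero] at h4
      rw [h4]
    · intro c
      obtain ⟨h, rfl⟩ := RightCosets.mk_surjective c
      obtain ⟨t, ht, x, y, rfl⟩ := exists_eq_mul_upperUnit h2 hl hE h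
      exact ⟨(x, y), RightCosets.mk_eq.2 (by simpa using ht)⟩)

theorem cosetEquiv_apply (x : D) (y : Dˣ) :
    cosetEquiv D h2 hl hl2 hE (x, y) = RightCosets.mk _ (upperUnit x y) := rfl

theorem cosetEquiv_symm_translate (b : D) (c : Dˣ) (x) :
    (cosetEquiv D h2 hl hl2 hE).symm (RightCosets.translate (upperUnit b c) x) =
      (b + ((cosetEquiv D h2 hl hl2 hE).symm x).1 * c, ((cosetEquiv D h2 hl hl2 hE).symm x).2 * c) := by
  rw [Equiv.symm_apply_eq]
  obtain ⟨⟨u, v⟩, rfl⟩ := (cosetEquiv D h2 hl hl2 hE).surjective x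
  rw [Equiv.symm_apply_apply, cosetEquiv_apply, cosetEquiv_apply, RightCosets.translate_mk,
    upperUnit_mul]

/-- The first coordinate of a coset with respect to the basis `1, θ`, where `l = α + β θ`. -/
def coordU (α : F) (x : RightCosets (stabilizerH D (uZero D h2 hl))) : D :=
  ((cosetEquiv D h2 hl hl2 hE).symm x).1 + α • (((cosetEquiv D h2 hl hl2 hE).symm x).2 : D)

/-- The second coordinate of a coset with respect to the basis `1, θ`, where `l = α + β θ`. -/
def coordV (β : F) (x : RightCosets (stabilizerH D (uZero D h2 hl))) : D :=
  β • (((cosetEquiv D h2 hl hl2 hE).symm x).2 : D)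

variable {h2 hl hl2 hE} in
theorem coordV_ne_zero {β : F} (hβ : β ≠ 0) (x : RightCosets (stabilizerH D (uZero D h2 hl))) :
    coordV h2 hl hl2 hE β x ≠ 0 :=
  smul_ne_zero hβ (Units.ne_zero _)

theorem coordU_translate (α : F) (b : D) (c : Dˣ) (x) :
    coordU h2 hl hl2 hE α (RightCosets.translate (upperUnit b c) x) =
      b + coordU h2 hl hl2 hE α x * c := by
  rw [coordU, cosetEquiv_symm_translate, coordU, add_mul, smul_mul_assoc, Units.val_mul, add_assoc]

theorem coordV_translate (β : F) (b : D) (c : Dˣ) (x) :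
    coordV h2 hl hl2 hE β (RightCosets.translate (upperUnit b c) x) =
      coordV h2 hl hl2 hE β x * c := by
  rw [coordV, cosetEquiv_symm_translate, coordV, smul_mul_assoc, Units.val_mul]

variable [ValuativeRel F] [TopologicalSpace F] [IsNonarchimedeanLocalField F]

/-- The set of cosets whose coordinates have absolute values at most `r`, respectively equal
to `ρ`. -/
def labelSet (α β : F) (r ρ : ℝ) : Set (RightCosets (stabilizerH D (uZero D h2 hl))) :=
  {x | algAbs F (coordU h2 hl hl2 hE α x) ≤ r ∧ algAbs F (coordV h2 hl hl2 hE β x) = ρ}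

/-- The integrand in terms of the coordinates. -/
theorem periodIntegrand_rep {d : ℕ} (hD : Module.finrank F D = d ^ 2) {θ : E} {α β : F}
    (hβ : β ≠ 0) (hlθ : l = algebraMap F E α + algebraMap F E β * θ) (s : ℂ)
    (x : RightCosets (stabilizerH D (uZero D h2 hl))) :
    periodIntegrand D (uZero D h2 hl) s x.rep =
      ((algAbs F ((1 : D) ⊗ₜ[F] (algebraMap F E (2 * β⁻¹) * l)) *
        algAbs F (coordV h2 hl hl2 hE β x) ^ 2 /
        max 1 (algAbs F (coordU h2 hl hl2 hE α x ⊗ₜ[F] (1 : E) +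
          coordV h2 hl hl2 hE β x ⊗ₜ θ)) ^ 2 : ℝ) : ℂ) ^ s := by
  obtain ⟨⟨u, v⟩, rfl⟩ := (cosetEquiv D h2 hl hl2 hE).surjective x
  rw [coordU, coordV, Equiv.symm_apply_apply, cosetEquiv_apply]
  obtain ⟨t, ht, h⟩ := RightCosets.exists_rep_eq (T := stabilizerH D (uZero D h2 hl)) (upperUnit u v)
  rw [h, periodIntegrand_mul h2 hl hE hl2 s ht, periodIntegrand_upperUnit]
  have e1 : algAbs F ((2 * v : D) ⊗ₜ[F] l) =
      algAbs F ((1 : D) ⊗ₜ[F] (algebraMap F E (2 * β⁻¹) * l)) * algAbs F (β • (v : D)) ^ 2 := by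
    rw [← algAbs_tmul_one hE hD, ← algAbs_mul, Algebra.TensorProduct.tmul_mul_tmul, mul_one, one_mul,
      ← Algebra.smul_def, TensorProduct.tmul_smul, TensorProduct.smul_tmul', smul_smul, mul_assoc,
      inv_mul_cancel₀ hβ, mul_one]
    congr 2
    rw [Algebra.smul_def, map_ofNat]
  have e2 : u ⊗ₜ[F] (1 : E) + (v : D) ⊗ₜ l = (u + α • (v : D)) ⊗ₜ[F] (1 : E) + (β • (v : D)) ⊗ₜ θ := by
    rw [hlθ, TensorProduct.tmul_add, TensorProduct.add_tmul, Algebra.algebraMap_eq_smul_one,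
      ← Algebra.smul_def, TensorProduct.tmul_smul, TensorProduct.tmul_smul, TensorProduct.smul_tmul',
      TensorProduct.smul_tmul', add_assoc]
  rw [e1, e2]

variable [TopologicalSpace D] [IsModuleTopology F D] [IsTopologicalRing D] [T2Space D]

/-- Bounds on u = x + α y and the exact size of v = β y bound x, y and y⁻¹, hence the representative
and its inverse. Compactness yields both measurability and finite volume. -/
theorem exists_isCompact_labelSet (α : F) {β : F} (hβ : β ≠ 0) (r : ℝ) {ρ : ℝ} (hρ : 0 < ρ) :
    ∃ C : Set (GL2 D), IsCompact C ∧
      labelSet h2 hl hl2 hE α β r ρ = RightCosets.mk (stabilizerH D (uZero D h2 hl)) '' C := by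
  let C : Set (GL2 D) := ({h | h.val 0 0 = 1} ∩ {h | h.val 1 0 = 0}) ∩
    ({h | algAbs F (h.val 0 1 + α • h.val 1 1) ≤ r} ∩ {h | algAbs F (β • h.val 1 1) = ρ})
  have hC : ∀ h : GL2 D, h ∈ C → ∃ x y, h = upperUnit x y ∧ algAbs F (x + α • (y : D)) ≤ r ∧
      algAbs F (β • (y : D)) = ρ := by
    rintro h ⟨⟨h00, h10⟩, h01, h11⟩
    have hne : h.val 1 1 ≠ 0 := by
      intro h0
      have : algAbs F (β • h.val 1 1) = ρ := h11
      rw [h0, smul_zero, algAbs_zero] at this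
      exact hρ.ne this
    refine ⟨h.val 0 1, Units.mk0 _ hne, ?_, h01, h11⟩
    apply Units.ext
    rw [upperUnit_val, Units.val_mk0]
    conv_lhs => rw [Matrix.eta_fin_two h.val]
    rw [show h.val 0 0 = 1 from h00, show h.val 1 0 = 0 from h10]
  have hcl : IsClosed C := by
    refine ((isClosed_eq (continuous_entry 0 0) continuous_const).inter
      (isClosed_eq (continuous_entry 1 0) continuous_const)).inter
      ((isClosed_le ((continuous_algAbs F).comp ((continuous_entry 0 1).add
        ((continuous_entry 1 1).const_smul α))) continuous_const).inter
      (isClosed_eq ((continuous_algAbs F).comp ((continuous_entry 1 1).const_smul β))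
        continuous_const))
  set N := Module.finrank F D
  set B := absF F β ^ N with hB
  have hB0 : 0 < B := pow_pos (absF_pos hβ) _
  set ρy := B⁻¹ * ρ
  have hρy : 0 < ρy := mul_pos (inv_pos.2 hB0) hρ
  set rx := max r (absF F α ^ N * ρy)
  have hbound : ∀ x : D, ∀ y : Dˣ, algAbs F (x + α • (y : D)) ≤ r → algAbs F (β • (y : D)) = ρ →
      algAbs F (y : D) = ρy ∧ algAbs F x ≤ rx := by
    intro x y hx hy
    have h1 : algAbs F (y : D) = ρy := by
      rw [algAbs_smul] at hy
      rw [eq_inv_mul_iff_mul_eq₀ hB0.ne']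
      exact hy
    refine ⟨h1, ?_⟩
    have : x = (x + α • (y : D)) - α • (y : D) := by abel
    rw [this]
    refine (algAbs_sub_le F _ _).trans (max_le_max hx ?_)
    rw [algAbs_smul, h1]
  have hrx : 0 ≤ rx := le_max_of_le_right (mul_nonneg (pow_nonneg (absF_nonneg _) _) hρy.le)
  refine ⟨C, isCompact_of_entries_le F hcl (1 + rx + ρy + ρy⁻¹ + rx * ρy⁻¹) fun g hg i j => ?_, ?_⟩
  · obtain ⟨x, y, rfl, hx, hy⟩ := hC g hg
    obtain ⟨hy', hx'⟩ := hbound x y hx hy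
    have hi := (inv_pos.2 hρy)
    have hxi : algAbs F x * ρy⁻¹ ≤ rx * ρy⁻¹ := mul_le_mul_of_nonneg_right hx' hi.le
    have hri : 0 ≤ rx * ρy⁻¹ := mul_nonneg hrx hi.le
    rw [upperUnit_val, upperUnit_inv_val]
    fin_cases i <;> fin_cases j <;>
      simp only [Fin.zero_eta, Fin.mk_one, Fin.isValue, Matrix.of_apply, Matrix.cons_val',
        Matrix.cons_val_zero, Matrix.cons_val_one, Matrix.cons_val_fin_one, algAbs_one, algAbs_zero,
        algAbs_neg, algAbs_mul, algAbs_units_inv, hy'] <;>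
      constructor <;> linarith
  · ext c
    obtain ⟨⟨u, v⟩, rfl⟩ := (cosetEquiv D h2 hl hl2 hE).surjective c
    rw [labelSet, Set.mem_ofPred_eq, coordU, coordV, Equiv.symm_apply_apply]
    constructor
    · rintro ⟨h1, h3⟩
      exact ⟨upperUnit u v, ⟨⟨rfl, rfl⟩, h1, h3⟩, rfl⟩
    · rintro ⟨h, hh, he⟩
      obtain ⟨x, y, rfl, hx, hy⟩ := hC h hh
      rw [← cosetEquiv_apply h2 hl hl2 hE, Equiv.apply_eq_iff_eq] at he
      cases he
      exact ⟨hx, hy⟩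

theorem measurableSet_labelSet (α : F) {β : F} (hβ : β ≠ 0) (r : ℝ) {ρ : ℝ} (hρ : 0 < ρ) :
    MeasurableSet (labelSet (D := D) h2 hl hl2 hE α β r ρ) := by
  obtain ⟨C, hC, h⟩ := exists_isCompact_labelSet (D := D) h2 hl hl2 hE α hβ r hρ
  rw [h]
  exact (RightCosets.isClosed_image_mk (isClosed_stabilizerH h2 hl hl2 hE) hC).measurableSet

variable {μ : Measure (RightCosets (stabilizerH D (uZero D h2 hl)))}
  (hμ : IsInvariantQuotientMeasure μ)

include hμ in
theorem measure_labelSet_lt_top (α : F) {β : F} (hβ : β ≠ 0) (r : ℝ) {ρ : ℝ} (hρ : 0 < ρ) :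
    μ (labelSet h2 hl hl2 hE α β r ρ) < ⊤ := by
  obtain ⟨C, hC, h⟩ := exists_isCompact_labelSet (D := D) h2 hl hl2 hE α hβ r hρ
  rw [h]
  exact hμ.finite_on_compact _ (hC.image RightCosets.continuous_mk)

-- Right translation by the diagonal matrix with entries 1, c multiplies both coordinates by c.
include hμ in
theorem measure_labelSet_mul (α : F) {β : F} (hβ : β ≠ 0) (r : ℝ) {ρ : ℝ} (hρ : 0 < ρ) (c : Dˣ) :
    μ (labelSet h2 hl hl2 hE α β (r * algAbs F (c : D)) (ρ * algAbs F (c : D))) =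
      μ (labelSet h2 hl hl2 hE α β r ρ) := by
  have hc := algAbs_pos F c.ne_zero
  have hm := measurableSet_labelSet (D := D) h2 hl hl2 hE α hβ (r * algAbs F (c : D))
    (mul_pos hρ hc)
  conv_lhs => rw [← hμ.invariant (upperUnit 0 c),
    Measure.map_apply (RightCosets.continuous_translate _).measurable hm]
  congr 1
  ext x
  simp only [labelSet, Set.mem_preimage, Set.mem_ofPred_eq, coordU_translate, coordV_translate,
    zero_add, algAbs_mul, mul_le_mul_iff_left₀ hc, mul_left_inj' hc.ne']

-- The set with |u| ≤ 1 is the disjoint union of unipotent translates of the set with |u| ≤ |c|, one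
-- for each class of the unit ball modulo the smaller ball.
include hμ in
theorem measure_labelSet_index (α : F) {β : F} (hβ : β ≠ 0) {ρ : ℝ} (hρ : 0 < ρ) (c : D)
    (hc : algAbs F c ≤ 1) (hfin : (ballOf F c).relIndex (ballOf F (1 : D)) ≠ 0) :
    μ (labelSet h2 hl hl2 hE α β 1 ρ) =
      (ballOf F c).relIndex (ballOf F (1 : D)) * μ (labelSet h2 hl hl2 hE α β (algAbs F c) ρ) := by
  set B := ballOf F (1 : D)
  set B' := (ballOf F c).addSubgroupOf B
  have hfin' : Finite (B ⧸ B') := Nat.finite_of_card_ne_zero hfin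
  let S : B ⧸ B' → Set (RightCosets (stabilizerH D (uZero D h2 hl))) := fun z =>
    RightCosets.translate (upperUnit (-(z.out : D)) 1) ⁻¹' labelSet h2 hl hl2 hE α β (algAbs F c) ρ
  have hmem : ∀ z x, x ∈ S z ↔ algAbs F (coordU h2 hl hl2 hE α x - (z.out : D)) ≤ algAbs F c ∧
      algAbs F (coordV h2 hl hl2 hE β x) = ρ := by
    intro z x
    simp only [S, labelSet, Set.mem_preimage, Set.mem_ofPred_eq, coordU_translate, coordV_translate,
      Units.val_one, mul_one, neg_add_eq_sub]
  have hm := measurableSet_labelSet (D := D) h2 hl hl2 hE α hβ (algAbs F c) hρ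
  have hSm : ∀ z, MeasurableSet (S z) := fun z =>
    (RightCosets.continuous_translate _).measurable hm
  have hSμ : ∀ z, μ (S z) = μ (labelSet h2 hl hl2 hE α β (algAbs F c) ρ) := fun z => by
    conv_rhs => rw [← hμ.invariant (upperUnit (-(z.out : D)) 1),
      Measure.map_apply (RightCosets.continuous_translate _).measurable hm]
  have hunion : labelSet h2 hl hl2 hE α β 1 ρ = ⋃ z, S z := by
    ext x
    simp only [Set.mem_iUnion, hmem]
    constructor
    · rintro ⟨h1, h3⟩
      let b : B := ⟨coordU h2 hl hl2 hE α x, by rw [mem_ballOf, algAbs_one]; exact h1⟩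
      refine ⟨QuotientAddGroup.mk b, ?_, h3⟩
      have h4 : -(QuotientAddGroup.mk b : B ⧸ B').out + b ∈ B' := by
        rw [← QuotientAddGroup.eq, QuotientAddGroup.out_eq']
      rw [AddSubgroup.mem_addSubgroupOf, mem_ballOf] at h4
      rwa [AddSubgroup.coe_add, AddSubgroup.coe_neg, neg_add_eq_sub] at h4
    · rintro ⟨z, h1, h3⟩
      refine ⟨?_, h3⟩
      have h4 : algAbs F (z.out : D) ≤ 1 := by
        have := mem_ballOf.1 z.out.2
        rwa [algAbs_one] at this
      have h5 := algAbs_add_le F (coordU h2 hl hl2 hE α x - (z.out : D)) (z.out : D)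
      rw [sub_add_cancel] at h5
      exact h5.trans (max_le (h1.trans hc) h4)
  have hdisj : Pairwise (Function.onFun Disjoint S) := by
    intro z z' hzz
    rw [Function.onFun, Set.disjoint_left]
    intro x h1 h3
    rw [hmem] at h1 h3
    apply hzz
    rw [← QuotientAddGroup.out_eq' z, ← QuotientAddGroup.out_eq' z', QuotientAddGroup.eq,
      AddSubgroup.mem_addSubgroupOf, mem_ballOf, AddSubgroup.coe_add, AddSubgroup.coe_neg]
    have h5 := algAbs_sub_le F (coordU h2 hl hl2 hE α x - (z.out : D))
      (coordU h2 hl hl2 hE α x - (z'.out : D))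
    rw [sub_sub_sub_cancel_left, sub_eq_neg_add] at h5
    exact h5.trans (max_le h1.1 h3.1)
  have := Fintype.ofFinite (B ⧸ B')
  rw [hunion, measure_iUnion hdisj hSm]
  simp only [hSμ]
  rw [tsum_fintype, Finset.sum_const, nsmul_eq_mul, Finset.card_univ, ← Nat.card_eq_fintype_card]
  rfl

include hμ in
/-- The volumes of the label sets. -/
theorem exists_measure_labelSet [Algebra.IsCentral F D] {d : ℕ} (hd : d ≠ 0)
    (hD : Module.finrank F D = d ^ 2) (α : F) {β : F} (hβ : β ≠ 0) :
    ∃ c : ℝ, 0 < c ∧ ∀ j k : ℤ, μ (labelSet h2 hl hl2 hE α β (((residueCard F : ℝ) ^ d) ^ j)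
      (((residueCard F : ℝ) ^ d) ^ k)) = ENNReal.ofReal (c * ((residueCard F : ℝ) ^ d) ^ (j - k)) := by
  obtain ⟨hres, ⟨ϖ, hϖ⟩, hval⟩ := exists_uniformiser_of_central hD
  have hQ : (1 : ℝ) < (residueCard F : ℝ) ^ d := one_lt_pow₀ (one_lt_residueCard_real F) hd
  have hcard : (Nat.card (ResidueAlgebra F D) : ℝ) = (residueCard F : ℝ) ^ d := by
    rw [card_residueAlgebra, hres, Nat.cast_pow]
  set Q : ℝ := (residueCard F : ℝ) ^ d
  have hQ0 : 0 < Q := zero_lt_one.trans hQ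
  set S : ℤ → ℤ → Set (RightCosets (stabilizerH D (uZero D h2 hl))) := fun j k =>
    labelSet h2 hl hl2 hE α β (Q ^ j) (Q ^ k)
  have hlt : ∀ j k, μ (S j k) < ⊤ := fun j k =>
    measure_labelSet_lt_top h2 hl hl2 hE hμ α hβ _ (zpow_pos hQ0 k)
  -- Diagonal translation by ϖ shows that the volume depends only on j - k, and unipotent
  -- translation that lowering j by 1 divides it by Q; so it is a constant times Q^(j - k).
  have hshift1 : ∀ j k : ℤ, μ (S (j - 1) (k - 1)) = μ (S j k) := by
    intro j k
    have := measure_labelSet_mul h2 hl hl2 hE hμ α hβ (Q ^ j) (zpow_pos hQ0 k) ϖ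
    rwa [hϖ, ← zpow_sub_one₀ hQ0.ne', ← zpow_sub_one₀ hQ0.ne'] at this
  have hrel := relIndex_ballOf_uniformiser (F := F) (ϖ := ϖ) (by rw [hϖ]; exact inv_lt_one_of_one_lt₀ hQ)
    (by
      intro x hx
      by_cases hx0 : x = 0
      · rw [hx0, algAbs_zero]; exact algAbs_nonneg F _
      obtain ⟨n, hn⟩ := hval x hx0
      rw [hn] at hx ⊢
      rw [hϖ, ← zpow_neg_one, zpow_le_zpow_iff_right₀ hQ]
      rw [zpow_lt_one_iff_right₀ hQ] at hx
      omega)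
  have hidx : ∀ k : ℤ, μ (S 0 k) = ENNReal.ofReal Q * μ (S (-1) k) := by
    intro k
    have := measure_labelSet_index h2 hl hl2 hE hμ α hβ (zpow_pos hQ0 k) (ϖ : D)
      (by rw [hϖ]; exact inv_le_one_of_one_le₀ hQ.le) (by
        rw [hrel, ← Nat.cast_ne_zero (R := ℝ), hcard]; exact hQ0.ne')
    rw [hrel, hϖ, ← zpow_neg_one, ← zpow_zero Q, ← ENNReal.ofReal_natCast, hcard] at this
    exact this
  set σ : ℤ → ℝ := fun k => (μ (S 0 k)).toReal
  have hσ : ∀ k, σ k = Q * σ (k + 1) := by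
    intro k
    have h1 := hshift1 0 (k + 1)
    rw [add_sub_cancel_right, zero_sub] at h1
    have h3 := congrArg ENNReal.toReal (hidx k)
    rw [h1, ENNReal.toReal_mul, ENNReal.toReal_ofReal hQ0.le] at h3
    exact h3
  have hσ0 : ∀ k : ℤ, σ k = σ 0 * Q ^ (-k) := by
    intro k
    induction k using Int.induction_on with
    | zero => simp
    | succ i ih =>
      have := hσ i
      rw [ih] at this
      rw [neg_add, zpow_add₀ hQ0.ne', zpow_neg_one, ← mul_assoc, this]
      field_simp
    | pred i ih =>
      have := hσ (-i - 1)
      rw [sub_add_cancel, ih] at this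
      rw [this, neg_sub, sub_neg_eq_add, neg_neg, zpow_add₀ hQ0.ne', zpow_one]
      ring
  have hshift : ∀ j k : ℤ, μ (S j k) = μ (S 0 (k - j)) := by
    intro j k
    induction j using Int.induction_on generalizing k with
    | zero => simp
    | succ i ih =>
      have := hshift1 (i + 1) k
      rw [add_sub_cancel_right] at this
      rw [← this, ih]
      congr 2
      ring
    | pred i ih =>
      have := hshift1 (-i) (k + 1)
      rw [add_sub_cancel_right] at this
      rw [this, ih]
      congr 2
      ring
  have hform : ∀ j k : ℤ, μ (S j k) = ENNReal.ofReal (σ 0 * Q ^ (j - k)) := by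
    intro j k
    rw [hshift, ← neg_sub k j, ← hσ0, ENNReal.ofReal_toReal (hlt _ _).ne]
  refine ⟨σ 0, ?_, hform⟩
  -- The countably many sets S j k cover the space, so a vanishing constant would force μ = 0.
  refine lt_of_le_of_ne ENNReal.toReal_nonneg fun h0 => hμ.ne_zero ?_
  rw [← Measure.measure_univ_eq_zero]
  have hun : (Set.univ : Set (RightCosets (stabilizerH D (uZero D h2 hl)))) = ⋃ j, ⋃ k, S j k := by
    refine (Set.eq_univ_of_forall fun x => ?_).symm
    obtain ⟨k, hk⟩ := hval _ (coordV_ne_zero (h2 := h2) (hl := hl) (hl2 := hl2) (hE := hE) hβ x)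
    obtain ⟨j, hj⟩ : ∃ j : ℤ, algAbs F (coordU h2 hl hl2 hE α x) ≤ Q ^ j := by
      obtain ⟨n, hn⟩ := pow_unbounded_of_one_lt (algAbs F (coordU h2 hl hl2 hE α x)) hQ
      exact ⟨n, by rw [zpow_natCast]; exact hn.le⟩
    exact Set.mem_iUnion.2 ⟨j, Set.mem_iUnion.2 ⟨k, hj, hk⟩⟩
  rw [hun]
  refine measure_iUnion_null fun j => measure_iUnion_null fun k => ?_
  rw [hform, ← h0, zero_mul, ENNReal.ofReal_zero]

end Coordinates


/-! ### Summation over the label sets -/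

section Summation

theorem integral_of_pieces {X ι : Type*} [MeasurableSpace X] [Countable ι] {μ : Measure X}
    {P : ι → Set X} (hm : ∀ i, MeasurableSet (P i)) (hd : Pairwise (Function.onFun Disjoint P))
    (hc : ⋃ i, P i = Set.univ) {w : ι → ℝ} (hw : ∀ i, 0 ≤ w i)
    (hμ : ∀ i, μ (P i) = ENNReal.ofReal (w i)) {f : X → ℂ} {v : ι → ℂ}
    (hf : ∀ i, ∀ x ∈ P i, f x = v i) (hs : Summable fun i => ‖(w i : ℂ) * v i‖) {I : ℂ}
    (hI : HasSum (fun i => (w i : ℂ) * v i) I) : Integrable f μ ∧ ∫ x, f x ∂μ = I := by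
  have hreal : ∀ i, μ.real (P i) = w i := fun i => by
    rw [Measure.real, hμ, ENNReal.toReal_ofReal (hw i)]
  have hint : ∀ i, IntegrableOn f (P i) μ := fun i => by
    rw [integrableOn_congr_fun (g := fun _ => v i) (hf i) (hm i)]
    exact integrableOn_const (by rw [hμ]; exact ENNReal.ofReal_ne_top)
  have hval : ∀ i, ∫ x in P i, f x ∂μ = (w i : ℂ) * v i := fun i => by
    rw [setIntegral_congr_fun (g := fun _ => v i) (hm i) (hf i), setIntegral_const, hreal]
    simp
  have hon : IntegrableOn f (⋃ i, P i) μ := by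
    refine integrableOn_iUnion_of_summable_integral_norm hint ?_
    refine hs.congr fun i => ?_
    rw [setIntegral_congr_fun (g := fun _ => ‖v i‖) (hm i) fun x hx => by simp [hf i x hx],
      setIntegral_const, hreal, norm_mul, Complex.norm_real, Real.norm_of_nonneg (hw i), smul_eq_mul]
  have hsum := hasSum_integral_iUnion hm hd hon
  simp only [hval] at hsum
  rw [hc, setIntegral_univ] at hsum
  rw [hc, integrableOn_univ] at hon
  exact ⟨hon, hsum.unique hI⟩

theorem cpow_ratio {Q C : ℝ} (hQ : 0 < Q) (hC : 0 ≤ C) (k e : ℤ) (s : ℂ) :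
    ((C * (Q ^ k) ^ 2 / (Q ^ e) ^ 2 : ℝ) : ℂ) ^ s =
      (C : ℂ) ^ s * ((Q : ℂ) ^ (-2 * s)) ^ (e - k) := by
  have h1 : C * (Q ^ k) ^ 2 / (Q ^ e) ^ 2 = C * Q ^ (2 * (k - e)) := by
    rw [mul_div_assoc, ← div_pow, ← zpow_sub₀ hQ.ne', ← zpow_natCast, ← zpow_mul]
    congr 2
    push_cast
    ring
  rw [h1, Complex.ofReal_mul, Complex.mul_cpow_ofReal_nonneg hC (zpow_pos hQ _).le]
  congr 1
  have hQC : (Q : ℂ) ≠ 0 := by exact_mod_cast hQ.ne'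
  rw [← Complex.cpow_int_mul, ← Real.rpow_intCast, Complex.ofReal_cpow hQ.le,
    ← Complex.ofReal_cpow hQ.le, Complex.cpow_def_of_ne_zero hQC, Complex.cpow_def_of_ne_zero,
    ← Complex.ofReal_log (Real.rpow_nonneg hQ.le _), Real.log_rpow hQ, ← Complex.ofReal_log hQ.le]
  · push_cast
    congr 1
    ring
  · exact_mod_cast (zpow_pos hQ _).ne'

variable {X : Type*} {Q : ℝ} (a b : X → ℝ)

/-- The set where `b = Q ^ k` and `a` is at most `Q ^ J`, respectively equal to `Q ^ (J + i)`. -/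
def piece (Q : ℝ) (k J : ℤ) (i : ℕ) : Set X :=
  {x | b x = Q ^ k ∧ if i = 0 then a x ≤ Q ^ J else a x = Q ^ (J + i)}

variable {a b}

theorem piece_eq_index (hQ : 1 < Q) {k J k' J' : ℤ} {i i' : ℕ} {x : X} (h : x ∈ piece a b Q k J i)
    (h' : x ∈ piece a b Q k' J' i') : k = k' ∧ (J = J' → i = i') := by
  have hQ0 : 0 < Q := zero_lt_one.trans hQ
  refine ⟨zpow_right_injective₀ hQ0 hQ.ne' (h.1.symm.trans h'.1), ?_⟩
  rintro rfl
  have h1 := h.2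
  have h2 := h'.2
  split_ifs at h1 h2 with h3 h4 h4
  · omega
  · rw [h2, zpow_le_zpow_iff_right₀ hQ] at h1
    omega
  · rw [h1, zpow_le_zpow_iff_right₀ hQ] at h2
    omega
  · have := zpow_right_injective₀ hQ0 hQ.ne' (h1.symm.trans h2)
    omega

theorem piece_succ (hQ : 1 < Q) (ha : ∀ x, a x = 0 ∨ ∃ j : ℤ, a x = Q ^ j) (k J : ℤ) (i : ℕ) :
    piece a b Q k J (i + 1) = {x | a x ≤ Q ^ (J + i + 1) ∧ b x = Q ^ k} \
      {x | a x ≤ Q ^ (J + i) ∧ b x = Q ^ k} := by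
  have hQ0 : 0 < Q := zero_lt_one.trans hQ
  ext x
  simp only [piece, Set.mem_ofPred_eq, Set.mem_sdiff, Nat.add_eq_zero_iff, one_ne_zero, and_false,
    if_false]
  push_cast
  constructor
  · rintro ⟨h1, h2⟩
    refine ⟨⟨h2.le.trans_eq (by ring_nf), h1⟩, fun h => ?_⟩
    have := h.1
    rw [h2, zpow_le_zpow_iff_right₀ hQ] at this
    omega
  · rintro ⟨⟨h1, h2⟩, h3⟩
    refine ⟨h2, ?_⟩
    rcases ha x with h0 | ⟨j, hj⟩
    · exact absurd ⟨by rw [h0]; exact (zpow_pos hQ0 _).le, h2⟩ h3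
    · rw [hj] at h1 h3 ⊢
      rw [zpow_le_zpow_iff_right₀ hQ] at h1
      have h4 : ¬ j ≤ J + i := fun h => h3 ⟨zpow_le_zpow_right₀ hQ.le h, h2⟩
      congr 1
      omega

theorem exists_mem_piece (hQ : 1 < Q) (ha : ∀ x, a x = 0 ∨ ∃ j : ℤ, a x = Q ^ j) {k : ℤ} (J : ℤ)
    {x : X} (hx : b x = Q ^ k) : ∃ i, x ∈ piece a b Q k J i := by
  have hQ0 : 0 < Q := zero_lt_one.trans hQ
  by_cases h : a x ≤ Q ^ J
  · exact ⟨0, hx, by simpa using h⟩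
  rcases ha x with h0 | ⟨j, hj⟩
  · exact absurd (h0.trans_le (zpow_pos hQ0 J).le) h
  · rw [hj, zpow_le_zpow_iff_right₀ hQ, not_le] at h
    refine ⟨(j - J).toNat, hx, ?_⟩
    rw [if_neg (by omega), hj]
    congr 1
    omega

/-- The proportion of the ball of radius `Q ^ (J + i)` that belongs to a piece. -/
def pieceWeight (Q : ℝ) (i : ℕ) : ℝ := if i = 0 then 1 else 1 - Q⁻¹

variable [MeasurableSpace X] {μ : Measure X} {c : ℝ}

theorem measure_piece (hQ : 1 < Q) (ha : ∀ x, a x = 0 ∨ ∃ j : ℤ, a x = Q ^ j) (hc : 0 < c)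
    (hm : ∀ j k : ℤ, MeasurableSet {x | a x ≤ Q ^ j ∧ b x = Q ^ k})
    (hμ : ∀ j k : ℤ, μ {x | a x ≤ Q ^ j ∧ b x = Q ^ k} = ENNReal.ofReal (c * Q ^ (j - k)))
    (k J : ℤ) (i : ℕ) : MeasurableSet (piece a b Q k J i) ∧
      μ (piece a b Q k J i) = ENNReal.ofReal (c * (pieceWeight Q i * Q ^ (J + i - k))) := by
  have hQ0 : 0 < Q := zero_lt_one.trans hQ
  cases i with
  | zero =>
    have : piece a b Q k J 0 = {x | a x ≤ Q ^ J ∧ b x = Q ^ k} := by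
      ext x
      simp [piece, and_comm]
    rw [this]
    refine ⟨hm J k, ?_⟩
    rw [hμ]
    simp [pieceWeight]
  | succ i =>
    rw [piece_succ hQ ha]
    refine ⟨(hm _ _).diff (hm _ _), ?_⟩
    rw [measure_sdiff _ (hm _ _).nullMeasurableSet (by rw [hμ]; exact ENNReal.ofReal_ne_top), hμ, hμ,
      ← ENNReal.ofReal_sub _ (mul_pos hc (zpow_pos hQ0 _)).le]
    · congr 1
      have e1 : Q ^ (J + i - k) = Q⁻¹ * Q ^ (J + i + 1 - k) := by
        rw [← zpow_neg_one, ← zpow_add₀ hQ0.ne']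
        congr 1
        ring
      have e2 : J + ((i + 1 : ℕ) : ℤ) - k = J + i + 1 - k := by push_cast; ring
      rw [e1, e2, pieceWeight, if_neg (by omega)]
      ring
    · rintro x ⟨h1, h2⟩
      exact ⟨h1.trans (zpow_le_zpow_right₀ hQ.le (by omega)), h2⟩

omit [MeasurableSpace X] in
/-- The value of the maximum on a piece. -/
theorem max_eq_of_mem_piece (hQ : 1 < Q) (ha : ∀ x, 0 ≤ a x) {k J m e : ℤ} {i : ℕ} {x : X}
    (hx : x ∈ piece a b Q k J i) (he : max 0 (2 * k - m) = 2 * J + e) (h0 : 0 ≤ e) (h1 : e ≤ 1) :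
    max 1 (max (a x ^ 2) (Q ^ (-m) * b x ^ 2)) = Q ^ (if i = 0 then 2 * J + e else 2 * (J + i)) := by
  have hQ0 : 0 < Q := zero_lt_one.trans hQ
  have hb : Q ^ (-m) * b x ^ 2 = Q ^ (2 * k - m) := by
    rw [hx.1, ← zpow_natCast, ← zpow_mul, ← zpow_add₀ hQ0.ne']
    congr 1
    push_cast
    ring
  have hmono : ∀ p r : ℤ, max (Q ^ p) (Q ^ r) = Q ^ max p r := fun p r =>
    ((zpow_right_strictMono₀ hQ).monotone.map_max).symm
  have hsq : ∀ j : ℤ, (Q ^ j) ^ 2 = Q ^ (2 * j) := fun j => by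
    rw [← zpow_natCast, ← zpow_mul, mul_comm]; rfl
  rw [hb, max_left_comm, ← zpow_zero Q, hmono, he]
  have h2 := hx.2
  split_ifs at h2 ⊢ with hi
  · refine max_eq_right ?_
    refine (pow_le_pow_left₀ (ha x) h2 2).trans ?_
    rw [hsq]
    exact zpow_le_zpow_right₀ hQ.le (by omega)
  · rw [h2, hsq, hmono]
    -- Here i ≥ 1, so 2(J + i) ≥ 2J + 2 exceeds 2J + e because e ≤ 1.
    congr 1
    omega

theorem hasSum_pieceWeight {y : ℂ} (hy : ‖y‖ < 1) (u : ℂ) :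
    Summable (fun i : ℕ => ‖(if i = 0 then 1 else u * y ^ i : ℂ)‖) ∧
      HasSum (fun i : ℕ => (if i = 0 then 1 else u * y ^ i : ℂ)) (1 + u * y * (1 - y)⁻¹) := by
  have h1 : HasSum (fun i : ℕ => u * y * y ^ i) (u * y * (1 - y)⁻¹) :=
    (hasSum_geometric_of_norm_lt_one hy).mul_left _
  constructor
  · rw [← summable_nat_add_iff 1]
    have : Summable fun i : ℕ => ‖u * y‖ * ‖y‖ ^ i :=
      (summable_geometric_of_lt_one (norm_nonneg y) hy).mul_left _
    refine this.congr fun i => ?_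
    rw [if_neg (by omega), pow_succ', ← mul_assoc, norm_mul (u * y), norm_pow]
  · rw [← hasSum_nat_add_iff' 1]
    simp only [Finset.range_one, Finset.sum_singleton, if_true, add_sub_cancel_left]
    have : (fun n : ℕ => (if n + 1 = 0 then 1 else u * y ^ (n + 1) : ℂ)) =
        fun i : ℕ => u * y * y ^ i := funext fun i => by
      rw [if_neg (by omega), pow_succ', ← mul_assoc]
    rw [this]
    exact h1

theorem hasSum_geometric_mul {x y : ℂ} (hx : ‖x‖ < 1) (hy : ‖y‖ < 1) (K u : ℂ) :
    Summable (fun p : ℕ × ℕ => ‖K * (x ^ p.1 * (if p.2 = 0 then 1 else u * y ^ p.2))‖) ∧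
      HasSum (fun p : ℕ × ℕ => K * (x ^ p.1 * (if p.2 = 0 then 1 else u * y ^ p.2)))
        (K * ((1 - x)⁻¹ * (1 + u * y * (1 - y)⁻¹))) := by
  obtain ⟨h1, h2⟩ := hasSum_pieceWeight hy u
  have h3 : Summable fun i : ℕ => ‖x ^ i‖ := by
    simp only [norm_pow]
    exact summable_geometric_of_lt_one (norm_nonneg x) hx
  have h4 := h3.mul_norm h1
  refine ⟨?_, ((hasSum_geometric_of_norm_lt_one hx).mul h2 h4.of_norm).mul_left K⟩
  refine (h4.mul_left ‖K‖).congr fun p => ?_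
  rw [norm_mul K]

/-- The integral of the function `(C b² / max(1, a², Q⁻ᵐ b²)²) ^ s`. -/
theorem integral_of_volumes (hQ : 1 < Q) (ha0 : ∀ x, 0 ≤ a x)
    (ha : ∀ x, a x = 0 ∨ ∃ j : ℤ, a x = Q ^ j) (hb : ∀ x, ∃ k : ℤ, b x = Q ^ k) (hc : 0 < c)
    (hm : ∀ j k : ℤ, MeasurableSet {x | a x ≤ Q ^ j ∧ b x = Q ^ k})
    (hμ : ∀ j k : ℤ, μ {x | a x ≤ Q ^ j ∧ b x = Q ^ k} = ENNReal.ofReal (c * Q ^ (j - k)))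
    {C : ℝ} (hC : 0 < C) (n e : ℤ) (he : e = 0 ∨ e = 1) {s : ℂ} (hs : 1 / 2 < s.re) {f : X → ℂ}
    (hf : ∀ x, f x = ((C * b x ^ 2 /
      max 1 (max (a x ^ 2) (Q ^ (-(2 * n + e)) * b x ^ 2)) ^ 2 : ℝ) : ℂ) ^ s) :
    Integrable f μ ∧ ∫ x, f x ∂μ = c * (C : ℂ) ^ s * (Q * (Q : ℂ) ^ (-2 * s)) ^ (-n) *
      ((if e = 0 then 1 + (Q : ℂ) ^ (-2 * s) else 1 + (Q : ℂ)⁻¹) *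
        (1 - Q * (Q : ℂ) ^ (-2 * s))⁻¹) := by
  have hQ0 : 0 < Q := zero_lt_one.trans hQ
  have hQC : (Q : ℂ) ≠ 0 := by exact_mod_cast hQ0.ne'
  set Y : ℂ := (Q : ℂ) ^ (-2 * s) with hY
  have hY0 : Y ≠ 0 := by rw [hY, Complex.cpow_ne_zero_iff]; exact Or.inl hQC
  -- The assumption Re s > 1/2 is exactly ‖Q Y‖ < 1, the convergence of the leading geometric
  -- series.
  have hnY : ‖Y‖ < Q⁻¹ := by
    rw [hY, Complex.norm_cpow_eq_rpow_re_of_pos hQ0, ← Real.rpow_neg_one]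
    refine Real.rpow_lt_rpow_of_exponent_lt hQ ?_
    simp
    linarith
  have hQY : ‖(Q : ℂ) * Y‖ < 1 := by
    rw [norm_mul, Complex.norm_real, Real.norm_of_nonneg hQ0.le]
    calc Q * ‖Y‖ < Q * Q⁻¹ := mul_lt_mul_of_pos_left hnY hQ0
      _ = 1 := mul_inv_cancel₀ hQ0.ne'
  have hY1 : ‖Y‖ < 1 := hnY.trans (inv_lt_one_of_one_lt₀ hQ)
  have hQY2 : ‖(Q : ℂ) * Y ^ 2‖ < 1 := by
    rw [sq, ← mul_assoc, norm_mul]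
    exact mul_lt_one_of_nonneg_of_lt_one_left (norm_nonneg _) hQY hY1.le
  -- The space is cut by b = Q^κ and by the size of a. For κ ≤ n (left summand) the term Q⁻ᵐ b²,
  -- with m = 2n + e, is at most 1; for κ = n + 1 + p (right summand) it equals Q^(2J + e) with J =
  -- p + 1 - e. Index 0 collects all a ≤ Q^J, where a does not affect the maximum.
  let κ : (ℕ × ℕ) ⊕ (ℕ × ℕ) → ℤ := Sum.elim (fun p => n - p.1) (fun p => n + 1 + p.1)
  let J : (ℕ × ℕ) ⊕ (ℕ × ℕ) → ℤ := Sum.elim (fun _ => 0) (fun p => p.1 + 1 - e)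
  let ε : (ℕ × ℕ) ⊕ (ℕ × ℕ) → ℤ := Sum.elim (fun _ => 0) (fun _ => e)
  let ι : (ℕ × ℕ) ⊕ (ℕ × ℕ) → ℕ := Sum.elim Prod.snd Prod.snd
  let P : (ℕ × ℕ) ⊕ (ℕ × ℕ) → Set X := fun p => piece a b Q (κ p) (J p) (ι p)
  let E : (ℕ × ℕ) ⊕ (ℕ × ℕ) → ℤ := fun p => if ι p = 0 then 2 * J p + ε p else 2 * (J p + ι p)
  let w : (ℕ × ℕ) ⊕ (ℕ × ℕ) → ℝ := fun p => c * (pieceWeight Q (ι p) * Q ^ (J p + ι p - κ p))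
  let v : (ℕ × ℕ) ⊕ (ℕ × ℕ) → ℂ := fun p => (C : ℂ) ^ s * Y ^ (E p - κ p)
  have hε : ∀ p, 0 ≤ ε p ∧ ε p ≤ 1 ∧ max 0 (2 * κ p - (2 * n + e)) = 2 * J p + ε p := by
    rintro (p | p) <;> simp only [ε, κ, J, Sum.elim_inl, Sum.elim_inr] <;> omega
  have hP := fun p => measure_piece hQ ha hc hm hμ (κ p) (J p) (ι p)
  have hdisj : Pairwise (Function.onFun Disjoint P) := by
    intro p p' hpp
    rw [Function.onFun, Set.disjoint_left]
    intro x h1 h2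
    obtain ⟨h3, h4⟩ := piece_eq_index hQ h1 h2
    apply hpp
    rcases p with ⟨p, i⟩ | ⟨p, i⟩ <;> rcases p' with ⟨p', i'⟩ | ⟨p', i'⟩ <;>
      simp only [κ, J, ι, Sum.elim_inl, Sum.elim_inr] at h3 h4
    · obtain rfl : p = p' := by omega
      rw [h4 trivial]
    · omega
    · omega
    · obtain rfl : p = p' := by omega
      rw [h4 rfl]
  have hcover : ⋃ p, P p = Set.univ := by
    refine Set.eq_univ_of_forall fun x => Set.mem_iUnion.2 ?_
    obtain ⟨k, hk⟩ := hb x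
    rcases le_or_gt k n with h | h
    · obtain ⟨i, hi⟩ := exists_mem_piece hQ ha 0 hk
      refine ⟨Sum.inl ((n - k).toNat, i), ?_⟩
      have : n - ((n - k).toNat : ℤ) = k := by omega
      simpa only [P, κ, J, ι, Sum.elim_inl, this] using hi
    · obtain ⟨i, hi⟩ := exists_mem_piece hQ ha (((k - n - 1).toNat : ℤ) + 1 - e) hk
      refine ⟨Sum.inr ((k - n - 1).toNat, i), ?_⟩
      have : n + 1 + ((k - n - 1).toNat : ℤ) = k := by omega
      simpa only [P, κ, J, ι, Sum.elim_inr, this] using hi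
  have hfv : ∀ p, ∀ x ∈ P p, f x = v p := by
    intro p x hx
    obtain ⟨h1, h2, h3⟩ := hε p
    rw [hf, max_eq_of_mem_piece hQ ha0 hx h3 h1 h2, hx.1]
    exact cpow_ratio hQ0 hC.le _ _ s
  have hw : ∀ p, 0 ≤ w p := by
    intro p
    refine mul_nonneg hc.le (mul_nonneg ?_ (zpow_pos hQ0 _).le)
    rw [pieceWeight]
    split_ifs
    · exact zero_le_one
    · exact sub_nonneg.2 (inv_le_one_of_one_le₀ hQ.le)
  set K₁ : ℂ := c * (C : ℂ) ^ s * (Q * Y) ^ (-n)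
  set K₂ : ℂ := c * (C : ℂ) ^ s * ((Q : ℂ) ^ (-n - e) * Y ^ (1 - e - n))
  set u : ℂ := 1 - (Q : ℂ)⁻¹
  have hinl : ∀ p : ℕ × ℕ, (w (Sum.inl p) : ℂ) * v (Sum.inl p) =
      K₁ * ((Q * Y) ^ p.1 * (if p.2 = 0 then 1 else u * (Q * Y ^ 2) ^ p.2)) := by
    rintro ⟨p, i⟩
    change ((c * (pieceWeight Q i * Q ^ (0 + i - (n - p) : ℤ)) : ℝ) : ℂ) * ((C : ℂ) ^ s *
      Y ^ ((if i = 0 then 2 * 0 + 0 else 2 * (0 + i) : ℤ) - (n - p))) =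
      K₁ * ((Q * Y) ^ p * (if i = 0 then 1 else u * (Q * Y ^ 2) ^ i))
    rw [Complex.ofReal_mul, Complex.ofReal_mul, Complex.ofReal_zpow, pieceWeight]
    have e1 : (Q : ℂ) ^ (0 + i - (n - p) : ℤ) = Q ^ (-n) * Q ^ p * Q ^ i := by
      rw [← zpow_natCast, ← zpow_natCast, ← zpow_add₀ hQC, ← zpow_add₀ hQC]
      congr 1
      ring
    split_ifs with hi
    · subst hi
      have e2 : Y ^ (2 * 0 + 0 - (n - p) : ℤ) = Y ^ (-n) * Y ^ p := by
        rw [← zpow_natCast, ← zpow_add₀ hY0]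
        congr 1
        ring
      rw [e1, e2]
      simp only [K₁, mul_zpow, mul_pow, Complex.ofReal_one]
      ring
    · have e2 : Y ^ (2 * (0 + i) - (n - p) : ℤ) = Y ^ (-n) * Y ^ p * (Y ^ 2) ^ i := by
        rw [← pow_mul, ← zpow_natCast, ← zpow_natCast, ← zpow_add₀ hY0, ← zpow_add₀ hY0]
        congr 1
        push_cast
        ring
      rw [e1, e2]
      simp only [K₁, u, mul_zpow, mul_pow, Complex.ofReal_sub, Complex.ofReal_inv,
        Complex.ofReal_one]
      ring
  have hinr : ∀ p : ℕ × ℕ, (w (Sum.inr p) : ℂ) * v (Sum.inr p) =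
      K₂ * (Y ^ p.1 * (if p.2 = 0 then 1 else (u * Y ^ (-e)) * (Q * Y ^ 2) ^ p.2)) := by
    rintro ⟨p, i⟩
    change ((c * (pieceWeight Q i * Q ^ (p + 1 - e + i - (n + 1 + p) : ℤ)) : ℝ) : ℂ) *
      ((C : ℂ) ^ s * Y ^ ((if i = 0 then 2 * (p + 1 - e) + e else 2 * (p + 1 - e + i) : ℤ) -
        (n + 1 + p))) = K₂ * (Y ^ p * (if i = 0 then 1 else (u * Y ^ (-e)) * (Q * Y ^ 2) ^ i))
    rw [Complex.ofReal_mul, Complex.ofReal_mul, Complex.ofReal_zpow, pieceWeight]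
    have e1 : (Q : ℂ) ^ (p + 1 - e + i - (n + 1 + p) : ℤ) = Q ^ (-n - e) * Q ^ i := by
      rw [← zpow_natCast, ← zpow_add₀ hQC]
      congr 1
      ring
    split_ifs with hi
    · subst hi
      have e2 : Y ^ (2 * (p + 1 - e) + e - (n + 1 + p) : ℤ) = Y ^ (1 - e - n) * Y ^ p := by
        rw [← zpow_natCast, ← zpow_add₀ hY0]
        congr 1
        ring
      rw [e1, e2]
      simp only [K₂, Complex.ofReal_one]
      ring
    · have e2 : Y ^ (2 * (p + 1 - e + i) - (n + 1 + p) : ℤ) =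
          Y ^ (1 - e - n) * Y ^ p * (Y ^ (-e) * (Y ^ 2) ^ i) := by
        rw [← pow_mul, ← zpow_natCast, ← zpow_natCast, ← zpow_add₀ hY0, ← zpow_add₀ hY0,
          ← zpow_add₀ hY0]
        congr 1
        push_cast
        ring
      rw [e1, e2]
      simp only [K₂, u, mul_pow, Complex.ofReal_sub, Complex.ofReal_inv, Complex.ofReal_one]
      ring
  obtain ⟨s1, t1⟩ := hasSum_geometric_mul hQY hQY2 K₁ u
  obtain ⟨s2, t2⟩ := hasSum_geometric_mul hY1 hQY2 K₂ (u * Y ^ (-e))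
  have hsum : Summable fun p => ‖(w p : ℂ) * v p‖ := by
    refine Summable.sum _ (s1.congr fun p => ?_) (s2.congr fun p => ?_)
    · rw [Function.comp_apply, hinl]
    · rw [Function.comp_apply, hinr]
  rw [← funext hinl] at t1
  rw [← funext hinr] at t2
  have hhas := HasSum.sum (f := fun p => (w p : ℂ) * v p) t1 t2
  obtain ⟨g1, g2⟩ := integral_of_pieces (fun p => (hP p).1) hdisj hcover hw (fun p => (hP p).2)
    hfv hsum hhas
  refine ⟨g1, g2.trans ?_⟩
  have ne1 : ∀ z : ℂ, ‖z‖ < 1 → 1 - z ≠ 0 := fun z hz h => by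
    rw [sub_eq_zero] at h
    rw [← h, norm_one] at hz
    exact lt_irrefl _ hz
  have d1 := ne1 _ hQY
  have d2 := ne1 _ hQY2
  have d3 := ne1 _ hY1
  -- Each inner sum carries the denominator 1 - Q Y². It cancels after the two halves are added,
  -- leaving (1 + Y) / (1 - Q Y) for e = 0 and (1 + Q⁻¹) / (1 - Q Y) for e = 1.
  rcases he with rfl | rfl
  · have hK : K₂ = K₁ * Y := by
      simp only [K₂, K₁, sub_zero]
      rw [mul_zpow, show (1 - n : ℤ) = -n + 1 by ring, zpow_add_one₀ hY0]
      ring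
    rw [hK, if_pos rfl, neg_zero, zpow_zero]
    simp only [u]
    field_simp
    ring
  · have hK : K₂ = K₁ * (Q : ℂ)⁻¹ := by
      simp only [K₂, K₁]
      rw [mul_zpow, show (1 - 1 - n : ℤ) = -n by ring, zpow_sub_one₀ hQC]
      ring
    rw [hK, if_neg one_ne_zero, zpow_neg_one]
    simp only [u]
    field_simp
    ring

end Summation


/-! ### The period and its continuation -/

theorem zpow_cpow_eq {q : ℝ} (hq : 0 < q) (j : ℤ) (s : ℂ) :
    ((q ^ j : ℝ) : ℂ) ^ s = ((q : ℂ) ^ s) ^ j := by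
  have hqC : (q : ℂ) ≠ 0 := by exact_mod_cast hq.ne'
  rw [← Complex.cpow_int_mul, Complex.cpow_def_of_ne_zero hqC, Complex.cpow_def_of_ne_zero,
    ← Complex.ofReal_log (zpow_pos hq _).le, Real.log_zpow, ← Complex.ofReal_log hq.le]
  · push_cast
    congr 1
    ring
  · exact_mod_cast (zpow_pos hq _).ne'

/-! ### Monomials as units of the ring of Laurent polynomials in q^s -/

section Laurent

variable (F : Type*) [Field F] [ValuativeRel F] [TopologicalSpace F]
  [IsNonarchimedeanLocalField F]

theorem residueCard_complex_ne_zero : (residueCard F : ℂ) ≠ 0 :=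
  Nat.cast_ne_zero.2 (zero_lt_one.trans (one_lt_residueCard F)).ne'

theorem exists_laurentRing_unit {K : ℂ} (hK : K ≠ 0) (b : ℤ) :
    ∃ ε : (laurentRing F)ˣ, ∀ s : ℂ, (ε : laurentRing F).val s = K * ((residueCard F : ℂ) ^ s) ^ b := by
  have hq := residueCard_complex_ne_zero F
  let ν : (laurentRing F)ˣ :=
    { val := ⟨fun s => (residueCard F : ℂ) ^ s, Algebra.subset_adjoin (by simp)⟩
      inv := ⟨fun s => (residueCard F : ℂ) ^ (-s), Algebra.subset_adjoin (by simp)⟩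
      val_inv := Subtype.ext (funext fun s => by
        change (residueCard F : ℂ) ^ s * (residueCard F : ℂ) ^ (-s) = 1
        rw [← Complex.cpow_add _ _ hq, add_neg_cancel, Complex.cpow_zero])
      inv_val := Subtype.ext (funext fun s => by
        change (residueCard F : ℂ) ^ (-s) * (residueCard F : ℂ) ^ s = 1
        rw [← Complex.cpow_add _ _ hq, neg_add_cancel, Complex.cpow_zero]) }
  let k : (laurentRing F)ˣ := Units.map (algebraMap ℂ (laurentRing F)).toMonoidHom (Units.mk0 K hK)
  refine ⟨k * ν ^ b, fun s => ?_⟩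
  let ev : laurentRing F →+* ℂ := (Pi.evalRingHom (fun _ : ℂ => ℂ) s).comp (laurentRing F).val.toRingHom
  have h1 := Units.coe_map (ev : laurentRing F →* ℂ) (k * ν ^ b)
  rw [map_mul, map_zpow, Units.val_mul, Units.val_zpow_eq_zpow_val] at h1
  exact h1.symm

end Laurent

section Period

variable {F : Type*} [Field F] [ValuativeRel F] [TopologicalSpace F] [IsNonarchimedeanLocalField F]
  {E : Type*} [Field E] [Algebra F E]

theorem tateL_one_eq (d : ℕ) (s : ℂ) : tateL F (fun _ => 1) (d * (2 * s - 1)) =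
    (1 - (residueCard F : ℂ) ^ d * (residueCard F : ℂ) ^ (-(2 * d * s)))⁻¹ := by
  rw [tateL, if_pos fun _ _ => rfl, one_mul]
  congr 2
  rw [← Complex.cpow_natCast, ← Complex.cpow_add _ _ (residueCard_complex_ne_zero F)]
  congr 1
  ring

theorem tateL_etaChar_unramified
    (hu : ∀ u : Fˣ, absF F (u : F) = 1 → ∃ y : E, Algebra.norm F y = (u : F))
    (hϖ : ¬ ∃ y : E, Algebra.norm F y = (uniformiser F : F)) (s : ℂ) :
    tateL F (etaChar F E) s = (1 + (residueCard F : ℂ) ^ (-s))⁻¹ := by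
  have h1 : ∀ u : Fˣ, absF F (u : F) = 1 → etaChar F E u = 1 := fun u h => if_pos (hu u h)
  rw [tateL, if_pos h1]
  have : etaChar F E (uniformiserUnit F) = -1 := if_neg hϖ
  rw [this]
  congr 1
  ring

theorem tateL_etaChar_ramified
    (hu : ∃ u : Fˣ, absF F (u : F) = 1 ∧ ¬ ∃ y : E, Algebra.norm F y = (u : F)) (s : ℂ) :
    tateL F (etaChar F E) s = 1 := by
  rw [tateL, if_neg]
  intro h
  obtain ⟨u, hu1, hu2⟩ := hu
  have h1 := h u hu1
  rw [etaChar, if_neg hu2] at h1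
  norm_num at h1

/-- The reciprocal of the factor of the quadratic character is `1 + q⁻ˢ` or `1`. -/
theorem inv_tateL_etaChar {m : ℤ}
    (h : (Even m ∧ (∀ u : Fˣ, absF F (u : F) = 1 → ∃ y : E, Algebra.norm F y = (u : F)) ∧
          ¬ ∃ y : E, Algebra.norm F y = (uniformiser F : F)) ∨
        (Odd m ∧ ∃ u : Fˣ, absF F (u : F) = 1 ∧ ¬ ∃ y : E, Algebra.norm F y = (u : F))) :
    ∃ n e : ℤ, (e = 0 ∨ e = 1) ∧ m = 2 * n + e ∧ ∀ s : ℂ,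
      (tateL F (etaChar F E) s)⁻¹ = if e = 0 then 1 + (residueCard F : ℂ) ^ (-s) else 1 := by
  rcases h with ⟨⟨n, hn⟩, hu, hϖ⟩ | ⟨⟨n, hn⟩, hu⟩
  · exact ⟨n, 0, Or.inl rfl, by omega, fun s => by
      rw [tateL_etaChar_unramified hu hϖ, inv_inv, if_pos rfl]⟩
  · exact ⟨n, 1, Or.inr rfl, hn, fun s => by
      rw [tateL_etaChar_ramified hu, inv_one, if_neg one_ne_zero]⟩

variable {D : Type*} [DivisionRing D] [Algebra F D] [Algebra.IsCentral F D]
  [TopologicalSpace D] [IsModuleTopology F D] [IsTopologicalRing D] [T2Space D]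
  [FiniteDimensional F D] [FiniteDimensional F E] [IsDomain (D ⊗[F] E)]

/-- The period as a product of a monomial in `qˢ` and a quotient of `L`-factors. -/
theorem integral_periodIntegrand (h2 : (2 : F) ≠ 0) (hE : Module.finrank F E = 2) {d : ℕ}
    (hd : Odd d) (hD : Module.finrank F D = d ^ 2) {l : E} (hl : l ∉ Set.range (algebraMap F E))
    (hl2 : l ^ 2 ∈ Set.range (algebraMap F E))
    {μ : Measure (RightCosets (stabilizerH D (uZero D h2 hl)))} (hμ : IsInvariantQuotientMeasure μ) :
    ∃ K : ℂ, K ≠ 0 ∧ ∃ b : ℤ, ∀ s : ℂ, 1 / 2 < s.re →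
      Integrable (fun x => periodIntegrand D (uZero D h2 hl) s x.rep) μ ∧
      ∫ x, periodIntegrand D (uZero D h2 hl) s x.rep ∂μ = K * ((residueCard F : ℂ) ^ s) ^ b *
        (tateL F (fun _ => 1) (d * (2 * s - 1)) / tateL F (etaChar F E) (2 * d * s)) := by
  have hq := one_lt_residueCard_real F
  have hq0 : (0 : ℝ) < residueCard F := zero_lt_one.trans hq
  have hqC := residueCard_complex_ne_zero F
  have hQ : (1 : ℝ) < (residueCard F : ℝ) ^ d := one_lt_pow₀ hq hd.pos.ne'
  have hQ0 : (0 : ℝ) < (residueCard F : ℝ) ^ d := zero_lt_one.trans hQ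
  obtain ⟨θ, hθ, m, hform, hcase⟩ := exists_orthogonal_generator (D := D) h2 hE hd hD hl hl2
  obtain ⟨n, e, he, rfl, hη⟩ := inv_tateL_etaChar hcase
  -- The period is given in terms of l and the orthogonal generator is θ; the change of basis l = α
  -- + β θ defines the coordinates u = x + α y and v = β y.
  obtain ⟨α, β, hlθ⟩ := exists_eq_add_mul hE hθ l
  have hβ : β ≠ 0 := by
    rintro rfl
    exact hl ⟨α, by rw [hlθ]; simp⟩
  obtain ⟨-, -, hval⟩ := exists_uniformiser_of_central hD
  obtain ⟨c, hc, hvol⟩ := exists_measure_labelSet h2 hl hl2 hE hμ hd.pos.ne' hD α hβ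
  have hl0 : l ≠ 0 := by
    rintro rfl
    exact hl ⟨0, map_zero _⟩
  have hC0 : (1 : D) ⊗ₜ[F] (algebraMap F E (2 * β⁻¹) * l) ≠ 0 := by
    have h0 : algebraMap F E (2 * β⁻¹) * l ≠ 0 :=
      mul_ne_zero ((map_ne_zero _).2 (mul_ne_zero h2 (inv_ne_zero hβ))) hl0
    exact ((isUnit_iff_ne_zero.2 h0).map
      (Algebra.TensorProduct.includeRight : E →ₐ[F] D ⊗[F] E)).ne_zero
  -- The constant C is a power of q, so C^s is a monomial in q^s and can be absorbed into the unit.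
  obtain ⟨b₀, hb₀⟩ := exists_algAbs_eq_zpow F hC0
  -- For e = 1 the factor 1 + Q⁻¹ is a nonzero constant rather than an L-factor, and also goes into
  -- the unit.
  set G : ℂ := if e = 0 then 1 else 1 + ((residueCard F : ℂ) ^ d)⁻¹ with hG
  have hG0 : G ≠ 0 := by
    rw [hG]
    split_ifs
    · exact one_ne_zero
    · have : (0 : ℝ) < 1 + ((residueCard F : ℝ) ^ d)⁻¹ := by positivity
      have h4 := Complex.ofReal_ne_zero.2 this.ne'
      push_cast at h4
      exact h4
  refine ⟨c * ((residueCard F : ℂ) ^ d) ^ (-n) * G,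
    mul_ne_zero (mul_ne_zero (by exact_mod_cast hc.ne') (zpow_ne_zero _ (pow_ne_zero _ hqC))) hG0,
    b₀ + 2 * d * n, fun s hs => ?_⟩
  obtain ⟨h1, h3⟩ := integral_of_volumes (μ := μ) (Q := (residueCard F : ℝ) ^ d)
    (a := fun x => algAbs F (coordU h2 hl hl2 hE α x))
    (b := fun x => algAbs F (coordV h2 hl hl2 hE β x)) (c := c)
    (C := algAbs F ((1 : D) ⊗ₜ[F] (algebraMap F E (2 * β⁻¹) * l)))
    (f := fun x => periodIntegrand D (uZero D h2 hl) s x.rep) hQ (fun x => algAbs_nonneg F _)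
    (fun x => by
      by_cases h0 : coordU h2 hl hl2 hE α x = 0
      · left
        rw [h0, algAbs_zero]
      · exact Or.inr (hval _ h0))
    (fun x => hval _ (coordV_ne_zero hβ x)) hc
    (fun j k => measurableSet_labelSet h2 hl hl2 hE α hβ _ (zpow_pos hQ0 k)) hvol
    (algAbs_pos F hC0) n e he hs
    (fun x => by
      rw [periodIntegrand_rep h2 hl hl2 hE hD hβ hlθ, hform])
  refine ⟨h1, h3.trans ?_⟩
  rw [div_eq_mul_inv, hη, tateL_one_eq, hb₀, zpow_cpow_eq hq0]
  have hY : (((residueCard F : ℝ) ^ d : ℝ) : ℂ) ^ (-2 * s) = (residueCard F : ℂ) ^ (-(2 * d * s)) := by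
    have := zpow_cpow_eq hq0 d (-2 * s)
    rw [zpow_natCast, zpow_natCast, Complex.ofReal_natCast, ← Complex.cpow_nat_mul] at this
    rw [this]
    congr 1
    ring
  have hY' : (residueCard F : ℂ) ^ (-(2 * d * s)) = ((residueCard F : ℂ) ^ s) ^ (-(2 * d : ℤ)) := by
    rw [← Complex.cpow_int_mul]
    congr 1
    push_cast
    ring
  rw [hY]
  push_cast
  have hz : (residueCard F : ℂ) ^ s ≠ 0 := by
    rw [Complex.cpow_ne_zero_iff]; exact Or.inl hqC
  have hpow : ((residueCard F : ℂ) ^ (-(2 * d * s))) ^ (-n) =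
      ((residueCard F : ℂ) ^ s) ^ (2 * d * n : ℤ) := by
    rw [hY', ← zpow_mul]
    congr 1
    ring
  rw [mul_zpow, hpow, zpow_add₀ hz, hG]
  rcases he with rfl | rfl
  · simp only [if_true]
    ring
  · simp only [one_ne_zero, if_false]
    ring

omit [FiniteDimensional F E] in
/-- The continuation of the period. -/
theorem meromorphic_continuation {d : ℕ} (hd : d ≠ 0) {e : ℤ}
    (hη : ∀ s : ℂ,
      (tateL F (etaChar F E) s)⁻¹ = if e = 0 then 1 + (residueCard F : ℂ) ^ (-s) else 1)
    {K : ℂ} (hK : K ≠ 0) (b : ℤ) :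
    let I : ℂ → ℂ := fun s => K * ((residueCard F : ℂ) ^ s) ^ b *
        (tateL F (fun _ => 1) (d * (2 * s - 1)) / tateL F (etaChar F E) (2 * d * s))
    MeromorphicNFOn I Set.univ ∧ I 0 ≠ 0 := by
  intro I
  have hqC := residueCard_complex_ne_zero F
  have hq := one_lt_residueCard_real F
  have hQ : (1 : ℝ) < (residueCard F : ℝ) ^ d := one_lt_pow₀ hq hd
  let Y : ℂ → ℂ := fun s => (residueCard F : ℂ) ^ (-(2 * d * s))
  let f : ℂ → ℂ := fun s => K * ((residueCard F : ℂ) ^ s) ^ b * if e = 0 then 1 + Y s else 1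
  let g : ℂ → ℂ := fun s => 1 - (residueCard F : ℂ) ^ d * Y s
  have hI : I = f / g := by
    funext s
    simp only [I, f, g, Y, Pi.div_apply]
    rw [div_eq_mul_inv (tateL _ _ _), hη, tateL_one_eq]
    ring
  have hcpow : ∀ h : ℂ → ℂ, ∀ s, AnalyticAt ℂ h s →
      AnalyticAt ℂ (fun s => (residueCard F : ℂ) ^ (h s)) s := fun h s hh =>
    analyticAt_const.cpow hh (by
      rw [Complex.natCast_mem_slitPlane]
      exact_mod_cast hqC)
  have hYa : ∀ s, AnalyticAt ℂ Y s := fun s =>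
    hcpow _ s ((analyticAt_const.mul analyticAt_id).neg)
  have hz : ∀ s : ℂ, (residueCard F : ℂ) ^ s ≠ 0 := fun s => by
    rw [Complex.cpow_ne_zero_iff]; exact Or.inl hqC
  have hfa : ∀ s, AnalyticAt ℂ f s := by
    intro s
    refine (analyticAt_const.mul ((hcpow id s analyticAt_id).zpow (hz s))).mul ?_
    split_ifs
    · exact analyticAt_const.add (hYa s)
    · exact analyticAt_const
  have hga : ∀ s, AnalyticAt ℂ g s := fun s => analyticAt_const.sub (analyticAt_const.mul (hYa s))
  have hf0 : ∀ s, 1 + Y s ≠ 0 → f s ≠ 0 := by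
    intro s h
    refine mul_ne_zero (mul_ne_zero hK (zpow_ne_zero _ (hz s))) ?_
    split_ifs
    · exact h
    · exact one_ne_zero
  refine ⟨fun s _ => ?_, ?_⟩
  · rw [hI]
    -- A quotient of analytic functions without common zeros is in normal form: with the convention
    -- that division by zero gives zero, its value at a pole is 0. A zero of the denominator has Y =
    -- Q⁻¹, and then 1 + Y is nonzero.
    refine MeromorphicNFOn.div (hfa s) (hga s).meromorphicNFAt ?_
    by_contra! h
    refine hf0 s ?_ h.2
    have h1 : (residueCard F : ℂ) ^ d * Y s = 1 := (sub_eq_zero.1 h.1).symm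
    have h3 : Y s = (((residueCard F : ℝ) ^ d)⁻¹ : ℝ) := by
      push_cast
      exact eq_inv_of_mul_eq_one_right h1
    rw [h3]
    have : (0 : ℝ) < 1 + ((residueCard F : ℝ) ^ d)⁻¹ := by positivity
    exact_mod_cast this.ne'
  · have hY0 : Y 0 = 1 := by simp [Y]
    rw [hI, Pi.div_apply]
    refine div_ne_zero (hf0 0 ?_) ?_
    · rw [hY0]; norm_num
    · simp only [g, hY0, mul_one]
      rw [sub_ne_zero]
      exact_mod_cast hQ.ne

end Period

end IntertwiningPeriod

end

/-! ### The main theorem -/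

open IntertwiningPeriod in
theorem mainTheorem5
    {F : Type*} [Field F] [ValuativeRel F] [TopologicalSpace F] [IsNonarchimedeanLocalField F]
    (h2 : (2 : F) ≠ 0)
    {E : Type*} [Field E] [Algebra F E] (hE : Module.finrank F E = 2)
    {D : Type*} [DivisionRing D] [Algebra F D] [Algebra.IsCentral F D]
    [TopologicalSpace D] [IsModuleTopology F D]
    (d : ℕ) (hd : Odd d) (hD : Module.finrank F D = d ^ 2)
    {l : E} (hl : l ∉ Set.range (algebraMap F E)) (hl2 : l ^ 2 ∈ Set.range (algebraMap F E)) :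
    -- `φ_s` is the spherical vector of `ind_P^G(δ_P ^ s)`, normalised by `φ_s(1) = 1`
    (∀ s : ℂ, sphericalSection F s (1 : GL2 (D ⊗[F] E)) = 1 ∧
      ∀ p ∈ borelSubgroup (D ⊗[F] E), ∀ k ∈ maxCompact F (D ⊗[F] E), ∀ g : GL2 (D ⊗[F] E),
        sphericalSection F s (p * g * k) =
          ((modulus F p : ℝ) : ℂ) ^ s * sphericalSection F s g) ∧
    -- the integrand is a function on `T \ H`, where `T = u₀⁻¹ P u₀ ∩ H`
    (∀ (s : ℂ), ∀ t ∈ stabilizerH D (uZero D h2 hl), ∀ h : GL2 D,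
      periodIntegrand D (uZero D h2 hl) s (t * h) = periodIntegrand D (uZero D h2 hl) s h) ∧
    -- `T \ H` carries an invariant measure
    (∃ μ : MeasureTheory.Measure (RightCosets (stabilizerH D (uZero D h2 hl))),
      IsInvariantQuotientMeasure μ) ∧
    ∀ μ : MeasureTheory.Measure (RightCosets (stabilizerH D (uZero D h2 hl))),
      IsInvariantQuotientMeasure μ →
      -- `I` is the meromorphic continuation of the period to the complex plane
      ∃ I : ℂ → ℂ, MeromorphicNFOn I Set.univ ∧
        (∃ σ : ℝ, ∀ s : ℂ, σ < s.re →
          MeasureTheory.Integrable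
            (fun x => periodIntegrand D (uZero D h2 hl) s x.rep) μ ∧
          I s = ∫ x, periodIntegrand D (uZero D h2 hl) s x.rep ∂μ) ∧
        (∃ ε : (laurentRing F)ˣ, ∀ s : ℂ,
          I s = (ε : laurentRing F).val s *
            (tateL F (fun _ => 1) (d * (2 * s - 1)) / tateL F (etaChar F E) (2 * d * s))) ∧
        I 0 ≠ 0 := by
  have hd0 : d ≠ 0 := hd.pos.ne'
  have : FiniteDimensional F D := Module.finite_of_finrank_pos (by rw [hD]; positivity)
  have : FiniteDimensional F E := Module.finite_of_finrank_pos (by omega)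
  have : IsDomain (TensorProduct F D E) := isDomain_tensor hE hd hD hl hl2
  have : IsTopologicalRing D := IsModuleTopology.isTopologicalRing F D
  have : T2Space D := t2Space_of_isModuleTopology F D
  have : LocallyCompactSpace D := locallyCompactSpace_of_isModuleTopology F D
  refine ⟨fun s => ⟨sphericalSection_one s, fun p hp k hk g => sphericalSection_mul s hp hk g⟩,
    fun s t ht h => periodIntegrand_mul h2 hl hE hl2 s ht h,
    exists_invariant_measure h2 hl hl2 hE hD, fun μ hμ => ?_⟩
  obtain ⟨K, hK, b, hint⟩ := integral_periodIntegrand h2 hE hd hD hl hl2 hμ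
  -- The generator is chosen anew, independently of the one behind `hint`; this is harmless because
  -- I is written in terms of L-factors only, and e merely records the shape of L(η, ·).
  obtain ⟨_, _, _, _, hcase⟩ := exists_orthogonal_generator (D := D) h2 hE hd hD hl hl2
  obtain ⟨_, e, _, _, hη⟩ := inv_tateL_etaChar hcase
  obtain ⟨hmero, hzero⟩ := meromorphic_continuation hd0 hη hK b
  obtain ⟨ε, hε⟩ := exists_laurentRing_unit F hK b
  exact ⟨_, hmero, ⟨1 / 2, fun s hs => ⟨(hint s hs).1, (hint s hs).2.symm⟩⟩,
    ⟨ε, fun s => by rw [hε]⟩, hzero⟩
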